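/- **Setting.** Let $\mathscr C\subset\mathbb R^2$ be compact with piecewise $C^1$ boundary: except at finitely many points, $\partial\mathscr C$ is a $C^1$ curve with $\mathscr C$ locally on one side of it and outward unit normal $\hat n$. Let $\Sigma_0,\Sigma_1$ be symmetric $2\times2$ matrices with $\Sigma_0\succ0$, $\Sigma_1\succeq0$; let $M\in C^0(\mathbb R^2;\mathbf{Sym}_2(\mathbb R))$ with $M(y)\succ 0$ for all $y$; let $\|\cdot\|_{2,\varepsilon}:\mathbb R^2\to[0,\infty)$ be continuous (a regularisation of the Euclidean norm, or that norm itself), and put $$G(y)=\Sigma_1\,\|M(y)y\|_{2,\varepsilon}+M(y)^2 .$$ For a rolling speed $V_r$ define $$\Sigma(v,s)=-\tfrac1{V_r(s)}\,\|M(V_r(s)v)V_r(s)v\|_{2,\varepsilon}\;G(V_r(s)v)^{-1}\Sigma_0,\qquad H(v,s)=-G(V_r(s)v)^{-1}M(V_r(s)v)^2 .$$ For a transport velocity $\bar V$ let $\mathscr L=\{x\in\partial\mathscr C:\bar V(x)\cdot\hat n(x)<0\}$ be the leading edge. Given a rigid slip velocity $\bar v(x,s)$, consider for $z(x,s)\in\mathbb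 R^2$ $$\partial_s z+(\bar V\cdot\nabla)z=\tilde\Sigma z+H(\bar v,s)\bar v\ \text{ in }\mathring{\mathscr C}\times(0,S),\qquad z=0\ \text{ on }\mathscr L\times(0,S),\qquad z(\cdot,0)=z_0,$$ in the following two cases. * *Standard linear model:* $\bar V=-(1,0)^{\mathrm T}$, $\tilde\Sigma=\Sigma(\bar v,s)$, relative velocity $\bar v_r=\bar v$. * *Linear model for large spin slips:* $\bar V(x)=-(\varepsilon_y,-\varepsilon_x)^{\mathrm T}+\varphi_1(x_2,-x_1)^{\mathrm T}$ with $\varepsilon_x^2+\varepsilon_y^2=1$ and $\varphi_1\in\mathbb R$; $\tilde\Sigma=\Sigma(\bar v,s)-H(\bar v,s)A_{\varphi_2}$, $\bar v_r=\bar v-A_{\varphi_2}z$, with $A_{\varphi_2}=\begin{pmatrix}0&-\varphi_2\\ \varphi_2&0\end{pmatrix}$, taken with $\varphi_2=0$. A classical solution is $z\in C^1([0,S];L^2(\mathring{\mathscr C};\mathbb R^2))\cap C^0([0,S];H^1(\mathring{\mathscr C};\mathbb R^2))$ satisfying these equations, the boundary condition being understood for traces. The total derivative is $\mathrm dz/\mathrm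 ds=\partial_sz+(\bar V\cdot\nabla)z$, and the force per unit of vertical load is $f=\Sigma_0z+V_r\Sigma_1\,\mathrm dz/\mathrm ds$. **Lemma (Passivity).** Let $p\in C^1(\mathscr C;\mathbb R_{\ge0})$ satisfy $\nabla\cdot(p\bar V)\le0$ on $\mathscr C$, and suppose that $M^2(y)G^{-1}(y)\Sigma_1\succeq0$ for all $y\in\mathbb R^2$. Then each of the two models (with its own $\bar V$ in the condition on $p$) is passive with storage function $$W(\zeta)=\tfrac12\iint_{\mathscr C}p\,\zeta^{\mathrm T}\Sigma_0\zeta\,\mathrm dx\ \ge0,\qquad \zeta\in L^2(\mathring{\mathscr C};\mathbb R^2).$$ That is, let $0<V_{\min}\le V_{\max}$. For every $S>0$, every $\bar v\in C^1(\mathscr C\times\mathbb R_{\ge0};\mathbb R^2)\cap L^\infty$, every rolling speed $V_r\in C^1(\mathbb R_{\ge0};[V_{\min},V_{\max}])$, and every classical solution $z$ on $[0,S]$ with $z(\cdot,0)=z_0$, the functions $f(\cdot,s)$, $\bar v(\cdot,s)$ and $\bar v_r(\cdot,s)$ lie in $L^2(\mathring{\mathscr C};\mathbb R^2)$ for all $s\in[0,S]$,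 the supply $s\mapsto-\langle pf(\cdot,s),\bar v(\cdot,s)\rangle_{L^2}$ is integrable on $[0,S]$, and for all $s\in[0,S]$ $$-\int_0^s\langle pf(\cdot,s'),\bar v_r(\cdot,s')\rangle_{L^2}\,\mathrm ds'=-\int_0^s\langle pf(\cdot,s'),\bar v(\cdot,s')\rangle_{L^2}\,\mathrm ds'\ \ge\ W(z(\cdot,s))-W(z_0).$$ -/

import Mathlib

open MeasureTheory Set Filter Topology
open scoped RealInnerProductSpace ContDiff

noncomputable section

namespace FrBD

/-- The Euclidean plane. -/
abbrev Plane : Type := EuclideanSpace ℝ (Fin 2)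

abbrev Mat2 : Type := Matrix (Fin 2) (Fin 2) ℝ

/-- The matrix-vector product on the Euclidean plane. -/
def act (A : Mat2) (v : Plane) : Plane := Matrix.toEuclideanCLM (𝕜 := ℝ) A v

/-! ### Contact area, outward normal, leading edge -/

/-- `n` is the outward unit normal to `C` at the boundary point `x`: near `x` the boundary is
`C¹` and `C` lies locally on one side of it, that is, `C = {φ ≤ 0}` near `x` for some `C¹` function
`φ` with `φ x = 0` and `∇φ x ≠ 0`, and `n = ∇φ x / ‖∇φ x‖`. -/
def IsOutwardUnitNormal (C : Set Plane) (x n : Plane) : Prop :=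
  x ∈ frontier C ∧ ∃ φ : Plane → ℝ,
    ContDiffAt ℝ 1 φ x ∧ φ x = 0 ∧ gradient φ x ≠ 0 ∧
    n = ‖gradient φ x‖⁻¹ • gradient φ x ∧
    ∀ᶠ y in 𝓝 x, (y ∈ C ↔ φ y ≤ 0)

/-- The boundary of `C` is `C¹`, with `C` locally on one side, except at finitely many points
(the corners). -/
def HasPiecewiseC1Boundary (C : Set Plane) : Prop :=
  {x ∈ frontier C | ¬ ∃ n, IsOutwardUnitNormal C x n}.Finite

/-- The leading edge (inflow boundary) of a fixed contact area `C` for the transport velocity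
`V`. -/
def leadingEdge (C : Set Plane) (V : Plane → Plane) : Set Plane :=
  {x ∈ frontier C | ∃ n, IsOutwardUnitNormal C x n ∧ ⟪V x, n⟫ < 0}

/-- The divergence of a plane vector field. -/
def divergence (F : Plane → Plane) (x : Plane) : ℝ :=
  ∑ i : Fin 2, (fderiv ℝ F x (EuclideanSpace.single i 1)) i

/-! ### Function spaces on the interior of the contact area -/

/-- Lebesgue measure on the interior of `C`. -/
abbrev areaMeasure (C : Set Plane) : Measure Plane := volume.restrict (interior C)

/-- `L²` of the interior of `C`, with values in the plane. -/
abbrev L2 (C : Set Plane) : Type := Lp Plane 2 (areaMeasure C)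

/-- `L²` of the interior of `C`, with values in the linear maps of the plane. -/
abbrev L2Grad (C : Set Plane) : Type := Lp (Plane →L[ℝ] Plane) 2 (areaMeasure C)

/-- `Du` is the weak derivative of `u` in the interior of `C`. For `u` and `Du` in `L²` this says
that `u` belongs to `H¹` of the interior. -/
def HasWeakDeriv (C : Set Plane) (u : L2 C) (Du : L2Grad C) : Prop :=
  ∀ φ : Plane → ℝ, ContDiff ℝ ∞ φ → HasCompactSupport φ → tsupport φ ⊆ interior C →
    ∀ e : Plane,
      ∫ x in interior C, (fderiv ℝ φ x e) • u x = - ∫ x in interior C, φ x • Du x e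

/-- The `H¹` function `u`, with weak derivative `Du`, has the trace `g` on the part `Γ` of the
boundary of `C`: locally near every point of `Γ`, `u` is an `H¹` limit of functions that are `C¹` up
to the boundary and whose boundary values tend to `g` in `L²(Γ)` for the arc length. -/
def HasTraceOn (C Γ : Set Plane) (u : L2 C) (Du : L2Grad C) (g : Plane → Plane) : Prop :=
  ∀ x ∈ Γ, ∃ r > (0 : ℝ), ∃ w : ℕ → Plane → Plane,
    (∀ k, ContDiff ℝ 1 (w k)) ∧
    Tendsto (fun k => eLpNorm (fun y => w k y - u y) 2
      (volume.restrict (interior C ∩ Metric.ball x r))) atTop (𝓝 0) ∧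
    Tendsto (fun k => eLpNorm (fun y => fderiv ℝ (w k) y - Du y) 2
      (volume.restrict (interior C ∩ Metric.ball x r))) atTop (𝓝 0) ∧
    Tendsto (fun k => eLpNorm (fun y => w k y - g y) 2
      ((Measure.hausdorffMeasure 1).restrict (Γ ∩ Metric.ball x r))) atTop (𝓝 0)

/-! ### The friction model -/

/-- The constitutive data: micro-stiffness `S0`, micro-damping `S1`, friction matrix `M`, and the
(regularised) Euclidean norm `nrm`. -/
structure FrictionData where
  S0 : Mat2
  S1 : Mat2
  M : Plane → Mat2
  nrm : Plane → ℝ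

/-- `G(y) = Σ₁ ‖M(y) y‖_ε + M(y)²`. -/
def FrictionData.G (D : FrictionData) (y : Plane) : Mat2 :=
  D.nrm (act (D.M y) y) • D.S1 + D.M y ^ 2

/-- `Σ(v, s)`, with `V` the rolling speed at `s`:
`-(1 / V) ‖M(V v) V v‖_ε G(V v)⁻¹ Σ₀`. -/
def FrictionData.SigmaMat (D : FrictionData) (V : ℝ) (v : Plane) : Mat2 :=
  -((1 / V * D.nrm (act (D.M (V • v)) (V • v))) • ((D.G (V • v))⁻¹ * D.S0))

/-- `H(v, s)`, with `V` the rolling speed at `s`: `-G(V v)⁻¹ M(V v)²`. -/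
def FrictionData.HMat (D : FrictionData) (V : ℝ) (v : Plane) : Mat2 :=
  -((D.G (V • v))⁻¹ * D.M (V • v) ^ 2)

/-- A linear rolling contact model: the nondimensional transport velocity, the matrix coefficient
of the bristle deflection, and the rigid relative velocity as a function of the deflection. The last
two depend on the rigid slip velocity `v` and on the rolling speed `Vr`. -/
structure RollingModel where
  transport : Plane → Plane
  coeff : (v : Plane → ℝ → Plane) → (Vr : ℝ → ℝ) → Plane → ℝ → Mat2
  relVel : (v : Plane → ℝ → Plane) → (z : Plane) → Plane → ℝ → Plane

/-- The standard linear model: transport velocity `-(1, 0)`, coefficient `Σ(v(x, s), s)`, relative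
velocity equal to the slip velocity. -/
def standardModel (D : FrictionData) : RollingModel where
  transport := fun _ => !₂[-1, 0]
  coeff := fun v Vr x s => D.SigmaMat (Vr s) (v x s)
  relVel := fun v _ x s => v x s

/-- The spin matrix `A_{φ₂}`. -/
def spinMat (φ₂ : ℝ) : Mat2 := !![0, -φ₂; φ₂, 0]

/-- The linear model for large spin slips: transport velocity
`-(ε_y, -ε_x) + (φ₁ y, -φ₁ x)`, coefficient `Σ(v(x, s), s) - H(v(x, s), s) A_{φ₂(s)}`, relative
velocity `v(x, s) - A_{φ₂(s)} z`. -/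
def largeSpinModel (D : FrictionData) (ε : Plane) (φ₁ : ℝ) (φ₂ : ℝ → ℝ) : RollingModel where
  transport := fun x => -!₂[ε 1, -ε 0] + act !![0, φ₁; -φ₁, 0] x
  coeff := fun v Vr x s =>
    D.SigmaMat (Vr s) (v x s) - D.HMat (Vr s) (v x s) * spinMat (φ₂ s)
  relVel := fun v z x s => v x s - act (spinMat (φ₂ s)) z

/-- The `s`-derivative of an `L²`-valued curve on `[0, S]` (one-sided at the end points). -/
def sDeriv {C : Set Plane} (S : ℝ) (z : ℝ → L2 C) (s : ℝ) : L2 C :=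
  derivWithin z (Icc 0 S) s

/-- The total derivative `dz/ds = ∂z/∂s + (V · ∇) z` along the transport velocity `V`. -/
def totalDeriv {C : Set Plane} (V : Plane → Plane) (S : ℝ) (z : ℝ → L2 C) (Dz : ℝ → L2Grad C)
    (s : ℝ) (x : Plane) : Plane :=
  sDeriv S z s x + Dz s x (V x)

/-- `z` (with spatial weak derivative `Dz`) is a classical solution on `[0, S]`, with initial datum
`z₀`, of the initial-boundary value problem
`∂z/∂s + (V · ∇) z = Σ̃ z + H(v, s) v` in the interior of `C`, `z = 0` on the leading edge:
it belongs to `C¹([0, S]; L²) ∩ C⁰([0, S]; H¹)`. -/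
structure IsClassicalSolution (D : FrictionData) (mdl : RollingModel) (C : Set Plane)
    (v : Plane → ℝ → Plane) (Vr : ℝ → ℝ) (S : ℝ) (z₀ : L2 C)
    (z : ℝ → L2 C) (Dz : ℝ → L2Grad C) : Prop where
  contDiffOn : ContDiffOn ℝ 1 z (Icc 0 S)
  weakDeriv : ∀ s ∈ Icc 0 S, HasWeakDeriv C (z s) (Dz s)
  continuousOn_deriv : ContinuousOn Dz (Icc 0 S)
  pde : ∀ s ∈ Ioo 0 S, ∀ᵐ x ∂(areaMeasure C),
    totalDeriv mdl.transport S z Dz s x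
      = act (mdl.coeff v Vr x s) (z s x) + act (D.HMat (Vr s) (v x s)) (v x s)
  boundary : ∀ s ∈ Ioo 0 S,
    HasTraceOn C (leadingEdge C mdl.transport) (z s) (Dz s) (fun _ => 0)
  initial : z 0 = z₀

/-- The force per unit of vertical load, `f = Σ₀ z + V_r Σ₁ dz/ds`. -/
def bristleForce {C : Set Plane} (D : FrictionData) (V : Plane → Plane) (Vr : ℝ → ℝ) (S : ℝ)
    (z : ℝ → L2 C) (Dz : ℝ → L2Grad C) (s : ℝ) (x : Plane) : Plane :=
  act D.S0 (z s x) + Vr s • act D.S1 (totalDeriv V S z Dz s x)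

/-! ### Dissipativity and passivity -/

/-- Admissible inputs: `v ∈ C¹(C × [0, ∞)) ∩ L^∞`, and a `C¹` rolling speed with values in
`[Vmin, Vmax]`. -/
structure IsAdmissibleInput (C : Set Plane) (Vmin Vmax : ℝ) (v : Plane → ℝ → Plane)
    (Vr : ℝ → ℝ) : Prop where
  slip_contDiffOn : ContDiffOn ℝ 1 (fun q : Plane × ℝ => v q.1 q.2) (C ×ˢ Ici 0)
  slip_bounded : ∃ B : ℝ, ∀ x ∈ C, ∀ s, 0 ≤ s → ‖v x s‖ ≤ B
  speed_contDiffOn : ContDiffOn ℝ 1 Vr (Ici 0)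
  speed_mem : ∀ s, 0 ≤ s → Vr s ∈ Icc Vmin Vmax

/-- The model is dissipative with supply rate `w` and storage function `W`: the storage function is
nonnegative and, along every classical solution under admissible inputs, the arguments of the supply
rate are in `L²`, the supply is integrable in `s`, it is the same for the relative velocity as for
the slip velocity, and it bounds the increase of the stored energy. -/
def IsDissipativeWith (D : FrictionData) (mdl : RollingModel) (C : Set Plane) (Vmin Vmax : ℝ)
    (w : (Plane → Plane) → (Plane → Plane) → ℝ) (W : L2 C → ℝ) : Prop :=
  (∀ ζ : L2 C, 0 ≤ W ζ) ∧
  ∀ (v : Plane → ℝ → Plane) (Vr : ℝ → ℝ), IsAdmissibleInput C Vmin Vmax v Vr →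
  ∀ S > (0 : ℝ), ∀ (z₀ : L2 C) (z : ℝ → L2 C) (Dz : ℝ → L2Grad C),
  IsClassicalSolution D mdl C v Vr S z₀ z Dz →
    (∀ s ∈ Icc 0 S,
      MemLp (bristleForce D mdl.transport Vr S z Dz s) 2 (areaMeasure C) ∧
      MemLp (fun x => v x s) 2 (areaMeasure C) ∧
      MemLp (fun x => mdl.relVel v (z s x) x s) 2 (areaMeasure C)) ∧
    IntervalIntegrable
      (fun s => w (bristleForce D mdl.transport Vr S z Dz s) (fun x => -v x s)) volume 0 S ∧
    ∀ s ∈ Icc 0 S,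
      ∫ t in (0 : ℝ)..s, w (bristleForce D mdl.transport Vr S z Dz t)
          (fun x => -mdl.relVel v (z t x) x t)
        = ∫ t in (0 : ℝ)..s, w (bristleForce D mdl.transport Vr S z Dz t) (fun x => -v x t) ∧
      W (z s) - W z₀
        ≤ ∫ t in (0 : ℝ)..s, w (bristleForce D mdl.transport Vr S z Dz t) (fun x => -v x t)

/-- The supply rate of passivity: `w(f, u) = ⟨p f, u⟩` in `L²`, so that
`w(f, -v) = -⟨p f, v⟩`. -/
def powerSupply (C : Set Plane) (p : Plane → ℝ) (f u : Plane → Plane) : ℝ :=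
  ∫ x in interior C, ⟪p x • f x, u x⟫

/-- The model is passive with storage function `W`. -/
def IsPassiveWith (D : FrictionData) (mdl : RollingModel) (C : Set Plane) (p : Plane → ℝ)
    (Vmin Vmax : ℝ) (W : L2 C → ℝ) : Prop :=
  IsDissipativeWith D mdl C Vmin Vmax (powerSupply C p) W

/-- The stored energy `W(ζ) = ½ ∬ p ζᵀ Σ₀ ζ`. -/
def storedEnergy (D : FrictionData) (C : Set Plane) (p : Plane → ℝ) (ζ : L2 C) : ℝ :=
  1 / 2 * ∫ x in interior C, p x * ⟪ζ x, act D.S0 (ζ x)⟫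

end FrBD

end

/-! Passivity comes from a pointwise power inequality, a transport inequality in the plane, and
integration in `s`.

Pointwise, let `w = dz/ds` and `ν = ‖M(y)y‖_ε` with `y = V v`. Multiplying the bristle equation by
`G = ν Σ₁ + M²` and regrouping gives `M² (w + v) = -(ν / V) f`, where `f = Σ₀ z + V Σ₁ w`. As `M²`
is positive definite, `⟪f, w + v⟫ ≤ 0`: for `ν > 0` by pairing with `w + v`, for `ν = 0` because
then `w = -v`. Since `⟪Σ₁ w, w⟫ ≥ 0`, this leaves `⟪Σ₀ z, w⟫ ≤ -⟪f, v⟫`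
(`inner_elastic_le_neg_inner_force_slip`). Weighting by `p` and integrating over the contact area
bounds `⟨p Σ₀ z, ∂ₛz⟩ + ⟨p Σ₀ z, (V·∇)z⟩` by the supply. The first term is `dW/ds`, so it remains to
see that the second is nonnegative (`integral_inner_transport_nonneg`).

Formally the second term is half of `∮ p (V·n) q - ∫ div(pV) q`, with `q = zᵀ Σ₀ z`. The volume part
has the right sign by the condition on `p`, and the boundary part is outgoing except on the leading
edge, where `z = 0`. The work is to justify this when `z` is only `H¹`, has a trace only locally on
the leading edge, and the domain may have arbitrary corners. No boundary integral is ever formed.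
For a `C¹` function `g`, `weakFlux` is the volume integral of `div(g B(u) F)`, with `F = pV` and `B`
a bounded truncation of the quadratic form. It vanishes when `g` is compactly supported in the
interior, by the chain rule for weak derivatives.

In a boundary chart `{φ ≤ 0}`, `g` is cut off at depth `t` by a step function of `-φ/t`. As `t → 0`
the flux is recovered as the limit of an average over the layer `-2t ≤ φ ≤ -t`. There the inflow is
either slow, or close to the leading edge, where the zero trace makes the mean square of `u` over
the layer `o(t)` (`HasTraceOn.tendsto_lintegral_strip`). Hence the flux is nonnegative
(`IsBoundaryChart.weakFlux_nonneg`). A partition of unity makes this global away from the corners.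
The corners are removed by cutoffs with gradients small in `L¹`, which suffices because `B` is
bounded. Finally the truncation is lifted by dominated convergence. -/

section

/-! ### Convergence of mollifications in `L¹` -/

open scoped Convolution

/-- A Scheffé-type argument for majorants that vary with `n` but have constant mass. The function `g
n + ‖f‖ - ‖F n - f‖` is nonnegative and tends to `2 ‖f‖`. Cut at height `2 ‖f‖` it converges in mean
by domination, which forces the mass of `‖F n - f‖` to vanish. -/
theorem tendsto_integral_norm_sub_of_norm_le {α E : Type*} [MeasurableSpace α]
    [NormedAddCommGroup E] {μ : Measure α} {f : α → E} {F : ℕ → α → E} {g : ℕ → α → ℝ}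
    (hf : Integrable f μ) (hF : ∀ n, Integrable (F n) μ) (hg : ∀ n, Integrable (g n) μ)
    (hbound : ∀ n, ∀ᵐ x ∂μ, ‖F n x‖ ≤ g n x)
    (hFlim : ∀ᵐ x ∂μ, Tendsto (fun n => F n x) atTop (𝓝 (f x)))
    (hglim : ∀ᵐ x ∂μ, Tendsto (fun n => g n x) atTop (𝓝 ‖f x‖))
    (hint : ∀ n, ∫ x, g n x ∂μ = ∫ x, ‖f x‖ ∂μ) :
    Tendsto (fun n => ∫ x, ‖F n x - f x‖ ∂μ) atTop (𝓝 0) := by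
  set h : ℕ → α → ℝ := fun n x => g n x + ‖f x‖ - ‖F n x - f x‖ with hh
  have hhint : ∀ n, Integrable (h n) μ := fun n =>
    ((hg n).add hf.norm).sub ((hF n).sub hf).norm
  have h2f : Integrable (fun x => 2 * ‖f x‖) μ := hf.norm.const_mul 2
  have hmin : Tendsto (fun n => ∫ x, min (h n x) (2 * ‖f x‖) ∂μ) atTop
      (𝓝 (∫ x, 2 * ‖f x‖ ∂μ)) := by
    refine tendsto_integral_of_dominated_convergence (fun x => 2 * ‖f x‖)
      (fun n => ((hhint n).inf h2f).aestronglyMeasurable) h2f ?_ ?_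
    · intro n
      filter_upwards [hbound n] with x hx
      have h0 : 0 ≤ h n x := by
        have := norm_sub_le (F n x) (f x)
        simp only [hh]; linarith
      rw [Real.norm_of_nonneg (le_min h0 (by positivity))]
      exact min_le_right _ _
    · filter_upwards [hFlim, hglim] with x h1 h2
      have h3 : Tendsto (fun n => h n x) atTop (𝓝 (‖f x‖ + ‖f x‖ - ‖f x - f x‖)) :=
        (h2.add_const _).sub (h1.sub_const _).norm
      have h4 := h3.min (tendsto_const_nhds (x := 2 * ‖f x‖))
      convert h4 using 2
      simp [two_mul]
  have hub : Tendsto (fun n => 2 * ∫ x, ‖f x‖ ∂μ - ∫ x, min (h n x) (2 * ‖f x‖) ∂μ) atTop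
      (𝓝 0) := by
    have := hmin.const_sub (2 * ∫ x, ‖f x‖ ∂μ)
    rwa [integral_const_mul, sub_self] at this
  refine squeeze_zero (fun n => integral_nonneg fun x => norm_nonneg _) (fun n => ?_) hub
  have h1 : ∫ x, min (h n x) (2 * ‖f x‖) ∂μ ≤ ∫ x, h n x ∂μ :=
    integral_mono ((hhint n).inf h2f) (hhint n) fun x => min_le_left _ _
  have h2 : ∫ x, h n x ∂μ = ∫ x, g n x ∂μ + ∫ x, ‖f x‖ ∂μ - ∫ x, ‖F n x - f x‖ ∂μ := by
    have h3 := integral_sub (f := fun x => g n x + ‖f x‖) (g := fun x => ‖F n x - f x‖)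
      ((hg n).add hf.norm) ((hF n).sub hf).norm
    have h4 := integral_add (f := g n) (g := fun x => ‖f x‖) (hg n) hf.norm
    simp only [hh]
    rw [h3, h4]
  rw [hint n] at h2
  linarith

/-- The mollification of `‖f‖` dominates the norm of the mollification of `f` and keeps the mass of
`‖f‖`. Both converge almost everywhere by Lebesgue differentiation, which needs the ratio of the
bump radii bounded. -/
theorem tendsto_integral_norm_convolution_sub {G E : Type*} [NormedAddCommGroup G]
    [NormedSpace ℝ G] [MeasurableSpace G] [BorelSpace G] [FiniteDimensional ℝ G]
    [NormedAddCommGroup E] [NormedSpace ℝ E] [CompleteSpace E]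
    {μ : Measure G} [μ.IsAddHaarMeasure] {f : G → E} (hf : Integrable f μ)
    {φ : ℕ → ContDiffBump (0 : G)} {K : ℝ}
    (hφ : Tendsto (fun i => (φ i).rOut) atTop (𝓝 0))
    (h'φ : ∀ᶠ i in atTop, (φ i).rOut ≤ K * (φ i).rIn) :
    Tendsto (fun n => ∫ x, ‖((φ n).normed μ ⋆[ContinuousLinearMap.lsmul ℝ ℝ, μ] f) x - f x‖ ∂μ)
      atTop (𝓝 0) := by
  have hint : ∀ n, Integrable ((φ n).normed μ) μ := fun n => (φ n).integrable_normed
  refine tendsto_integral_norm_sub_of_norm_le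
    (g := fun n => (φ n).normed μ ⋆[ContinuousLinearMap.lsmul ℝ ℝ, μ] fun x => ‖f x‖) hf
    (fun n => (hint n).integrable_convolution _ hf)
    (fun n => (hint n).integrable_convolution _ hf.norm) (fun n => ?_)
    (ContDiffBump.ae_convolution_tendsto_right_of_locallyIntegrable hφ h'φ hf.locallyIntegrable)
    (ContDiffBump.ae_convolution_tendsto_right_of_locallyIntegrable hφ h'φ
      hf.norm.locallyIntegrable) (fun n => ?_)
  · refine Eventually.of_forall fun x => ?_
    refine (norm_integral_le_integral_norm _).trans (le_of_eq ?_)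
    refine integral_congr_ae (Eventually.of_forall fun t => ?_)
    simp [norm_smul, Real.norm_of_nonneg ((φ n).nonneg_normed t)]
  · rw [integral_convolution _ (hint n) hf.norm]
    simp [(φ n).integral_normed]

end

section

/-! ### Chain rule for weak derivatives by mollification -/

open scoped Convolution

theorem norm_sub_le_of_norm_fderiv_le {E F : Type*} [NormedAddCommGroup E] [NormedSpace ℝ E]
    [NormedAddCommGroup F] [NormedSpace ℝ F] {B : E → F} (hB : Differentiable ℝ B) {L : ℝ}
    (hL : ∀ y, ‖fderiv ℝ B y‖ ≤ L) (x y : E) : ‖B x - B y‖ ≤ L * ‖x - y‖ :=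
  convex_univ.norm_image_sub_le_of_norm_fderiv_le (fun z _ => hB z) (fun z _ => hL z)
    (mem_univ y) (mem_univ x)

/-- The chain rule for a function `f` all of whose mollifications eventually have the mollified
derivative `Df` near the support of the test function. -/
theorem integral_fderiv_mul_comp_of_convolution {G E : Type*} [NormedAddCommGroup G]
    [NormedSpace ℝ G] [MeasurableSpace G] [BorelSpace G] [FiniteDimensional ℝ G]
    [NormedAddCommGroup E] [NormedSpace ℝ E] [CompleteSpace E]
    {μ : Measure G} [μ.IsAddHaarMeasure] {f : G → E} {Df : G → G →L[ℝ] E}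
    (hf : Integrable f μ) (hDf : Integrable Df μ) {φ : ℕ → ContDiffBump (0 : G)} {K : ℝ}
    (hφ : Tendsto (fun i => (φ i).rOut) atTop (𝓝 0))
    (h'φ : ∀ᶠ i in atTop, (φ i).rOut ≤ K * (φ i).rIn)
    {ψ : G → ℝ} (hψ : ContDiff ℝ 1 ψ) (hψc : HasCompactSupport ψ)
    (hder : ∀ᶠ n in atTop, ∀ x ∈ tsupport ψ,
      fderiv ℝ ((φ n).normed μ ⋆[ContinuousLinearMap.lsmul ℝ ℝ, μ] f) x
        = ((φ n).normed μ ⋆[ContinuousLinearMap.lsmul ℝ ℝ, μ] Df) x)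
    {B : E → ℝ} (hB : ContDiff ℝ 1 B) {L : ℝ} (hL : ∀ y, ‖fderiv ℝ B y‖ ≤ L) (e : G) :
    ∫ x, fderiv ℝ ψ x e * B (f x) ∂μ = - ∫ x, ψ x * fderiv ℝ B (f x) (Df x e) ∂μ := by
  set w : ℕ → G → E := fun n => (φ n).normed μ ⋆[ContinuousLinearMap.lsmul ℝ ℝ, μ] f with hw
  set D : ℕ → G → G →L[ℝ] E :=
    fun n => (φ n).normed μ ⋆[ContinuousLinearMap.lsmul ℝ ℝ, μ] Df with hD
  have hφint : ∀ n, Integrable ((φ n).normed μ) μ := fun n => (φ n).integrable_normed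
  have hL0 : 0 ≤ L := (norm_nonneg _).trans (hL 0)
  have hwint : ∀ n, Integrable (w n) μ := fun n => (hφint n).integrable_convolution _ hf
  have hDint : ∀ n, Integrable (D n) μ := fun n => (hφint n).integrable_convolution _ hDf
  have hwC : ∀ n, ContDiff ℝ 1 (w n) := fun n =>
    (φ n).hasCompactSupport_normed.contDiff_convolution_left _ (φ n).contDiff_normed
      hf.locallyIntegrable
  have hwlim : Tendsto (fun n => ∫ x, ‖w n x - f x‖ ∂μ) atTop (𝓝 0) :=
    tendsto_integral_norm_convolution_sub hf hφ h'φ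
  have hDlim : Tendsto (fun n => ∫ x, ‖D n x - Df x‖ ∂μ) atTop (𝓝 0) :=
    tendsto_integral_norm_convolution_sub hDf hφ h'φ
  have hwae : ∀ᵐ x ∂μ, Tendsto (fun n => w n x) atTop (𝓝 (f x)) :=
    ContDiffBump.ae_convolution_tendsto_right_of_locallyIntegrable hφ h'φ hf.locallyIntegrable
  have hψ' : Continuous fun x => fderiv ℝ ψ x e :=
    (hψ.continuous_fderiv one_ne_zero).clm_apply continuous_const
  have hψ'c : HasCompactSupport fun x => fderiv ℝ ψ x e := hψc.fderiv_apply ℝ e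
  obtain ⟨M₁, hM₁⟩ := hψ'c.exists_bound_of_continuous hψ'
  obtain ⟨M₀, hM₀⟩ := hψc.exists_bound_of_continuous hψ.continuous
  have hM₁0 : 0 ≤ M₁ := (norm_nonneg _).trans (hM₁ 0)
  have hM₀0 : 0 ≤ M₀ := (norm_nonneg _).trans (hM₀ 0)
  have hBd : Differentiable ℝ B := hB.differentiable one_ne_zero
  have hB' : Continuous (fderiv ℝ B) := hB.continuous_fderiv one_ne_zero
  have hBlip := norm_sub_le_of_norm_fderiv_le hBd hL
  have hX : ∀ g : G → E, AEStronglyMeasurable g μ → Integrable g μ →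
      Integrable (fun x => fderiv ℝ ψ x e * B (g x)) μ := by
    intro g hg hgi
    have h1 : Integrable (fun x => fderiv ℝ ψ x e * B 0) μ :=
      (hψ'.integrable_of_hasCompactSupport hψ'c).mul_const _
    have h2 : Integrable (fun x => fderiv ℝ ψ x e * (B (g x) - B 0)) μ := by
      refine (hgi.norm.const_mul (M₁ * L)).mono'
        (hψ'.aestronglyMeasurable.mul
          ((hB.continuous.comp_aestronglyMeasurable hg).sub aestronglyMeasurable_const))
        (Eventually.of_forall fun x => ?_)
      rw [norm_mul, mul_assoc]
      have := hBlip (g x) 0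
      rw [sub_zero] at this
      exact mul_le_mul (hM₁ x) this (norm_nonneg _) hM₁0
    exact (h1.add h2).congr (Eventually.of_forall fun x => by simp only [Pi.add_apply]; ring)
  have hY : ∀ (g : G → E) (T : G → G →L[ℝ] E), AEStronglyMeasurable g μ → Integrable T μ →
      Integrable (fun x => ψ x * fderiv ℝ B (g x) (T x e)) μ := by
    intro g T hg hT
    refine ((hT.norm.const_mul (M₀ * L)).mul_const ‖e‖).mono' ?_ (Eventually.of_forall fun x => ?_)
    · refine hψ.continuous.aestronglyMeasurable.mul ?_
      exact isBoundedBilinearMap_apply.continuous.comp_aestronglyMeasurable₂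
        (hB'.comp_aestronglyMeasurable hg) (hT.aestronglyMeasurable.apply_continuousLinearMap e)
    · rw [norm_mul, mul_assoc, mul_assoc]
      refine mul_le_mul (hM₀ x) ?_ (norm_nonneg _) hM₀0
      exact (ContinuousLinearMap.le_opNorm _ _).trans
        (mul_le_mul (hL _) ((T x).le_opNorm e) (norm_nonneg _) hL0)
  have hlimX : Tendsto (fun n => ∫ x, fderiv ℝ ψ x e * B (w n x) ∂μ) atTop
      (𝓝 (∫ x, fderiv ℝ ψ x e * B (f x) ∂μ)) := by
    rw [tendsto_iff_norm_sub_tendsto_zero]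
    refine squeeze_zero (fun n => norm_nonneg _) (fun n => ?_)
      (by simpa using hwlim.const_mul (M₁ * L))
    rw [← integral_sub (hX _ (hwint n).aestronglyMeasurable (hwint n))
      (hX _ hf.aestronglyMeasurable hf), ← integral_const_mul]
    refine norm_integral_le_of_norm_le (((hwint n).sub hf).norm.const_mul _)
      (Eventually.of_forall fun x => ?_)
    rw [← mul_sub, norm_mul, mul_assoc]
    exact mul_le_mul (hM₁ x) (hBlip _ _) (norm_nonneg _) hM₁0
  -- The weak derivative is held fixed here and only the base point varies, so almost everywhere
  -- convergence and domination suffice. The mollified derivative is then exchanged for the fixed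
  -- one by `L¹` convergence, as the gradient of `B` is bounded.
  have hlimZ : Tendsto (fun n => ∫ x, ψ x * fderiv ℝ B (w n x) (Df x e) ∂μ) atTop
      (𝓝 (∫ x, ψ x * fderiv ℝ B (f x) (Df x e) ∂μ)) := by
    refine tendsto_integral_of_dominated_convergence (fun x => M₀ * L * ‖Df x‖ * ‖e‖)
      (fun n => (hY _ _ (hwint n).aestronglyMeasurable hDf).aestronglyMeasurable)
      ((hDf.norm.const_mul (M₀ * L)).mul_const ‖e‖)
      (fun n => Eventually.of_forall fun x => ?_) ?_
    · rw [norm_mul, mul_assoc, mul_assoc]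
      refine mul_le_mul (hM₀ x) ?_ (norm_nonneg _) hM₀0
      exact (ContinuousLinearMap.le_opNorm _ _).trans
        (mul_le_mul (hL _) ((Df x).le_opNorm e) (norm_nonneg _) hL0)
    · filter_upwards [hwae] with x hx
      have h1 : Tendsto (fun n => fderiv ℝ B (w n x)) atTop (𝓝 (fderiv ℝ B (f x))) :=
        (hB'.tendsto _).comp hx
      exact (((ContinuousLinearMap.apply ℝ ℝ (Df x e)).continuous.tendsto _).comp h1).const_mul _
  have hlimY : Tendsto (fun n => ∫ x, ψ x * fderiv ℝ B (w n x) (D n x e) ∂μ) atTop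
      (𝓝 (∫ x, ψ x * fderiv ℝ B (f x) (Df x e) ∂μ)) := by
    refine tendsto_of_tendsto_of_dist hlimZ ?_
    refine squeeze_zero (fun n => dist_nonneg) (fun n => ?_)
      (by simpa using (hDlim.const_mul (M₀ * L)).mul_const ‖e‖)
    rw [dist_eq_norm, ← integral_sub (hY _ _ (hwint n).aestronglyMeasurable hDf)
      (hY _ _ (hwint n).aestronglyMeasurable (hDint n)), ← integral_const_mul,
      ← integral_mul_const]
    refine norm_integral_le_of_norm_le ((((hDint n).sub hDf).norm.const_mul _).mul_const _)
      (Eventually.of_forall fun x => ?_)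
    rw [← mul_sub, ← map_sub, ← sub_apply, norm_mul, mul_assoc, mul_assoc]
    refine mul_le_mul (hM₀ x) ?_ (norm_nonneg _) hM₀0
    refine (ContinuousLinearMap.le_opNorm _ _).trans
      (mul_le_mul (hL _) ?_ (norm_nonneg _) hL0)
    rw [norm_sub_rev]
    exact ContinuousLinearMap.le_opNorm _ e
  -- For a mollification the identity is the classical chain rule and integration by parts. The two
  -- derivatives need to agree only on the support of `ψ`.
  have heq : ∀ᶠ n in atTop, ∫ x, fderiv ℝ ψ x e * B (w n x) ∂μ
      = - ∫ x, ψ x * fderiv ℝ B (w n x) (D n x e) ∂μ := by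
    filter_upwards [hder] with n hn
    have hBw : Differentiable ℝ fun x => B (w n x) :=
      hBd.comp ((hwC n).differentiable one_ne_zero)
    have key : ∀ x, ψ x * fderiv ℝ B (w n x) (D n x e)
        = ψ x * fderiv ℝ (fun x => B (w n x)) x e := by
      intro x
      by_cases hx : x ∈ tsupport ψ
      · have h1 : fderiv ℝ (fun x => B (w n x)) x = (fderiv ℝ B (w n x)).comp (D n x) := by
          rw [hD]
          dsimp only
          rw [← hn x hx]
          exact fderiv_comp x (hBd _) ((hwC n).differentiable one_ne_zero x)
        rw [h1]; rfl
      · simp [image_eq_zero_of_notMem_tsupport hx]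
    simp_rw [key]
    have h2 : Integrable (fun x => ψ x * fderiv ℝ (fun x => B (w n x)) x e) μ := by
      simp_rw [← key]
      exact hY _ _ (hwint n).aestronglyMeasurable (hDint n)
    rw [integral_mul_fderiv_eq_neg_fderiv_mul_of_integrable
      (hX _ (hwint n).aestronglyMeasurable (hwint n)) h2 ?_
      (fun x _ => hψ.differentiable one_ne_zero x) (fun x _ => hBw x), neg_neg]
    exact (hψ.continuous.mul (hB.continuous.comp (hwC n).continuous)).integrable_of_hasCompactSupport
      hψc.mul_right
  exact tendsto_nhds_unique hlimX ((hlimY.neg).congr' (heq.mono fun n hn => hn.symm))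

namespace FrBD

/-- The derivative of the convolution falls on the mollifier. Its translate `y ↦ φ (x - y)` is a
legitimate test function as soon as the closed ball around `x` stays in the interior, and the two
sign changes cancel. -/
theorem HasWeakDeriv.fderiv_convolution {C : Set Plane} {u : L2 C} {Du : L2Grad C}
    (h : HasWeakDeriv C u Du) (hu : Integrable ((interior C).indicator u) volume)
    (hDu : Integrable ((interior C).indicator Du) volume)
    (φ : ContDiffBump (0 : Plane)) {x : Plane} (hx : Metric.closedBall x φ.rOut ⊆ interior C) :
    fderiv ℝ (φ.normed volume ⋆[ContinuousLinearMap.lsmul ℝ ℝ] (interior C).indicator u) x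
      = (φ.normed volume ⋆[ContinuousLinearMap.lsmul ℝ ℝ] (interior C).indicator Du) x := by
  have hφC : ContDiff ℝ ∞ (φ.normed (volume : Measure Plane)) := φ.contDiff_normed
  have hφC1 : ContDiff ℝ 1 (φ.normed (volume : Measure Plane)) := φ.contDiff_normed
  rw [(φ.hasCompactSupport_normed.hasFDerivAt_convolution_left
    (ContinuousLinearMap.lsmul ℝ ℝ) hφC1 hu.locallyIntegrable x).fderiv]
  have hmeas : MeasurableSet (interior C) := isOpen_interior.measurableSet
  ext1 e
  set χ : Plane → ℝ := fun y => φ.normed volume (x - y) with hχ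
  have hχC : ContDiff ℝ ∞ χ := hφC.comp (contDiff_const.sub contDiff_id)
  have hsupp : Function.support χ ⊆ Metric.ball x φ.rOut := by
    intro y hy
    have : x - y ∈ Function.support (φ.normed (volume : Measure Plane)) := hy
    rw [φ.support_normed_eq] at this
    rw [Metric.mem_ball, dist_comm, dist_eq_norm]
    simpa using this
  have htsupp : tsupport χ ⊆ Metric.closedBall x φ.rOut :=
    (closure_mono hsupp).trans Metric.closure_ball_subset_closedBall
  have hcomp : HasCompactSupport χ :=
    HasCompactSupport.of_support_subset_isCompact (isCompact_closedBall x φ.rOut)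
      (hsupp.trans Metric.ball_subset_closedBall)
  have hχ' : ∀ y, fderiv ℝ χ y e = - fderiv ℝ (φ.normed volume) (x - y) e := by
    intro y
    have h1 : HasFDerivAt χ ((fderiv ℝ (φ.normed volume) (x - y)).comp
        (-ContinuousLinearMap.id ℝ Plane)) y :=
      ((hφC1.differentiable one_ne_zero (x - y)).hasFDerivAt).comp y
        ((hasFDerivAt_id y).const_sub x)
    rw [h1.fderiv]; simp
  have hw := h χ hχC hcomp (htsupp.trans hx) e
  have hc1 : ConvolutionExistsAt (fderiv ℝ (φ.normed volume)) ((interior C).indicator u) x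
      ((ContinuousLinearMap.lsmul ℝ ℝ : ℝ →L[ℝ] Plane →L[ℝ] Plane).precompL Plane) volume :=
    (φ.hasCompactSupport_normed.fderiv ℝ).convolutionExists_left _
      (hφC1.continuous_fderiv one_ne_zero) hu.locallyIntegrable x
  have hc2 : ConvolutionExistsAt (φ.normed volume) ((interior C).indicator Du) x
      (ContinuousLinearMap.lsmul ℝ ℝ) volume :=
    φ.hasCompactSupport_normed.convolutionExists_left _ hφC1.continuous hDu.locallyIntegrable x
  rw [convolution_eq_swap, convolution_eq_swap,
    ContinuousLinearMap.integral_apply hc1.integrable_swap,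
    ContinuousLinearMap.integral_apply hc2.integrable_swap]
  have e1 : ∀ y, ((ContinuousLinearMap.lsmul ℝ ℝ : ℝ →L[ℝ] Plane →L[ℝ] Plane).precompL Plane
      (fderiv ℝ (φ.normed volume) (x - y)) ((interior C).indicator u y)) e
      = (interior C).indicator (fun y => - (fderiv ℝ χ y e • u y)) y := by
    intro y
    by_cases hy : y ∈ interior C <;> simp [hy, hχ', ContinuousLinearMap.precompL]
  have e2 : ∀ y, (ContinuousLinearMap.lsmul ℝ ℝ (φ.normed volume (x - y))
      ((interior C).indicator Du y)) e = (interior C).indicator (fun y => χ y • Du y e) y := by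
    intro y
    by_cases hy : y ∈ interior C <;> simp [hy, hχ]
  simp_rw [e1, e2]
  rw [integral_indicator hmeas, integral_indicator hmeas, integral_neg, hw, neg_neg]

end FrBD

end

/-! ### The weak flux and its vanishing for interior test functions -/

noncomputable section

namespace FrBD

theorem isFiniteMeasure_areaMeasure {C : Set Plane} (hC : IsCompact C) :
    IsFiniteMeasure (areaMeasure C) :=
  isFiniteMeasure_restrict.2 ((measure_mono interior_subset).trans_lt hC.measure_lt_top).ne

theorem HasWeakDeriv.integral_fderiv_mul_comp {C : Set Plane} (hC : IsCompact C) {u : L2 C}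
    {Du : L2Grad C} (h : HasWeakDeriv C u Du) {ψ : Plane → ℝ} (hψ : ContDiff ℝ 1 ψ)
    (hψc : HasCompactSupport ψ) (hψs : tsupport ψ ⊆ interior C) {B : Plane → ℝ}
    (hB : ContDiff ℝ 1 B) {L : ℝ} (hL : ∀ y, ‖fderiv ℝ B y‖ ≤ L) (e : Plane) :
    ∫ x in interior C, fderiv ℝ ψ x e * B (u x)
      = - ∫ x in interior C, ψ x * fderiv ℝ B (u x) (Du x e) := by
  have := isFiniteMeasure_areaMeasure hC
  have hmeas : MeasurableSet (interior C) := isOpen_interior.measurableSet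
  have hu : Integrable ((interior C).indicator u) volume :=
    (integrable_indicator_iff hmeas).2 ((Lp.memLp u).integrable one_le_two)
  have hDu : Integrable ((interior C).indicator Du) volume :=
    (integrable_indicator_iff hmeas).2 ((Lp.memLp Du).integrable one_le_two)
  -- Mollifying at scale below `δ` does not leave the interior from any point of the support of `ψ`.
  obtain ⟨δ, hδ, hδs⟩ := hψc.isCompact.exists_cthickening_subset_open isOpen_interior hψs
  -- Outer radius `1/(n+1)` and inner radius half of it: the fixed ratio 2 is what almost everywhere
  -- convergence requires.
  let φ : ℕ → ContDiffBump (0 : Plane) := fun n =>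
    ⟨(1 / ((n : ℝ) + 1)) / 2, 1 / ((n : ℝ) + 1), by positivity,
      half_lt_self (by positivity)⟩
  have hφ : Tendsto (fun i => (φ i).rOut) atTop (𝓝 0) := tendsto_one_div_add_atTop_nhds_zero_nat
  have h'φ : ∀ᶠ i in atTop, (φ i).rOut ≤ 2 * (φ i).rIn :=
    Eventually.of_forall fun n => by simp only [φ]; linarith
  have hder : ∀ᶠ n in atTop, ∀ x ∈ tsupport ψ,
      fderiv ℝ (convolution ((φ n).normed volume) ((interior C).indicator u)
        (ContinuousLinearMap.lsmul ℝ ℝ) volume) x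
        = convolution ((φ n).normed volume) ((interior C).indicator Du)
        (ContinuousLinearMap.lsmul ℝ ℝ) volume x := by
    filter_upwards [hφ.eventually (gt_mem_nhds hδ)] with n hn x hx
    refine h.fderiv_convolution hu hDu (φ n) (Subset.trans ?_ hδs)
    exact (Metric.closedBall_subset_closedBall hn.le).trans
      (Metric.closedBall_subset_cthickening hx δ)
  have key := integral_fderiv_mul_comp_of_convolution hu hDu hφ h'φ hψ hψc hder hB hL e
  have e1 : ∫ x in interior C, fderiv ℝ ψ x e * B (u x)
      = ∫ x, fderiv ℝ ψ x e * B ((interior C).indicator u x) := by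
    refine Eq.trans ?_ (setIntegral_eq_integral_of_forall_compl_eq_zero (s := interior C) ?_)
    · exact setIntegral_congr_fun hmeas fun x hx => by simp [hx]
    · intro x hx
      have : fderiv ℝ ψ x = 0 :=
        image_eq_zero_of_notMem_tsupport fun hx' => hx (hψs (tsupport_fderiv_subset ℝ hx'))
      simp [this]
  have e2 : ∫ x in interior C, ψ x * fderiv ℝ B (u x) (Du x e)
      = ∫ x, ψ x * fderiv ℝ B ((interior C).indicator u x) ((interior C).indicator Du x e) := by
    refine Eq.trans ?_ (setIntegral_eq_integral_of_forall_compl_eq_zero (s := interior C) ?_)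
    · exact setIntegral_congr_fun hmeas fun x hx => by simp [hx]
    · intro x hx
      have : ψ x = 0 := image_eq_zero_of_notMem_tsupport fun hx' => hx (hψs hx')
      simp [this]
  rw [e1, e2, key]

/-- A vector field that is `C¹` in the interior of `C`, bounded there together with its
divergence. -/
structure IsBoundedC1Field (C : Set Plane) (F : Plane → Plane) : Prop where
  contDiffOn : ContDiffOn ℝ 1 F (interior C)
  bounded : ∃ K : ℝ, ∀ x ∈ interior C, ‖F x‖ ≤ K
  divergence_bounded : ∃ K : ℝ, ∀ x ∈ interior C, |divergence F x| ≤ K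

theorem continuousOn_divergence {U : Set Plane} (hU : IsOpen U) {F : Plane → Plane}
    (hF : ContDiffOn ℝ 1 F U) : ContinuousOn (divergence F) U := by
  have h1 : ContinuousOn (fderiv ℝ F) U := hF.continuousOn_fderiv_of_isOpen hU le_rfl
  refine continuousOn_finsetSum _ fun i _ => ?_
  have h2 : ContinuousOn (fun x => fderiv ℝ F x (EuclideanSpace.single i 1)) U :=
    h1.clm_apply continuousOn_const
  exact (EuclideanSpace.proj (𝕜 := ℝ) i).continuous.comp_continuousOn h2

/-- The nonlinearities applied to the deflection: bounded `C¹` functions with bounded gradient. -/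
structure IsBoundedC1 (B : Plane → ℝ) : Prop where
  contDiff : ContDiff ℝ 1 B
  bounded : ∃ R : ℝ, ∀ y, |B y| ≤ R
  fderiv_bounded : ∃ L : ℝ, ∀ y, ‖fderiv ℝ B y‖ ≤ L

theorem integrable_mul_fderiv_apply {C : Set Plane} (hC : IsCompact C) {u : L2 C}
    {Du : L2Grad C} {B : Plane → ℝ} (hB : IsBoundedC1 B) {g : Plane → ℝ} {F : Plane → Plane}
    (hg : AEStronglyMeasurable g (areaMeasure C)) (hF : AEStronglyMeasurable F (areaMeasure C))
    {M K : ℝ} (hM : ∀ x ∈ interior C, |g x| ≤ M) (hK : ∀ x ∈ interior C, ‖F x‖ ≤ K) :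
    Integrable (fun x => g x * fderiv ℝ B (u x) (Du x (F x))) (areaMeasure C) := by
  have := isFiniteMeasure_areaMeasure hC
  have hDu : Integrable Du (areaMeasure C) := (Lp.memLp Du).integrable one_le_two
  obtain ⟨L, hL⟩ := hB.fderiv_bounded
  have hL0 : 0 ≤ L := (norm_nonneg _).trans (hL 0)
  have hb := isBoundedBilinearMap_apply (𝕜 := ℝ) (E := Plane) (F := ℝ)
  have hb2 := isBoundedBilinearMap_apply (𝕜 := ℝ) (E := Plane) (F := Plane)
  refine ((hDu.norm.const_mul (M * L)).mul_const K).mono' (hg.mul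
    (hb.continuous.comp_aestronglyMeasurable₂
      ((hB.contDiff.continuous_fderiv one_ne_zero).comp_aestronglyMeasurable
        (Lp.aestronglyMeasurable u))
      (hb2.continuous.comp_aestronglyMeasurable₂ hDu.aestronglyMeasurable hF))) ?_
  refine ae_restrict_of_forall_mem isOpen_interior.measurableSet fun x hx => ?_
  rw [norm_mul, mul_assoc, mul_assoc]
  have hM0 : 0 ≤ M := (abs_nonneg _).trans (hM x hx)
  refine mul_le_mul (hM x hx) ?_ (norm_nonneg _) hM0
  refine (ContinuousLinearMap.le_opNorm _ _).trans (mul_le_mul (hL _) ?_ (norm_nonneg _) hL0)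
  exact ((Du x).le_opNorm _).trans (mul_le_mul_of_nonneg_left (hK x hx) (norm_nonneg _))

theorem integrable_mul_comp {C : Set Plane} (hC : IsCompact C) {u : L2 C} {B : Plane → ℝ}
    (hB : IsBoundedC1 B) {g : Plane → ℝ} (hg : AEStronglyMeasurable g (areaMeasure C))
    {M : ℝ} (hM : ∀ x ∈ interior C, |g x| ≤ M) :
    Integrable (fun x => g x * B (u x)) (areaMeasure C) := by
  have := isFiniteMeasure_areaMeasure hC
  obtain ⟨R, hR⟩ := hB.bounded
  refine (integrable_const (M * R)).mono' (hg.mul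
    (hB.contDiff.continuous.comp_aestronglyMeasurable (Lp.aestronglyMeasurable u))) ?_
  refine ae_restrict_of_forall_mem isOpen_interior.measurableSet fun x hx => ?_
  rw [norm_mul]
  exact mul_le_mul (hM x hx) (hR _) (norm_nonneg _) ((abs_nonneg _).trans (hM x hx))

theorem HasWeakDeriv.integral_divergence_mul_comp {C : Set Plane} (hC : IsCompact C) {u : L2 C}
    {Du : L2Grad C} (h : HasWeakDeriv C u Du) {Ψ : Plane → Plane} (hΨ : ContDiff ℝ 1 Ψ)
    (hΨc : HasCompactSupport Ψ) (hΨs : tsupport Ψ ⊆ interior C) {B : Plane → ℝ}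
    (hB : IsBoundedC1 B) :
    ∫ x in interior C, divergence Ψ x * B (u x)
      = - ∫ x in interior C, fderiv ℝ B (u x) (Du x (Ψ x)) := by
  obtain ⟨L, hL⟩ := hB.fderiv_bounded
  have hi : ∀ i : Fin 2, ContDiff ℝ 1 fun x => Ψ x i := fun i =>
    (EuclideanSpace.proj (𝕜 := ℝ) i).contDiff.comp hΨ
  have hsub : ∀ i : Fin 2, tsupport (fun x => Ψ x i) ⊆ tsupport Ψ := fun i =>
    closure_mono fun x hx hx' => hx (by simp [hx'])
  have hic : ∀ i : Fin 2, HasCompactSupport fun x => Ψ x i := fun i =>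
    hΨc.isCompact.of_isClosed_subset (isClosed_tsupport _) (hsub i)
  have hfd : ∀ (i : Fin 2) x e, fderiv ℝ (fun x => Ψ x i) x e = (fderiv ℝ Ψ x e) i := by
    intro i x e
    have h1 : HasFDerivAt (fun x => Ψ x i)
        ((EuclideanSpace.proj (𝕜 := ℝ) i).comp (fderiv ℝ Ψ x)) x :=
      (EuclideanSpace.proj (𝕜 := ℝ) i).hasFDerivAt.comp x
        (hΨ.differentiable one_ne_zero x).hasFDerivAt
    rw [h1.fderiv]; rfl
  have hdec : ∀ x, Ψ x = ∑ i : Fin 2, Ψ x i • EuclideanSpace.single i (1 : ℝ) := by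
    intro x
    ext j
    fin_cases j <;> simp [Fin.sum_univ_two]
  have key := fun i : Fin 2 => h.integral_fderiv_mul_comp hC (hi i) (hic i)
    ((hsub i).trans hΨs) hB.contDiff hL (EuclideanSpace.single i 1)
  have e1 : ∀ x, divergence Ψ x * B (u x)
      = ∑ i : Fin 2, fderiv ℝ (fun x => Ψ x i) x (EuclideanSpace.single i 1) * B (u x) := by
    intro x
    simp only [divergence, hfd, Finset.sum_mul]
  have e2 : ∀ x, fderiv ℝ B (u x) (Du x (Ψ x))
      = ∑ i : Fin 2, Ψ x i * fderiv ℝ B (u x) (Du x (EuclideanSpace.single i 1)) := by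
    intro x
    conv_lhs => rw [hdec x]
    simp only [map_sum, map_smul, smul_eq_mul]
  simp_rw [e1, e2]
  rw [integral_finsetSum, integral_finsetSum, ← Finset.sum_neg_distrib]
  · exact Finset.sum_congr rfl fun i _ => key i
  · intro i _
    obtain ⟨M, hM⟩ := (hic i).exists_bound_of_continuous (hi i).continuous
    exact integrable_mul_fderiv_apply hC hB (hi i).continuous.aestronglyMeasurable
      (aestronglyMeasurable_const (b := EuclideanSpace.single i (1 : ℝ)))
      (fun x _ => hM x) (fun x _ => le_rfl)
  · intro i _
    have hc : Continuous fun x => fderiv ℝ (fun x => Ψ x i) x (EuclideanSpace.single i 1) :=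
      ((hi i).continuous_fderiv one_ne_zero).clm_apply continuous_const
    obtain ⟨M, hM⟩ := ((hic i).fderiv_apply ℝ _).exists_bound_of_continuous hc
    exact integrable_mul_comp hC hB hc.aestronglyMeasurable (fun x _ => hM x)

theorem divergence_smul {g : Plane → ℝ} {F : Plane → Plane} {x : Plane}
    (hg : DifferentiableAt ℝ g x) (hF : DifferentiableAt ℝ F x) :
    divergence (fun y => g y • F y) x = g x * divergence F x + fderiv ℝ g x (F x) := by
  have hdec : F x = ∑ i : Fin 2, F x i • EuclideanSpace.single i (1 : ℝ) := by
    ext j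
    fin_cases j <;> simp [Fin.sum_univ_two]
  conv_rhs => rw [hdec]
  simp only [divergence, fderiv_fun_smul hg hF, map_sum, map_smul, Finset.mul_sum,
    ← Finset.sum_add_distrib]
  refine Finset.sum_congr rfl fun i _ => ?_
  simp [mul_comm]

theorem contDiff_of_forall_mem_tsupport {E F : Type*} [NormedAddCommGroup E] [NormedSpace ℝ E]
    [NormedAddCommGroup F] [NormedSpace ℝ F] {n : WithTop ℕ∞} {f : E → F}
    (h : ∀ x ∈ tsupport f, ContDiffAt ℝ n f x) : ContDiff ℝ n f :=
  contDiff_iff_contDiffAt.2 fun x => by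
    by_cases hx : x ∈ tsupport f
    · exact h x hx
    · exact contDiffAt_const.congr_of_eventuallyEq (notMem_tsupport_iff_eventuallyEq.1 hx)

/-- The integral of the divergence of `g B(u) F`, written out by the product rule. -/
def weakFlux (C : Set Plane) (F : Plane → Plane) (B : Plane → ℝ) (u : L2 C) (Du : L2Grad C)
    (g : Plane → ℝ) : ℝ :=
  ∫ x in interior C, ((g x * divergence F x + fderiv ℝ g x (F x)) * B (u x)
    + g x * fderiv ℝ B (u x) (Du x (F x)))

theorem IsBoundedC1Field.aestronglyMeasurable {C : Set Plane} {F : Plane → Plane}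
    (hF : IsBoundedC1Field C F) : AEStronglyMeasurable F (areaMeasure C) :=
  hF.contDiffOn.continuousOn.aestronglyMeasurable isOpen_interior.measurableSet

theorem aestronglyMeasurable_divergence {C : Set Plane} {F : Plane → Plane}
    (hF : IsBoundedC1Field C F) : AEStronglyMeasurable (divergence F) (areaMeasure C) :=
  (continuousOn_divergence isOpen_interior hF.contDiffOn).aestronglyMeasurable
    isOpen_interior.measurableSet

theorem exists_abs_le_of_contDiff {C : Set Plane} (hC : IsCompact C) {g : Plane → ℝ}
    (hg : ContDiff ℝ 1 g) : ∃ M : ℝ, 0 ≤ M ∧ (∀ x ∈ C, |g x| ≤ M) ∧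
      ∀ x ∈ C, ‖fderiv ℝ g x‖ ≤ M := by
  obtain ⟨M₁, h₁⟩ := hC.exists_bound_of_continuousOn hg.continuous.continuousOn
  obtain ⟨M₂, h₂⟩ := hC.exists_bound_of_continuousOn
    (hg.continuous_fderiv one_ne_zero).continuousOn
  exact ⟨max 0 (max M₁ M₂), le_max_left _ _,
    fun x hx => (h₁ x hx).trans ((le_max_left _ _).trans (le_max_right _ _)),
    fun x hx => (h₂ x hx).trans ((le_max_right _ _).trans (le_max_right _ _))⟩

theorem integrable_flux_left {C : Set Plane} (hC : IsCompact C) {F : Plane → Plane}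
    (hF : IsBoundedC1Field C F) {B : Plane → ℝ} (hB : IsBoundedC1 B) {u : L2 C}
    {g : Plane → ℝ} (hg : ContDiff ℝ 1 g) :
    Integrable (fun x => (g x * divergence F x + fderiv ℝ g x (F x)) * B (u x))
      (areaMeasure C) := by
  obtain ⟨M, hM0, hM, hM'⟩ := exists_abs_le_of_contDiff hC hg
  obtain ⟨K, hK⟩ := hF.bounded
  obtain ⟨K', hK'⟩ := hF.divergence_bounded
  refine integrable_mul_comp hC hB (M := M * K' + M * K) ?_ fun x hx => ?_
  · exact (hg.continuous.aestronglyMeasurable.mul (aestronglyMeasurable_divergence hF)).add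
      (isBoundedBilinearMap_apply.continuous.comp_aestronglyMeasurable₂
        (hg.continuous_fderiv one_ne_zero).aestronglyMeasurable hF.aestronglyMeasurable)
  · refine (abs_add_le _ _).trans (add_le_add ?_ ?_)
    · rw [abs_mul]
      exact mul_le_mul (hM x (interior_subset hx)) (hK' x hx) (abs_nonneg _) hM0
    · exact ((fderiv ℝ g x).le_opNorm _).trans
        (mul_le_mul (hM' x (interior_subset hx)) (hK x hx) (norm_nonneg _) hM0)

theorem integrable_flux_right {C : Set Plane} (hC : IsCompact C) {F : Plane → Plane}
    (hF : IsBoundedC1Field C F) {B : Plane → ℝ} (hB : IsBoundedC1 B) {u : L2 C} {Du : L2Grad C}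
    {g : Plane → ℝ} (hg : ContDiff ℝ 1 g) :
    Integrable (fun x => g x * fderiv ℝ B (u x) (Du x (F x))) (areaMeasure C) := by
  obtain ⟨M, hM0, hM, hM'⟩ := exists_abs_le_of_contDiff hC hg
  obtain ⟨K, hK⟩ := hF.bounded
  exact integrable_mul_fderiv_apply hC hB hg.continuous.aestronglyMeasurable
    hF.aestronglyMeasurable (fun x hx => hM x (interior_subset hx)) hK

theorem weakFlux_eq_add {C : Set Plane} (hC : IsCompact C) {F : Plane → Plane}
    (hF : IsBoundedC1Field C F) {B : Plane → ℝ} (hB : IsBoundedC1 B) {u : L2 C} {Du : L2Grad C}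
    {g : Plane → ℝ} (hg : ContDiff ℝ 1 g) :
    weakFlux C F B u Du g
      = (∫ x in interior C, (g x * divergence F x + fderiv ℝ g x (F x)) * B (u x))
        + ∫ x in interior C, g x * fderiv ℝ B (u x) (Du x (F x)) :=
  integral_add (integrable_flux_left hC hF hB hg) (integrable_flux_right hC hF hB hg)

/-- The field `g F` is `C¹` on the whole plane because `g` is supported where `F` is `C¹`, so it can
be tested against `B(u)`. The product rule for the divergence turns the resulting identity into the
vanishing of the flux. -/
theorem weakFlux_eq_zero {C : Set Plane} (hC : IsCompact C) {F : Plane → Plane}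
    (hF : IsBoundedC1Field C F) {B : Plane → ℝ} (hB : IsBoundedC1 B) {u : L2 C} {Du : L2Grad C}
    (h : HasWeakDeriv C u Du) {g : Plane → ℝ} (hg : ContDiff ℝ 1 g)
    (hgc : HasCompactSupport g) (hgs : tsupport g ⊆ interior C) :
    weakFlux C F B u Du g = 0 := by
  have hFd : ∀ x ∈ interior C, ContDiffAt ℝ 1 F x := fun x hx =>
    hF.contDiffOn.contDiffAt (isOpen_interior.mem_nhds hx)
  have hsub : tsupport (fun y => g y • F y) ⊆ tsupport g :=
    closure_mono fun x hx hx' => hx (by simp [hx'])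
  have hΨ : ContDiff ℝ 1 fun y => g y • F y :=
    contDiff_of_forall_mem_tsupport fun x hx => (hg.contDiffAt).smul (hFd x (hgs (hsub hx)))
  have key := h.integral_divergence_mul_comp hC hΨ
    (hgc.isCompact.of_isClosed_subset (isClosed_tsupport _) hsub) (hsub.trans hgs) hB
  rw [weakFlux_eq_add hC hF hB hg]
  have e1 : ∫ x in interior C, (g x * divergence F x + fderiv ℝ g x (F x)) * B (u x)
      = ∫ x in interior C, divergence (fun y => g y • F y) x * B (u x) :=
    setIntegral_congr_fun isOpen_interior.measurableSet fun x hx => by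
      simp only [divergence_smul (hg.differentiable one_ne_zero x)
        ((hFd x hx).differentiableAt one_ne_zero)]
  have e2 : ∀ x, g x * fderiv ℝ B (u x) (Du x (F x)) = fderiv ℝ B (u x) (Du x (g x • F x)) := by
    intro x; simp only [map_smul, smul_eq_mul]
  simp_rw [e1, key, e2]
  ring

theorem weakFlux_congr {C : Set Plane} {F : Plane → Plane} {B : Plane → ℝ} {u : L2 C}
    {Du : L2Grad C} {g g' : Plane → ℝ} (h : ∀ x ∈ interior C, g x = g' x) :
    weakFlux C F B u Du g = weakFlux C F B u Du g' :=
  setIntegral_congr_fun isOpen_interior.measurableSet fun x hx => by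
    have : g =ᶠ[𝓝 x] g' := by
      filter_upwards [isOpen_interior.mem_nhds hx] with y hy using h y hy
    simp only [h x hx, this.fderiv_eq]

theorem weakFlux_sum {C : Set Plane} (hC : IsCompact C) {F : Plane → Plane}
    (hF : IsBoundedC1Field C F) {B : Plane → ℝ} (hB : IsBoundedC1 B) {u : L2 C} {Du : L2Grad C}
    {ι : Type*} (s : Finset ι) {g : ι → Plane → ℝ} (hg : ∀ i ∈ s, ContDiff ℝ 1 (g i)) :
    weakFlux C F B u Du (fun x => ∑ i ∈ s, g i x) = ∑ i ∈ s, weakFlux C F B u Du (g i) := by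
  have hint : ∀ i ∈ s, Integrable (fun x => (g i x * divergence F x + fderiv ℝ (g i) x (F x)) *
      B (u x) + g i x * fderiv ℝ B (u x) (Du x (F x))) (areaMeasure C) := fun i hi =>
    (integrable_flux_left hC hF hB (hg i hi)).add (integrable_flux_right hC hF hB (hg i hi))
  simp only [weakFlux]
  rw [← integral_finsetSum s hint]
  refine integral_congr_ae (Eventually.of_forall fun x => ?_)
  have h1 : fderiv ℝ (fun x => ∑ i ∈ s, g i x) x = ∑ i ∈ s, fderiv ℝ (g i) x :=
    fderiv_fun_sum fun i hi => (hg i hi).differentiable one_ne_zero x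
  simp only [h1, Finset.sum_mul, sum_apply, Finset.sum_add_distrib, add_mul]

end FrBD

end

/-! ### Estimates along lines transversal to the boundary -/

noncomputable section

open scoped ENNReal NNReal

/-- The Cauchy-Schwarz inequality against the constant function. -/
theorem sq_intervalIntegral_le {h : ℝ → ℝ} (hh : Continuous h) {T : ℝ} (hT : 0 < T) :
    (∫ τ in (0 : ℝ)..T, h τ) ^ 2 ≤ T * ∫ τ in (0 : ℝ)..T, h τ ^ 2 := by
  -- The mean of `h`: the inequality is the nonnegativity of the variance about `m`.
  set m := (∫ τ in (0 : ℝ)..T, h τ) / T with hm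
  have hI : ∫ τ in (0 : ℝ)..T, h τ = m * T := by rw [hm]; field_simp
  have h0 : 0 ≤ ∫ τ in (0 : ℝ)..T, (h τ - m) ^ 2 :=
    intervalIntegral.integral_nonneg hT.le fun τ _ => sq_nonneg _
  have h1 : ∫ τ in (0 : ℝ)..T, (h τ - m) ^ 2
      = (∫ τ in (0 : ℝ)..T, h τ ^ 2) - m ^ 2 * T := by
    have e : ∀ τ, (h τ - m) ^ 2 = h τ ^ 2 - 2 * m * h τ + m ^ 2 := fun τ => by ring
    simp_rw [e]
    rw [intervalIntegral.integral_add, intervalIntegral.integral_sub,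
      intervalIntegral.integral_const_mul, hI, intervalIntegral.integral_const]
    · simp only [sub_zero, smul_eq_mul]; ring
    all_goals exact Continuous.intervalIntegrable (by fun_prop) _ _
  rw [hI]
  rw [h1] at h0
  nlinarith

namespace FrBD

/-- Orthonormal coordinates of the plane with second axis along a given unit vector. -/
theorem exists_coordinates {e : Plane} (he : ‖e‖ = 1) :
    ∃ (Ψ : ℝ × ℝ → Plane) (π : Plane → ℝ), MeasurePreserving Ψ ∧ Continuous Ψ ∧
      LipschitzWith 1 π ∧ (∀ a b, π (Ψ (a, b)) = a) ∧
      (∀ a b s, Ψ (a, b + s) = Ψ (a, b) + s • e) ∧ ∀ y, ∃ b, y = Ψ (π y, b) := by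
  -- The one-vector family at index 1, so that the completed basis has `e` as its second axis.
  have horth : Orthonormal ℝ (({1} : Set (Fin 2)).domRestrict fun _ : Fin 2 => e) := by
    refine ⟨fun i => he, fun i j hij => ?_⟩
    exact absurd (Subsingleton.elim i j) hij
  obtain ⟨b, hb⟩ := horth.exists_orthonormalBasis_extension_of_card_eq
    (by simp : Module.finrank ℝ Plane = Fintype.card (Fin 2))
  have hb1 : b 1 = e := hb 1 rfl
  have hΨ : ∀ q : ℝ × ℝ, b.repr.symm (WithLp.toLp 2 (MeasurableEquiv.finTwoArrow.symm q))
      = q.1 • b 0 + q.2 • b 1 := by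
    intro q
    rw [← b.sum_repr_symm]
    simp [Fin.sum_univ_two, MeasurableEquiv.finTwoArrow]
  refine ⟨fun q => q.1 • b 0 + q.2 • e, fun y => ⟪b 0, y⟫, ?_, by fun_prop, ?_, ?_, ?_, ?_⟩
  · rw [← hb1]
    simp_rw [← hΨ]
    exact (b.measurePreserving_repr_symm).comp
      ((PiLp.volume_preserving_toLp (Fin 2)).comp (volume_preserving_finTwoArrow ℝ).symm)
  · refine LipschitzWith.of_dist_le_mul fun x y => ?_
    rw [dist_eq_norm, dist_eq_norm, ← inner_sub_right]
    simpa using norm_inner_le_norm (𝕜 := ℝ) (b 0) (x - y)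
  · intro a b'
    rw [← hb1]
    simp only [inner_add_right, inner_smul_right, b.inner_eq_one, b.inner_eq_ite]
    simp
  · intro a b' s
    simp only [add_smul, add_assoc]
  · intro y
    refine ⟨⟪b 1, y⟫, ?_⟩
    rw [← hb1]
    have := b.sum_repr' y
    rw [Fin.sum_univ_two] at this
    exact this.symm

/-- The fundamental theorem of calculus on the segment from `y` to `y + s e`, then `(a + b)² ≤ 2a² +
2b²`; Cauchy-Schwarz produces the factor `s`. -/
theorem enorm_sq_le_of_contDiff {w : Plane → Plane} (hw : ContDiff ℝ 1 w) {e : Plane}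
    (he : ‖e‖ = 1) (y : Plane) {s : ℝ} (hs : 0 < s) :
    ‖w y‖ₑ ^ 2 ≤ 2 * ‖w (y + s • e)‖ₑ ^ 2
      + 2 * ENNReal.ofReal s * ∫⁻ τ in Ioo 0 s, ‖fderiv ℝ w (y + τ • e)‖ₑ ^ 2 := by
  have hline : ∀ τ : ℝ, HasDerivAt (fun τ : ℝ => w (y + τ • e)) (fderiv ℝ w (y + τ • e) e) τ := by
    intro τ
    have h1 : HasDerivAt (fun τ : ℝ => y + τ • e) e τ := by
      simpa using ((hasDerivAt_id τ).smul_const e).const_add y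
    exact ((hw.differentiable one_ne_zero _).hasFDerivAt).comp_hasDerivAt τ h1
  have hcont : Continuous fun τ : ℝ => fderiv ℝ w (y + τ • e) :=
    (hw.continuous_fderiv one_ne_zero).comp (by fun_prop)
  have hftc : ∫ τ in (0 : ℝ)..s, fderiv ℝ w (y + τ • e) e = w (y + s • e) - w y := by
    rw [intervalIntegral.integral_eq_sub_of_hasDerivAt (fun τ _ => hline τ)
      ((hcont.clm_apply continuous_const).intervalIntegrable _ _)]
    simp
  set h : ℝ → ℝ := fun τ => ‖fderiv ℝ w (y + τ • e)‖ with hh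
  have hhc : Continuous h := hcont.norm
  have hle : ‖w (y + s • e) - w y‖ ≤ ∫ τ in (0 : ℝ)..s, h τ := by
    rw [← hftc]
    refine intervalIntegral.norm_integral_le_of_norm_le hs.le
      (Eventually.of_forall fun τ _ => ?_) (hhc.intervalIntegrable _ _)
    simpa [he] using (fderiv ℝ w (y + τ • e)).le_opNorm e
  have hcs := sq_intervalIntegral_le hhc hs
  have hreal : ‖w y‖ ^ 2 ≤ 2 * ‖w (y + s • e)‖ ^ 2 + 2 * s * ∫ τ in (0 : ℝ)..s, h τ ^ 2 := by
    have h1 : ‖w y‖ ≤ ‖w (y + s • e)‖ + ∫ τ in (0 : ℝ)..s, h τ := by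
      have := norm_sub_norm_le (w y) (w (y + s • e))
      rw [norm_sub_rev] at this
      linarith
    have h2 := norm_nonneg (w y)
    nlinarith [sq_nonneg (‖w (y + s • e)‖ - ∫ τ in (0 : ℝ)..s, h τ)]
  have hint : ENNReal.ofReal (∫ τ in (0 : ℝ)..s, h τ ^ 2)
      = ∫⁻ τ in Ioo 0 s, ‖fderiv ℝ w (y + τ • e)‖ₑ ^ 2 := by
    rw [intervalIntegral.integral_of_le hs.le, integral_Ioc_eq_integral_Ioo,
      ofReal_integral_eq_lintegral_ofReal]
    · refine lintegral_congr fun τ => ?_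
      rw [ENNReal.ofReal_pow (norm_nonneg _), ofReal_norm]
    · exact ((hhc.pow 2).integrableOn_Icc).mono_set Ioo_subset_Icc_self
    · exact Eventually.of_forall fun τ => sq_nonneg _
  have hI0 : 0 ≤ ∫ τ in (0 : ℝ)..s, h τ ^ 2 :=
    intervalIntegral.integral_nonneg hs.le fun τ _ => sq_nonneg _
  have := ENNReal.ofReal_le_ofReal hreal
  rw [ENNReal.ofReal_add (by positivity) (by positivity), ENNReal.ofReal_mul (by norm_num),
    ENNReal.ofReal_mul (by positivity), ENNReal.ofReal_mul (by norm_num),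
    ENNReal.ofReal_pow (norm_nonneg _), ENNReal.ofReal_pow (norm_nonneg _), ofReal_norm,
    ofReal_norm, hint] at this
  simpa using this

/-- The level function `φ` is `C¹` in the ball and has slope at least `c` along the unit
vector `e`. -/
structure HasSlope (φ : Plane → ℝ) (x : Plane) (r c : ℝ) (e : Plane) : Prop where
  contDiffOn : ContDiffOn ℝ 1 φ (Metric.ball x r)
  slope : ∀ y ∈ Metric.ball x r, c ≤ fderiv ℝ φ y e
  pos : 0 < c
  norm_eq_one : ‖e‖ = 1

theorem HasSlope.mono {φ : Plane → ℝ} {x y : Plane} {r r' c : ℝ} {e : Plane}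
    (h : HasSlope φ x r c e) (hs : Metric.ball y r' ⊆ Metric.ball x r) : HasSlope φ y r' c e :=
  ⟨h.contDiffOn.mono hs, fun z hz => h.slope z (hs hz), h.pos, h.norm_eq_one⟩

/-- The mean value inequality along `e`; convexity of the ball keeps the segment where the slope
bound holds. -/
theorem HasSlope.add_mul_le {φ : Plane → ℝ} {x : Plane} {r c : ℝ} {e : Plane}
    (h : HasSlope φ x r c e) {y : Plane} (hy : y ∈ Metric.ball x r) {s : ℝ} (hs : 0 ≤ s)
    (hys : y + s • e ∈ Metric.ball x r) : φ y + c * s ≤ φ (y + s • e) := by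
  have hseg : ∀ τ ∈ Icc 0 s, y + τ • e ∈ Metric.ball x r := by
    intro τ hτ
    have hconv := (convex_ball x r).segment_subset hy hys
    rcases hs.eq_or_lt with h0 | h0
    · have : τ = 0 := le_antisymm (hτ.2.trans h0.symm.le) hτ.1
      simpa [this] using hy
    · apply hconv
      rw [segment_eq_image']
      refine ⟨τ / s, ⟨div_nonneg hτ.1 hs, (div_le_one h0).2 hτ.2⟩, ?_⟩
      simp only [add_sub_cancel_left, smul_smul]
      rw [div_mul_cancel₀ _ h0.ne']
  have hd : ∀ τ ∈ Icc 0 s, HasDerivAt (fun τ : ℝ => φ (y + τ • e)) (fderiv ℝ φ (y + τ • e) e) τ := by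
    intro τ hτ
    have h1 : HasDerivAt (fun τ : ℝ => y + τ • e) e τ := by
      simpa using ((hasDerivAt_id τ).smul_const e).const_add y
    have h2 : DifferentiableAt ℝ φ (y + τ • e) :=
      (h.contDiffOn.contDiffAt (Metric.isOpen_ball.mem_nhds (hseg τ hτ))).differentiableAt
        one_ne_zero
    exact h2.hasFDerivAt.comp_hasDerivAt τ h1
  have := (convex_Icc 0 s).mul_sub_le_image_sub_of_le_deriv (f := fun τ : ℝ => φ (y + τ • e))
    (fun τ hτ => (hd τ hτ).continuousAt.continuousWithinAt)
    (fun τ hτ => (hd τ (interior_subset hτ)).differentiableAt.differentiableWithinAt) (C := c)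
    (fun τ hτ => by
      rw [(hd τ (interior_subset hτ)).deriv]
      exact h.slope _ (hseg τ (interior_subset hτ)))
    0 (left_mem_Icc.2 hs) s (right_mem_Icc.2 hs) hs
  simp only [sub_zero, zero_smul, add_zero] at this
  linarith

end FrBD

end

/-! ### Thin layers below the zero set of a level function -/

noncomputable section

open scoped ENNReal NNReal

namespace FrBD

/-- The part of the ball at `φ`-depth between `t` and `2t`. -/
def strip (φ : Plane → ℝ) (x : Plane) (r t : ℝ) : Set Plane :=
  Metric.ball x r ∩ φ ⁻¹' Icc (-(2 * t)) (-t)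

/-- The level function is continuous only in the ball, so the closed condition is handled as the
ball minus an open set. -/
theorem HasSlope.measurableSet_inter_preimage {φ : Plane → ℝ} {x : Plane} {r c : ℝ} {e : Plane}
    (h : HasSlope φ x r c e) {K : Set ℝ} (hK : IsClosed K) :
    MeasurableSet (Metric.ball x r ∩ φ ⁻¹' K) := by
  have h1 : IsOpen (Metric.ball x r ∩ φ ⁻¹' Kᶜ) :=
    h.contDiffOn.continuousOn.isOpen_inter_preimage Metric.isOpen_ball hK.isOpen_compl
  have h2 : Metric.ball x r ∩ φ ⁻¹' K = Metric.ball x r \ (Metric.ball x r ∩ φ ⁻¹' Kᶜ) := by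
    ext y; simp only [mem_inter_iff, mem_preimage, Set.mem_sdiff, mem_compl_iff]; tauto
  rw [h2]
  exact Metric.isOpen_ball.measurableSet.diff h1.measurableSet

/-- On the strip `φ` varies by at most `t`, while along a line in direction `e` it grows at rate at
least `c`. -/
theorem HasSlope.volume_slice_le {φ : Plane → ℝ} {x : Plane} {r c : ℝ} {e : Plane}
    (h : HasSlope φ x r c e) {ℓ : ℝ → Plane} (hℓ : ∀ b s, ℓ (b + s) = ℓ b + s • e) (t : ℝ) :
    volume {b | ℓ b ∈ strip φ x r t} ≤ ENNReal.ofReal (t / c) := by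
  refine (Real.volume_le_diam _).trans (Metric.ediam_le_of_forall_dist_le fun b hb b' hb' => ?_)
  have key : ∀ b b', ℓ b ∈ strip φ x r t → ℓ b' ∈ strip φ x r t → b ≤ b' → b' - b ≤ t / c := by
    intro b b' hb hb' hle
    have e1 : ℓ b' = ℓ b + (b' - b) • e := by rw [← hℓ]; congr 1; ring
    have := h.add_mul_le hb.1 (sub_nonneg.2 hle) (e1 ▸ hb'.1)
    rw [← e1] at this
    rw [le_div_iff₀ h.pos]
    have h1 := hb.2.1
    have h2 := hb'.2.2
    linarith
  rw [Real.dist_eq]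
  rcases le_total b b' with hle | hle
  · rw [abs_of_nonpos (by linarith)]
    linarith [key b b' hb hb' hle]
  · rw [abs_of_nonneg (by linarith)]
    exact key b' b hb' hb hle

/-- Fubini in coordinates adapted to `e`: each slice has length at most `t / c`, and only slices
over an interval of length `2r` meet the ball. The linear dependence on `t` balances the factor
`t⁻¹` of the boundary layer averages. -/
theorem HasSlope.volume_strip_le {φ : Plane → ℝ} {x : Plane} {r c : ℝ} {e : Plane}
    (h : HasSlope φ x r c e) (t : ℝ) :
    volume (strip φ x r t) ≤ ENNReal.ofReal (t / c) * ENNReal.ofReal (2 * r) := by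
  obtain ⟨Ψ, π, hΨ, hΨc, hπ, hπΨ, hadd, hsurj⟩ := exists_coordinates h.norm_eq_one
  have hmeas : MeasurableSet (strip φ x r t) := h.measurableSet_inter_preimage isClosed_Icc
  rw [← hΨ.measure_preimage hmeas.nullMeasurableSet, Measure.volume_eq_prod,
    Measure.prod_apply (hΨc.measurable hmeas)]
  have hle : ∀ a, volume (Prod.mk a ⁻¹' (Ψ ⁻¹' strip φ x r t))
      ≤ (Metric.closedBall (π x) r).indicator (fun _ => ENNReal.ofReal (t / c)) a := by
    intro a
    by_cases ha : a ∈ Metric.closedBall (π x) r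
    · rw [indicator_of_mem ha]
      exact h.volume_slice_le (ℓ := fun b => Ψ (a, b)) (hadd a) t
    · rw [indicator_of_notMem ha]
      have : Prod.mk a ⁻¹' (Ψ ⁻¹' strip φ x r t) = ∅ := by
        refine eq_empty_of_forall_notMem fun b hb => ha ?_
        have h1 : dist (Ψ (a, b)) x < r := hb.1
        have h2 := hπ.dist_le_mul (Ψ (a, b)) x
        rw [hπΨ] at h2
        simp only [NNReal.coe_one, one_mul] at h2
        exact Metric.mem_closedBall.2 (h2.trans h1.le)
      simp [this]
  refine (lintegral_mono hle).trans ?_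
  rw [lintegral_indicator Metric.isClosed_closedBall.measurableSet, setLIntegral_const,
    Real.volume_closedBall]

/-- The zero set is a graph over the first coordinate, since `φ` strictly increases along `e`, and
the projection `π` is 1-Lipschitz. So Lebesgue measure on the shadow of the zero set is at most the
image of arc length. The supremum selects the only point above `a`, is zero when there is none, and
avoids constructing the graph function or proving its measurability. -/
theorem HasSlope.lintegral_iSup_le {φ : Plane → ℝ} {x : Plane} {r c : ℝ} {e : Plane}
    (h : HasSlope φ x r c e) {Ψ : ℝ × ℝ → Plane} {π : Plane → ℝ} (hπ : LipschitzWith 1 π)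
    (hadd : ∀ a b s, Ψ (a, b + s) = Ψ (a, b) + s • e) (hsurj : ∀ y, ∃ b, y = Ψ (π y, b))
    (f : Plane → ℝ≥0∞) :
    ∫⁻ a, ⨆ z ∈ Metric.ball x r ∩ φ ⁻¹' {0} ∩ π ⁻¹' {a}, f z
      ≤ ∫⁻ z in Metric.ball x r ∩ φ ⁻¹' {0}, f z ∂(Measure.hausdorffMeasure 1) := by
  set Z := Metric.ball x r ∩ φ ⁻¹' {0} with hZ
  have hZm : MeasurableSet Z := h.measurableSet_inter_preimage isClosed_singleton
  set g : ℝ → ℝ≥0∞ := fun a => ⨆ z ∈ Z ∩ π ⁻¹' {a}, f z with hg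
  have huniq : ∀ z ∈ Z, ∀ z' ∈ Z, π z = π z' → z = z' := by
    have key : ∀ z ∈ Z, ∀ b b', z = Ψ (π z, b) → Ψ (π z, b') ∈ Z → b ≤ b' → b = b' := by
      intro z hz b b' hzb hb' hle
      have e1 : Ψ (π z, b') = z + (b' - b) • e := by
        nth_rewrite 2 [hzb]
        rw [← hadd]; congr 2; ring
      have h1 := h.add_mul_le hz.1 (sub_nonneg.2 hle) (e1 ▸ hb'.1)
      rw [← e1, show φ z = 0 from hz.2, show φ (Ψ (π z, b')) = 0 from hb'.2] at h1
      have := h.pos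
      nlinarith
    intro z hz z' hz' hzz
    obtain ⟨b, hb⟩ := hsurj z
    obtain ⟨b', hb'⟩ := hsurj z'
    rcases le_total b b' with hle | hle
    · have := key z hz b b' hb (by rw [hzz, ← hb']; exact hz') hle
      rw [hb, hb', hzz, this]
    · have := key z' hz' b' b hb' (by rw [← hzz, ← hb]; exact hz) hle
      rw [hb, hb', hzz, this]
  have hgz : ∀ z ∈ Z, g (π z) ≤ f z := by
    intro z hz
    refine iSup₂_le fun z' hz' => ?_
    rw [huniq z' hz'.1 z hz hz'.2]
  have hgind : ∀ a, g a ≤ (π '' Z).indicator g a := by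
    intro a
    by_cases ha : a ∈ π '' Z
    · rw [indicator_of_mem ha]
    · rw [indicator_of_notMem ha]
      exact iSup₂_le fun z hz => absurd ⟨z, hz.1, hz.2⟩ ha
  have hmeas : (volume : Measure ℝ).restrict (π '' Z)
      ≤ Measure.map π ((Measure.hausdorffMeasure 1).restrict Z) := by
    refine Measure.le_iff.2 fun B hB => ?_
    rw [Measure.restrict_apply hB, Measure.map_apply hπ.continuous.measurable hB,
      Measure.restrict_apply (hπ.continuous.measurable hB)]
    have h1 : B ∩ π '' Z ⊆ π '' (π ⁻¹' B ∩ Z) := by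
      rintro _ ⟨hb, z, hz, rfl⟩
      exact ⟨z, ⟨hb, hz⟩, rfl⟩
    refine (measure_mono h1).trans ?_
    rw [← hausdorffMeasure_real]
    simpa using hπ.hausdorffMeasure_image_le zero_le_one (π ⁻¹' B ∩ Z)
  calc ∫⁻ a, g a ≤ ∫⁻ a, (π '' Z).indicator g a := lintegral_mono hgind
    _ ≤ ∫⁻ a in π '' Z, g a := lintegral_indicator_le _ _
    _ ≤ ∫⁻ a, g a ∂(Measure.map π ((Measure.hausdorffMeasure 1).restrict Z)) :=
        lintegral_mono' hmeas le_rfl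
    _ ≤ ∫⁻ z in Z, g (π z) ∂(Measure.hausdorffMeasure 1) := lintegral_map_le _ _
    _ ≤ ∫⁻ z in Z, f z ∂(Measure.hausdorffMeasure 1) := setLIntegral_mono' hZm hgz

/-- From depth at most `2t`, moving along `e` at slope at least `c` reaches the level zero within
`2t / c`. The start is taken in the half ball so that the path cannot leave the full ball. -/
theorem HasSlope.exists_zero {φ : Plane → ℝ} {x : Plane} {r c : ℝ} {e : Plane}
    (h : HasSlope φ x r c e) {t : ℝ} (ht : 0 < t) (htr : 2 * t / c < r / 2) {y : Plane}
    (hy : y ∈ strip φ x (r / 2) t) :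
    ∃ s, 0 < s ∧ s ≤ 2 * t / c ∧ y + s • e ∈ Metric.ball x r ∩ φ ⁻¹' {0} ∧
      ∀ τ ∈ Ioo 0 s, y + τ • e ∈ Metric.ball x r ∩ φ ⁻¹' Iio 0 := by
  have hc := h.pos
  have hT : 0 < 2 * t / c := by positivity
  have hball : ∀ τ ∈ Icc 0 (2 * t / c), y + τ • e ∈ Metric.ball x r := by
    intro τ hτ
    rw [Metric.mem_ball]
    calc dist (y + τ • e) x ≤ dist (y + τ • e) y + dist y x := dist_triangle _ _ _
      _ < r / 2 + r / 2 := by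
        refine add_lt_add ?_ hy.1
        rw [dist_eq_norm, add_sub_cancel_left, norm_smul, h.norm_eq_one, mul_one,
          Real.norm_of_nonneg hτ.1]
        exact hτ.2.trans_lt htr
      _ = r := by ring
  have hcont : ContinuousOn (fun τ : ℝ => φ (y + τ • e)) (Icc 0 (2 * t / c)) :=
    h.contDiffOn.continuousOn.comp (by fun_prop) hball
  have hy0 : y ∈ Metric.ball x r := by simpa using hball 0 (left_mem_Icc.2 hT.le)
  have hend : 0 ≤ φ (y + (2 * t / c) • e) := by
    have h1 := h.add_mul_le hy0 hT.le (hball _ (right_mem_Icc.2 hT.le))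
    have h2 : c * (2 * t / c) = 2 * t := by field_simp
    have h3 := hy.2.1
    linarith
  obtain ⟨s, hs, hs0⟩ := intermediate_value_Icc hT.le hcont
    (show (0 : ℝ) ∈ Icc _ _ from ⟨by simpa using hy.2.2.trans (by linarith), hend⟩)
  have hspos : 0 < s := by
    rcases hs.1.eq_or_lt with h0 | h0
    · exfalso
      rw [← h0] at hs0
      simp only [zero_smul, add_zero] at hs0
      have := hy.2.2
      linarith
    · exact h0
  refine ⟨s, hspos, hs.2, ⟨hball s hs, hs0⟩, fun τ hτ => ⟨hball τ ⟨hτ.1.le, hτ.2.le.trans hs.2⟩, ?_⟩⟩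
  have e1 : y + s • e = (y + τ • e) + (s - τ) • e := by
    rw [add_assoc, ← add_smul]; congr 2; ring
  have h1 := h.add_mul_le (hball τ ⟨hτ.1.le, hτ.2.le.trans hs.2⟩) (sub_nonneg.2 hτ.2.le)
    (e1 ▸ hball s hs)
  rw [← e1] at h1
  have h2 : 0 < c * (s - τ) := mul_pos hc (sub_pos.2 hτ.2)
  have h3 : φ (y + s • e) = 0 := hs0
  show φ (y + τ • e) < 0
  linarith

/-- Every point of the layer is joined along `e` to the zero set inside `{φ < 0}`. The
one-dimensional estimate on this segment bounds the value by the boundary value and the gradient on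
the line, and the slice of the layer has length at most `t / c`. Integrating over the lines gives
the boundary and gradient terms. -/
theorem HasSlope.lintegral_strip_le {φ : Plane → ℝ} {x : Plane} {r c : ℝ} {e : Plane}
    (h : HasSlope φ x r c e) {t : ℝ} (ht : 0 < t) (htr : 2 * t / c < r / 2)
    {w : Plane → Plane} (hw : ContDiff ℝ 1 w) {O : Set Plane} (hO : MeasurableSet O)
    (hsub : Metric.ball x r ∩ φ ⁻¹' Iio 0 ⊆ O) :
    ∫⁻ y in strip φ x (r / 2) t, ‖w y‖ₑ ^ 2
      ≤ ENNReal.ofReal (t / c) *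
        (2 * ∫⁻ z in Metric.ball x r ∩ φ ⁻¹' {0}, ‖w z‖ₑ ^ 2 ∂(Measure.hausdorffMeasure 1)
          + 2 * ENNReal.ofReal (2 * t / c) * ∫⁻ y in O, ‖fderiv ℝ w y‖ₑ ^ 2) := by
  obtain ⟨Ψ, π, hΨ, hΨc, hπ, hπΨ, hadd, hsurj⟩ := exists_coordinates h.norm_eq_one
  have hc := h.pos
  have hr : 0 < r := by
    have : 0 < 2 * t / c := by positivity
    linarith
  have h' : HasSlope φ x (r / 2) c e := h.mono (Metric.ball_subset_ball (by linarith))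
  set A := strip φ x (r / 2) t with hA
  set T := 2 * t / c with hT
  have hAm : MeasurableSet A := h'.measurableSet_inter_preimage isClosed_Icc
  set g : ℝ → ℝ≥0∞ := fun a => ⨆ z ∈ Metric.ball x r ∩ φ ⁻¹' {0} ∩ π ⁻¹' {a}, ‖w z‖ₑ ^ 2 with hg
  set G : Plane → ℝ≥0∞ := O.indicator fun y => ‖fderiv ℝ w y‖ₑ ^ 2 with hG
  have hGm : Measurable G :=
    ((hw.continuous_fderiv one_ne_zero).enorm.measurable.pow_const 2).indicator hO
  have hWm : Measurable (A.indicator fun y => ‖w y‖ₑ ^ 2) :=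
    (hw.continuous.enorm.measurable.pow_const 2).indicator hAm
  set J : ℝ → ℝ≥0∞ := fun a => ∫⁻ b, G (Ψ (a, b)) with hJ
  have hGΨ : Measurable fun q : ℝ × ℝ => G (Ψ q) := hGm.comp hΨc.measurable
  have hJm : Measurable J := Measurable.lintegral_prod_right' (f := fun q => G (Ψ q)) hGΨ
  have hJint : ∫⁻ a, J a = ∫⁻ y in O, ‖fderiv ℝ w y‖ₑ ^ 2 := by
    rw [← lintegral_indicator hO, ← hΨ.lintegral_comp hGm, Measure.volume_eq_prod,
      lintegral_prod _ hGΨ.aemeasurable]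
  have hWΨ : Measurable fun q : ℝ × ℝ => A.indicator (fun y => ‖w y‖ₑ ^ 2) (Ψ q) :=
    hWm.comp hΨc.measurable
  have hslice : ∀ a, ∫⁻ b, A.indicator (fun y => ‖w y‖ₑ ^ 2) (Ψ (a, b))
      ≤ ENNReal.ofReal (t / c) * (2 * g a + 2 * ENNReal.ofReal T * J a) := by
    intro a
    have hpt : ∀ b, A.indicator (fun y => ‖w y‖ₑ ^ 2) (Ψ (a, b))
        ≤ {b | Ψ (a, b) ∈ A}.indicator (fun _ => 2 * g a + 2 * ENNReal.ofReal T * J a) b := by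
      intro b
      by_cases hb : Ψ (a, b) ∈ A
      · rw [indicator_of_mem hb, indicator_of_mem (show b ∈ {b | Ψ (a, b) ∈ A} from hb)]
        obtain ⟨s, hs0, hsT, hsZ, hseg⟩ := h.exists_zero ht htr hb
        refine (enorm_sq_le_of_contDiff hw h.norm_eq_one _ hs0).trans ?_
        have hga : ‖w (Ψ (a, b) + s • e)‖ₑ ^ 2 ≤ g a := by
          refine le_iSup₂_of_le (Ψ (a, b) + s • e) ⟨hsZ, ?_⟩ le_rfl
          rw [mem_preimage, ← hadd, hπΨ]; rfl
        -- The segment is enlarged to the whole line, with the gradient set to zero outside `O`; the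
        -- bound then depends on `a` only.
        have hJa : ∫⁻ τ in Ioo 0 s, ‖fderiv ℝ w (Ψ (a, b) + τ • e)‖ₑ ^ 2 ≤ J a := by
          calc ∫⁻ τ in Ioo 0 s, ‖fderiv ℝ w (Ψ (a, b) + τ • e)‖ₑ ^ 2
              ≤ ∫⁻ τ in Ioo 0 s, G (Ψ (a, b + τ)) := by
                refine setLIntegral_mono' measurableSet_Ioo fun τ hτ => ?_
                rw [hadd, hG, indicator_of_mem (hsub (hseg τ hτ))]
            _ ≤ ∫⁻ τ, G (Ψ (a, b + τ)) := setLIntegral_le_lintegral _ _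
            _ = J a := lintegral_add_left_eq_self (fun τ => G (Ψ (a, τ))) b
        gcongr
      · rw [indicator_of_notMem hb]; exact zero_le
    refine (lintegral_mono hpt).trans ((lintegral_indicator_le _ _).trans ?_)
    rw [setLIntegral_const, mul_comm]
    gcongr
    exact h'.volume_slice_le (ℓ := fun b => Ψ (a, b)) (hadd a) t
  rw [← lintegral_indicator hAm, ← hΨ.lintegral_comp hWm, Measure.volume_eq_prod,
    lintegral_prod _ hWΨ.aemeasurable]
  refine (lintegral_mono hslice).trans ?_
  rw [lintegral_const_mul' _ _ ENNReal.ofReal_ne_top, lintegral_add_right _ (hJm.const_mul _),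
    lintegral_const_mul' _ _ ENNReal.ofNat_ne_top,
    lintegral_const_mul' _ _ (ENNReal.mul_ne_top ENNReal.ofNat_ne_top ENNReal.ofReal_ne_top), hJint]
  gcongr
  exact h.lintegral_iSup_le hπ hadd hsurj _

end FrBD

end

/-! ### Zero trace and smallness in boundary layers -/

noncomputable section

open scoped ENNReal NNReal

namespace FrBD

theorem enorm_sq_le_two_mul_add {E : Type*} [NormedAddCommGroup E] (a b : E) :
    ‖a‖ₑ ^ 2 ≤ 2 * ‖b - a‖ₑ ^ 2 + 2 * ‖b‖ₑ ^ 2 := by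
  have h : ‖a‖ ^ 2 ≤ 2 * ‖b - a‖ ^ 2 + 2 * ‖b‖ ^ 2 := by
    have h1 : ‖a‖ ≤ ‖b - a‖ + ‖b‖ := by
      have := norm_sub_norm_le a b
      rw [norm_sub_rev] at this
      linarith
    have := norm_nonneg a
    nlinarith [sq_nonneg (‖b - a‖ - ‖b‖)]
  have := ENNReal.ofReal_le_ofReal h
  rw [ENNReal.ofReal_add (by positivity) (by positivity), ENNReal.ofReal_mul (by norm_num),
    ENNReal.ofReal_mul (by norm_num), ENNReal.ofReal_pow (norm_nonneg _),
    ENNReal.ofReal_pow (norm_nonneg _), ENNReal.ofReal_pow (norm_nonneg _), ofReal_norm,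
    ofReal_norm, ofReal_norm] at this
  simpa using this

theorem eLpNorm_two_sq {α E : Type*} [MeasurableSpace α] [NormedAddCommGroup E] (f : α → E)
    (μ : Measure α) : eLpNorm f 2 μ ^ 2 = ∫⁻ x, ‖f x‖ₑ ^ 2 ∂μ := by
  have := eLpNorm_nnreal_pow_eq_lintegral (f := f) (μ := μ) (p := 2) two_ne_zero
  simpa using this

theorem tendsto_lintegral_enorm_sq {α E : Type*} [MeasurableSpace α] [NormedAddCommGroup E]
    {f : ℕ → α → E} {μ : Measure α} (h : Tendsto (fun k => eLpNorm (f k) 2 μ) atTop (𝓝 0)) :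
    Tendsto (fun k => ∫⁻ x, ‖f k x‖ₑ ^ 2 ∂μ) atTop (𝓝 0) := by
  simp_rw [← eLpNorm_two_sq]
  simpa using ENNReal.Tendsto.pow (n := 2) h

theorem lintegral_enorm_sq_lt_top {C : Set Plane} {E : Type*} [NormedAddCommGroup E]
    (f : Lp E 2 (areaMeasure C)) : ∫⁻ x in interior C, ‖f x‖ₑ ^ 2 < ⊤ := by
  rw [← eLpNorm_two_sq]
  exact ENNReal.pow_lt_top (Lp.memLp f).2

/-- A deflection with zero trace is small, in mean square, in thin boundary layers. -/
theorem HasTraceOn.tendsto_lintegral_strip {C Γ : Set Plane} {u : L2 C} {Du : L2Grad C}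
    (htr : HasTraceOn C Γ u Du fun _ => 0) {φ : Plane → ℝ} {x : Plane} {r c : ℝ} {e : Plane}
    (hr : 0 < r) (h : HasSlope φ x r c e) (hx : x ∈ Γ)
    (hin : Metric.ball x r ∩ φ ⁻¹' Iio 0 ⊆ interior C)
    (hΓ : Metric.ball x r ∩ φ ⁻¹' {0} ⊆ Γ) :
    ∃ r' > 0, Tendsto (fun t => ENNReal.ofReal t⁻¹ * ∫⁻ y in strip φ x r' t, ‖u y‖ₑ ^ 2)
      (𝓝[>] 0) (𝓝 0) := by
  obtain ⟨ρ, hρ, w, hw, hwu, hwD, hwΓ⟩ := htr x hx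
  have hc := h.pos
  set r₁ := min r ρ with hr₁
  have hr₁0 : 0 < r₁ := lt_min hr hρ
  have hr₁r : Metric.ball x r₁ ⊆ Metric.ball x r := Metric.ball_subset_ball (min_le_left _ _)
  have hr₁ρ : Metric.ball x r₁ ⊆ Metric.ball x ρ := Metric.ball_subset_ball (min_le_right _ _)
  have h₁ : HasSlope φ x r₁ c e := h.mono hr₁r
  set O := interior C ∩ Metric.ball x ρ with hO
  have hOm : MeasurableSet O := (isOpen_interior.inter Metric.isOpen_ball).measurableSet
  have hOsub : Metric.ball x r₁ ∩ φ ⁻¹' Iio 0 ⊆ O := fun y hy =>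
    ⟨hin ⟨hr₁r hy.1, hy.2⟩, hr₁ρ hy.1⟩
  have hZsub : Metric.ball x r₁ ∩ φ ⁻¹' {0} ⊆ Γ ∩ Metric.ball x ρ := fun y hy =>
    ⟨hΓ ⟨hr₁r hy.1, hy.2⟩, hr₁ρ hy.1⟩
  have ha := tendsto_lintegral_enorm_sq hwu
  have hb := tendsto_lintegral_enorm_sq hwD
  have hd := tendsto_lintegral_enorm_sq hwΓ
  simp only [sub_zero] at hd
  set I := ∫⁻ y in O, ‖Du y‖ₑ ^ 2 with hI
  have hItop : I ≠ ⊤ := ((lintegral_mono_set inter_subset_left).trans_lt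
    (lintegral_enorm_sq_lt_top Du)).ne
  -- Letting the approximation index tend to infinity at fixed `t` removes the boundary term and
  -- leaves a bound of order `t²`, better than the `o(t)` that is required.
  have hbound : ∀ t, 0 < t → 2 * t / c < r₁ / 2 →
      ∫⁻ y in strip φ x (r₁ / 2) t, ‖u y‖ₑ ^ 2
        ≤ 2 * (ENNReal.ofReal (t / c) * (2 * ENNReal.ofReal (2 * t / c) * (2 * I))) := by
    intro t ht htr
    set A := strip φ x (r₁ / 2) t with hA
    have hAO : A ⊆ O := fun y hy => hOsub ⟨Metric.ball_subset_ball (by linarith) hy.1,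
      show φ y < 0 by have := hy.2.2; linarith⟩
    have hk : ∀ k, ∫⁻ y in A, ‖u y‖ₑ ^ 2 ≤ 2 * (∫⁻ y in O, ‖w k y - u y‖ₑ ^ 2)
        + 2 * (ENNReal.ofReal (t / c) *
          (2 * ∫⁻ z in Γ ∩ Metric.ball x ρ, ‖w k z‖ₑ ^ 2 ∂(Measure.hausdorffMeasure 1)
          + 2 * ENNReal.ofReal (2 * t / c) *
            (2 * (∫⁻ y in O, ‖fderiv ℝ (w k) y - Du y‖ₑ ^ 2) + 2 * I))) := by
      intro k
      have hwm : Measurable fun y => ‖w k y‖ₑ ^ 2 :=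
        ((hw k).continuous.enorm.measurable.pow_const 2)
      have hwD : ∫⁻ y in O, ‖fderiv ℝ (w k) y‖ₑ ^ 2
          ≤ 2 * (∫⁻ y in O, ‖fderiv ℝ (w k) y - Du y‖ₑ ^ 2) + 2 * I := by
        have hm : AEMeasurable (fun y => ‖Du y‖ₑ ^ 2) (volume.restrict O) :=
          ((Lp.aestronglyMeasurable Du).mono_measure
            (Measure.restrict_mono inter_subset_left le_rfl)).enorm.pow_const 2
        rw [hI, ← lintegral_const_mul' _ _ ENNReal.ofNat_ne_top,
          ← lintegral_const_mul' _ _ ENNReal.ofNat_ne_top,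
          ← lintegral_add_right' _ (hm.const_mul 2)]
        refine lintegral_mono fun y => ?_
        have := enorm_sq_le_two_mul_add (fderiv ℝ (w k) y) (Du y)
        rwa [enorm_sub_rev] at this
      calc ∫⁻ y in A, ‖u y‖ₑ ^ 2
          ≤ ∫⁻ y in A, (2 * ‖w k y - u y‖ₑ ^ 2 + 2 * ‖w k y‖ₑ ^ 2) :=
            lintegral_mono fun y => enorm_sq_le_two_mul_add _ _
        _ = 2 * (∫⁻ y in A, ‖w k y - u y‖ₑ ^ 2) + 2 * (∫⁻ y in A, ‖w k y‖ₑ ^ 2) := by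
            rw [lintegral_add_right _ (hwm.const_mul 2),
              lintegral_const_mul' _ _ ENNReal.ofNat_ne_top,
              lintegral_const_mul' _ _ ENNReal.ofNat_ne_top]
        _ ≤ _ := by
            gcongr ?_ + 2 * ?_
            · exact mul_le_mul_right (lintegral_mono_set hAO) _
            · refine (h₁.lintegral_strip_le ht htr (hw k) hOm hOsub).trans ?_
              gcongr
    have hb' := (ENNReal.Tendsto.const_mul (a := 2) hb (Or.inr ENNReal.ofNat_ne_top)).add_const
      (2 * I)
    have hb'' := ENNReal.Tendsto.const_mul (a := 2 * ENNReal.ofReal (2 * t / c)) hb'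
      (Or.inr (ENNReal.mul_ne_top ENNReal.ofNat_ne_top ENNReal.ofReal_ne_top))
    have hd' := (ENNReal.Tendsto.const_mul (a := 2) hd (Or.inr ENNReal.ofNat_ne_top)).add hb''
    have hd'' := ENNReal.Tendsto.const_mul (a := 2) (ENNReal.Tendsto.const_mul
      (a := ENNReal.ofReal (t / c)) hd' (Or.inr ENNReal.ofReal_ne_top))
      (Or.inr ENNReal.ofNat_ne_top)
    have := (ENNReal.Tendsto.const_mul (a := 2) ha (Or.inr ENNReal.ofNat_ne_top)).add hd''
    simpa using ge_of_tendsto' this hk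
  refine ⟨r₁ / 2, by positivity, ?_⟩
  have hlim : Tendsto (fun t : ℝ => ENNReal.ofReal (8 * t / c ^ 2) * (2 * I)) (𝓝[>] 0) (𝓝 0) := by
    have h1 : Tendsto (fun t : ℝ => 8 * t / c ^ 2) (𝓝[>] 0) (𝓝 0) := by
      have : Tendsto (fun t : ℝ => 8 * t / c ^ 2) (𝓝 0) (𝓝 (8 * 0 / c ^ 2)) :=
        (Continuous.tendsto (by fun_prop) _)
      simpa using this.mono_left nhdsWithin_le_nhds
    have h2 := ENNReal.tendsto_ofReal h1
    have := ENNReal.Tendsto.mul_const (b := 2 * I) h2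
      (Or.inr (ENNReal.mul_ne_top ENNReal.ofNat_ne_top hItop))
    simpa using this
  have hsmall : ∀ᶠ t : ℝ in 𝓝[>] 0, 2 * t / c < r₁ / 2 := by
    have : Tendsto (fun t : ℝ => 2 * t / c) (𝓝[>] 0) (𝓝 (2 * 0 / c)) :=
      (Continuous.tendsto (by fun_prop) _).mono_left nhdsWithin_le_nhds
    refine this.eventually (gt_mem_nhds ?_)
    simp only [mul_zero, zero_div]
    positivity
  refine tendsto_of_tendsto_of_tendsto_of_le_of_le' tendsto_const_nhds hlim
    (Eventually.of_forall fun _ => zero_le) ?_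
  filter_upwards [hsmall, self_mem_nhdsWithin] with t ht ht0
  have ht0 : 0 < t := ht0
  calc ENNReal.ofReal t⁻¹ * ∫⁻ y in strip φ x (r₁ / 2) t, ‖u y‖ₑ ^ 2
      ≤ ENNReal.ofReal t⁻¹
        * (2 * (ENNReal.ofReal (t / c) * (2 * ENNReal.ofReal (2 * t / c) * (2 * I)))) := by
        gcongr; exact hbound t ht0 ht
    _ = ENNReal.ofReal (8 * t / c ^ 2) * (2 * I) := by
        have e1 : 8 * t / c ^ 2 = t⁻¹ * (2 * ((t / c) * (2 * (2 * t / c)))) := by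
          field_simp; ring
        rw [e1, ENNReal.ofReal_mul (by positivity), ENNReal.ofReal_mul (by positivity),
          ENNReal.ofReal_mul (by positivity), ENNReal.ofReal_mul (by positivity)]
        simp only [ENNReal.ofReal_ofNat]
        ring

end FrBD

end

/-! ### Boundary charts and the leading edge -/

noncomputable section

open scoped ENNReal NNReal

namespace FrBD

/-- In the ball, `C` is the sublevel set `{φ ≤ 0}` of a level function with positive slope. -/
structure IsBoundaryChart (C : Set Plane) (φ : Plane → ℝ) (x : Plane) (r c : ℝ) (e : Plane) :
    Prop extends HasSlope φ x r c e where
  mem_iff : ∀ y ∈ Metric.ball x r, (y ∈ C ↔ φ y ≤ 0)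

theorem IsBoundaryChart.mono {C : Set Plane} {φ : Plane → ℝ} {x y : Plane} {r r' c : ℝ}
    {e : Plane} (h : IsBoundaryChart C φ x r c e) (hs : Metric.ball y r' ⊆ Metric.ball x r) :
    IsBoundaryChart C φ y r' c e :=
  ⟨h.toHasSlope.mono hs, fun z hz => h.mem_iff z (hs hz)⟩

/-- With `e` the normalised gradient at `x`, the slope at `x` is the length of the gradient; by
continuity at least half of it survives in a small ball. -/
theorem IsOutwardUnitNormal.exists_chart {C : Set Plane} {x n : Plane}
    (h : IsOutwardUnitNormal C x n) :
    ∃ (φ : Plane → ℝ) (r c : ℝ) (e : Plane), 0 < r ∧ IsBoundaryChart C φ x r c e := by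
  obtain ⟨-, φ, hφ, -, hgrad, -, hmem⟩ := h
  set N := gradient φ x with hN
  have hN0 : 0 < ‖N‖ := norm_pos_iff.2 hgrad
  set e := ‖N‖⁻¹ • N with he
  have hcont : ContinuousAt (fun y => fderiv ℝ φ y e) x :=
    (hφ.fderiv_right (m := 0) (by simp)).continuousAt.clm_apply continuousAt_const
  have hval : fderiv ℝ φ x e = ‖N‖ := by
    rw [← inner_gradient_left, ← hN, he, inner_smul_right, real_inner_self_eq_norm_sq]
    field_simp
  have h1 : ∀ᶠ y in 𝓝 x, ‖N‖ / 2 < fderiv ℝ φ y e :=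
    hcont.eventually (lt_mem_nhds (by simp only [hval]; linarith))
  obtain ⟨r, hr, hball⟩ := Metric.eventually_nhds_iff_ball.1
    ((hφ.eventually (by simp)).and (h1.and hmem))
  refine ⟨φ, r, ‖N‖ / 2, e, hr, ⟨fun y hy => (hball y hy).1.contDiffWithinAt,
    fun y hy => (hball y hy).2.1.le, by positivity, ?_⟩, fun y hy => (hball y hy).2.2⟩
  rw [he, norm_smul, norm_inv, norm_norm, inv_mul_cancel₀ hN0.ne']

theorem IsBoundaryChart.mem_interior {C : Set Plane} {φ : Plane → ℝ} {x : Plane} {r c : ℝ}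
    {e : Plane} (h : IsBoundaryChart C φ x r c e) {y : Plane} (hy : y ∈ Metric.ball x r)
    (hφ : φ y < 0) : y ∈ interior C := by
  rw [mem_interior_iff_mem_nhds]
  have hc : ContinuousAt φ y :=
    h.contDiffOn.continuousOn.continuousAt (Metric.isOpen_ball.mem_nhds hy)
  filter_upwards [hc.eventually (gt_mem_nhds hφ), Metric.isOpen_ball.mem_nhds hy] with z hz hzb
  exact (h.mem_iff z hzb).2 hz.le

/-- From an interior point with `φ ≥ 0`, a small move along `e` would stay in `C` and make `φ`
positive. -/
theorem IsBoundaryChart.neg_of_mem_interior {C : Set Plane} {φ : Plane → ℝ} {x : Plane} {r c : ℝ}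
    {e : Plane} (h : IsBoundaryChart C φ x r c e) {y : Plane} (hy : y ∈ Metric.ball x r)
    (hyC : y ∈ interior C) : φ y < 0 := by
  have hT : Tendsto (fun s : ℝ => y + s • e) (𝓝[>] 0) (𝓝 y) := by
    have : Tendsto (fun s : ℝ => y + s • e) (𝓝 0) (𝓝 (y + (0 : ℝ) • e)) :=
      Continuous.tendsto (by fun_prop) _
    simpa using this.mono_left nhdsWithin_le_nhds
  obtain ⟨s, ⟨hsC, hsb⟩, hs⟩ := (((hT.eventually (isOpen_interior.mem_nhds hyC)).and
    (hT.eventually (Metric.isOpen_ball.mem_nhds hy))).and self_mem_nhdsWithin).exists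
  have hs : 0 < s := hs
  have h1 := h.add_mul_le hy hs.le hsb
  have h2 := (h.mem_iff _ hsb).1 (interior_subset hsC)
  have h3 : 0 < c * s := mul_pos h.pos hs
  linarith

/-- The same level function serves as a chart at every nearby zero, so the outward normal there is
its normalised gradient, and the sign of `V·n` is that of the derivative of `φ` along `V`. -/
theorem IsBoundaryChart.mem_leadingEdge {C : Set Plane} {V : Plane → Plane} {φ : Plane → ℝ}
    {x : Plane} {r c : ℝ} {e : Plane} (h : IsBoundaryChart C φ x r c e) {y : Plane}
    (hy : y ∈ Metric.ball x r) (hφ : φ y = 0) (hV : fderiv ℝ φ y (V y) < 0) :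
    y ∈ leadingEdge C V := by
  have hfr : y ∈ frontier C :=
    ⟨subset_closure ((h.mem_iff y hy).2 hφ.le), fun hin => (h.neg_of_mem_interior hy hin).ne hφ⟩
  have hgrad : gradient φ y ≠ 0 := by
    intro h0
    have := h.slope y hy
    rw [← inner_gradient_left, h0, inner_zero_left] at this
    exact absurd h.pos (not_lt.2 this)
  refine ⟨hfr, _, ⟨hfr, φ, h.contDiffOn.contDiffAt (Metric.isOpen_ball.mem_nhds hy), hφ, hgrad, rfl,
    ?_⟩, ?_⟩
  · filter_upwards [Metric.isOpen_ball.mem_nhds hy] with z hz using h.mem_iff z hz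
  · rw [inner_smul_right, real_inner_comm, inner_gradient_left]
    exact mul_neg_of_pos_of_neg (inv_pos.2 (norm_pos_iff.2 hgrad)) hV

theorem IsBoundaryChart.continuousOn_fderiv_apply {C : Set Plane} {V : Plane → Plane}
    (hV : Continuous V) {φ : Plane → ℝ} {x : Plane} {r c : ℝ} {e : Plane}
    (h : IsBoundaryChart C φ x r c e) :
    ContinuousOn (fun y => fderiv ℝ φ y (V y)) (Metric.ball x r) :=
  (h.contDiffOn.continuousOn_fderiv_of_isOpen Metric.isOpen_ball le_rfl).clm_apply hV.continuousOn

/-- Uniform smallness of the boundary layer integrals near a compact part of the leading edge. -/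
theorem IsBoundaryChart.exists_open_tendsto {C : Set Plane} {V : Plane → Plane}
    (hV : Continuous V) {u : L2 C} {Du : L2Grad C}
    (htr : HasTraceOn C (leadingEdge C V) u Du fun _ => 0) {φ : Plane → ℝ} {x : Plane}
    {r c : ℝ} {e : Plane} (h : IsBoundaryChart C φ x r c e) {K : Set Plane} (hK : IsCompact K)
    (hKr : K ⊆ Metric.ball x r) (hK0 : ∀ y ∈ K, φ y = 0) (hKV : ∀ y ∈ K, fderiv ℝ φ y (V y) < 0) :
    ∃ N, IsOpen N ∧ K ⊆ N ∧
      Tendsto (fun t => ENNReal.ofReal t⁻¹ * ∫⁻ y in strip φ x r t ∩ N, ‖u y‖ₑ ^ 2)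
        (𝓝[>] 0) (𝓝 0) := by
  refine hK.induction_on (p := fun s => ∃ N, IsOpen N ∧ s ⊆ N ∧
      Tendsto (fun t => ENNReal.ofReal t⁻¹ * ∫⁻ y in strip φ x r t ∩ N, ‖u y‖ₑ ^ 2)
        (𝓝[>] 0) (𝓝 0)) ⟨∅, isOpen_empty, Subset.rfl, by simp⟩ ?_ ?_ ?_
  · rintro s t hst ⟨N, hN, htN, hlim⟩
    exact ⟨N, hN, hst.trans htN, hlim⟩
  · rintro s s' ⟨N, hN, hsN, hlim⟩ ⟨N', hN', hsN', hlim'⟩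
    refine ⟨N ∪ N', hN.union hN', union_subset_union hsN hsN', ?_⟩
    have hsum := hlim.add hlim'
    rw [add_zero] at hsum
    refine tendsto_of_tendsto_of_tendsto_of_le_of_le tendsto_const_nhds hsum (fun _ => zero_le)
      fun t => ?_
    rw [← mul_add, inter_union_distrib_left]
    exact mul_le_mul_right (lintegral_union_le _ _ _) _
  · intro y hy
    have hcont := (h.continuousOn_fderiv_apply hV).continuousAt
      (Metric.isOpen_ball.mem_nhds (hKr hy))
    obtain ⟨ρ, hρ, hball⟩ := Metric.eventually_nhds_iff_ball.1
      ((hcont.eventually (gt_mem_nhds (hKV y hy))).and (Metric.isOpen_ball.mem_nhds (hKr hy)))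
    have h' : IsBoundaryChart C φ y ρ c e := h.mono fun z hz => (hball z hz).2
    obtain ⟨r', hr', hlim⟩ := htr.tendsto_lintegral_strip hρ h'.toHasSlope
      (h.mem_leadingEdge (hKr hy) (hK0 y hy) (hKV y hy))
      (fun z hz => h'.mem_interior hz.1 hz.2)
      (fun z hz => h'.mem_leadingEdge hz.1 hz.2 (hball z hz.1).1)
    refine ⟨Metric.ball y r', mem_nhdsWithin_of_mem_nhds (Metric.ball_mem_nhds y hr'),
      Metric.ball y r', Metric.isOpen_ball, Subset.rfl, ?_⟩
    refine tendsto_of_tendsto_of_tendsto_of_le_of_le tendsto_const_nhds hlim (fun _ => zero_le)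
      fun t => ?_
    exact mul_le_mul_right (lintegral_mono_set
      fun z hz => show z ∈ strip φ y r' t from ⟨hz.2, hz.1.2⟩) _

/-- A smooth monotone step from `0` on `(-∞, 1]` to `1` on `[2, ∞)`. -/
def step (s : ℝ) : ℝ := Real.smoothTransition (s - 1)

theorem step_contDiff : ContDiff ℝ 1 step :=
  (Real.smoothTransition.contDiff (n := 1)).comp (contDiff_id.sub contDiff_const)

theorem step_nonneg (s : ℝ) : 0 ≤ step s := Real.smoothTransition.nonneg _

theorem step_le_one (s : ℝ) : step s ≤ 1 := Real.smoothTransition.le_one _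

theorem step_of_le {s : ℝ} (h : s ≤ 1) : step s = 0 :=
  Real.smoothTransition.zero_of_nonpos (by linarith)

theorem step_of_ge {s : ℝ} (h : 2 ≤ s) : step s = 1 :=
  Real.smoothTransition.one_of_one_le (by linarith)

theorem step_monotone : Monotone step := fun _ _ h =>
  Real.smoothTransition.monotone (by linarith)

theorem deriv_step_nonneg (s : ℝ) : 0 ≤ deriv step s := step_monotone.deriv_nonneg

/-- This confines the derivative of the cutoff `step (-φ / t)` to the layer `-2t ≤ φ ≤ -t`. -/
theorem deriv_step_eq_zero {s : ℝ} (h : s ∉ Icc 1 2) : deriv step s = 0 := by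
  rw [mem_Icc, not_and_or, not_le, not_le] at h
  rcases h with h | h
  · have : step =ᶠ[𝓝 s] fun _ => 0 := by
      filter_upwards [gt_mem_nhds h] with z hz using step_of_le hz.le
    rw [this.deriv_eq, deriv_const]
  · have : step =ᶠ[𝓝 s] fun _ => 1 := by
      filter_upwards [lt_mem_nhds h] with z hz using step_of_ge hz.le
    rw [this.deriv_eq, deriv_const]

theorem exists_deriv_step_le : ∃ M : ℝ, 0 ≤ M ∧ ∀ s, deriv step s ≤ M := by
  have hc : Continuous (deriv step) := step_contDiff.continuous_deriv le_rfl
  obtain ⟨M, hM⟩ := isCompact_Icc.exists_bound_of_continuousOn (s := Icc (1 : ℝ) 2) hc.continuousOn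
  refine ⟨max M 0, le_max_right _ _, fun s => ?_⟩
  by_cases hs : s ∈ Icc 1 2
  · exact (le_abs_self _).trans ((hM s hs).trans (le_max_left _ _))
  · rw [deriv_step_eq_zero hs]; exact le_max_right _ _

end FrBD

end

/-! ### Nonnegativity of the flux in one boundary chart -/

noncomputable section

open scoped ENNReal NNReal

namespace FrBD

theorem inv_mul_integral_indicator_sq_le {C : Set Plane} {u : L2 C} {S : Set Plane}
    (hS : MeasurableSet S) {t ε : ℝ} (ht : 0 < t) (hε : 0 ≤ ε)
    (h : ENNReal.ofReal t⁻¹ * ∫⁻ y in S, ‖u y‖ₑ ^ 2 ≤ ENNReal.ofReal ε) :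
    t⁻¹ * ∫ y in interior C, S.indicator (fun y => ‖u y‖ ^ 2) y ≤ ε := by
  rw [← ENNReal.ofReal_le_ofReal_iff hε, ENNReal.ofReal_mul (by positivity)]
  refine le_trans ?_ h
  gcongr
  rw [ofReal_integral_eq_lintegral_ofReal]
  · calc ∫⁻ y in interior C, ENNReal.ofReal (S.indicator (fun y => ‖u y‖ ^ 2) y)
        ≤ ∫⁻ y, ENNReal.ofReal (S.indicator (fun y => ‖u y‖ ^ 2) y) :=
          setLIntegral_le_lintegral _ _
      _ = ∫⁻ y, S.indicator (fun y => ‖u y‖ₑ ^ 2) y := by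
          refine lintegral_congr fun y => ?_
          by_cases hy : y ∈ S
          · rw [indicator_of_mem hy, indicator_of_mem hy, ENNReal.ofReal_pow (norm_nonneg _),
              ofReal_norm]
          · simp [hy]
      _ ≤ _ := lintegral_indicator_le _ _
  · exact ((Lp.memLp u).integrable_norm_pow two_ne_zero).indicator hS
  · exact Eventually.of_forall fun y => indicator_nonneg (fun _ _ => sq_nonneg _) y

/-- The `+ 1` makes the choice of small parameter valid also when the constant `a` is zero. -/
theorem mul_div_two_mul_add_one_le {a ε : ℝ} (ha : 0 ≤ a) (hε : 0 ≤ ε) :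
    a * (ε / (2 * (a + 1))) ≤ ε / 2 := by
  rw [mul_div_assoc', div_le_div_iff₀ (by positivity) (by positivity)]
  nlinarith

set_option maxHeartbeats 1000000 in
/-- The flux through the boundary of `C` inside a chart is nonnegative: it is outgoing off the
leading edge, and the deflection vanishes on the leading edge. -/
theorem IsBoundaryChart.weakFlux_nonneg {C : Set Plane} (hC : IsCompact C) {V : Plane → Plane}
    (hV : Continuous V) {p : Plane → ℝ} (hp : ContinuousOn p C) (hp0 : ∀ x ∈ C, 0 ≤ p x)
    (hF : IsBoundedC1Field C fun y => p y • V y) {B : Plane → ℝ} (hB : IsBoundedC1 B)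
    (hB0 : ∀ ζ, 0 ≤ B ζ) {K : ℝ} (hBK : ∀ ζ, B ζ ≤ K * ‖ζ‖ ^ 2) {u : L2 C} {Du : L2Grad C}
    (hu : HasWeakDeriv C u Du) (htr : HasTraceOn C (leadingEdge C V) u Du fun _ => 0)
    {φ : Plane → ℝ} {x : Plane} {r c : ℝ} {e : Plane} (h : IsBoundaryChart C φ x r c e)
    {η : Plane → ℝ} (hη : ContDiff ℝ 1 η) (hη0 : ∀ y, 0 ≤ η y) (hηc : HasCompactSupport η)
    (hηs : tsupport η ⊆ Metric.ball x r) :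
    0 ≤ weakFlux C (fun y => p y • V y) B u Du η := by
  have hfin := isFiniteMeasure_areaMeasure hC
  -- The radius is not assumed positive; a point of the support supplies this.
  rcases (tsupport η).eq_empty_or_nonempty with hemp | ⟨y₀, hy₀⟩
  · have hz : weakFlux C (fun y => p y • V y) B u Du η = 0 :=
      weakFlux_eq_zero hC hF hB hu hη hηc (by simp [hemp])
    exact hz.ge
  have hr : 0 < r := dist_nonneg.trans_lt (hηs hy₀)
  set F : Plane → Plane := fun y => p y • V y with hFdef
  set X : Plane → ℝ := fun y => (η y * divergence F y + fderiv ℝ η y (F y)) * B (u y)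
    + η y * fderiv ℝ B (u y) (Du y (F y)) with hX
  have hXint : Integrable X (areaMeasure C) :=
    (integrable_flux_left hC hF hB hη).add (integrable_flux_right hC hF hB hη)
  -- A cutoff that vanishes at depth less than `t` and equals one beyond depth `2t`, so that `η χ`
  -- becomes an interior test function.
  set χ : ℝ → Plane → ℝ := fun t y => step (-φ y / t) with hχ
  set g : ℝ → Plane → ℝ := fun t y => η y * χ t y with hg
  set Y : ℝ → Plane → ℝ := fun t y =>
    η y * deriv step (-φ y / t) * fderiv ℝ φ y (F y) * B (u y) with hY
  have hφat : ∀ y ∈ Metric.ball x r, ContDiffAt ℝ 1 φ y := fun y hy =>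
    h.contDiffOn.contDiffAt (Metric.isOpen_ball.mem_nhds hy)
  have hηoff : ∀ y, y ∉ Metric.ball x r → η y = 0 ∧ fderiv ℝ η y = 0 := fun y hy =>
    ⟨image_eq_zero_of_notMem_tsupport fun h' => hy (hηs h'),
      image_eq_zero_of_notMem_tsupport fun h' => hy (hηs (tsupport_fderiv_subset ℝ h'))⟩
  have hgsub : ∀ t, tsupport (g t) ⊆ tsupport η := fun t => tsupport_mul_subset_left
  have hgC : ∀ t, ContDiff ℝ 1 (g t) := fun t => contDiff_of_forall_mem_tsupport fun y hy =>
    hη.contDiffAt.mul (step_contDiff.contDiffAt.comp y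
      (((hφat y (hηs (hgsub t hy))).neg).div_const t))
  have hgc : ∀ t, HasCompactSupport (g t) := fun t =>
    hηc.isCompact.of_isClosed_subset (isClosed_tsupport _) (hgsub t)
  have hgs : ∀ t, 0 < t → tsupport (g t) ⊆ interior C := by
    intro t ht y hy
    have hyb := hηs (hgsub t hy)
    refine h.mem_interior hyb ?_
    by_contra hcon
    have hlt : -t < φ y := by linarith [not_lt.1 hcon]
    refine notMem_tsupport_iff_eventuallyEq.2 ?_ hy
    filter_upwards [(hφat y hyb).continuousAt.eventually (lt_mem_nhds hlt)] with z hz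
    have : step (-φ z / t) = 0 := step_of_le (by rw [div_le_one ht]; linarith)
    simp [hg, hχ, this]
  -- Differentiating the cutoff separates the flux density into the cut density of `η` and the layer
  -- term `t⁻¹ Y`. The flux of `η χ` is zero, so the two integrate to the same value.
  have hident : ∀ t, 0 < t → ∀ y ∈ interior C,
      (g t y * divergence F y + fderiv ℝ (g t) y (F y)) * B (u y)
        + g t y * fderiv ℝ B (u y) (Du y (F y))
      = (Metric.ball x r).indicator (χ t) y * X y - t⁻¹ * Y t y := by
    intro t ht y hyC
    by_cases hyb : y ∈ Metric.ball x r
    · have hd : HasFDerivAt (fun z => -φ z / t) (t⁻¹ • -fderiv ℝ φ y) y := by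
        have := ((hφat y hyb).differentiableAt one_ne_zero).hasFDerivAt.neg.const_smul t⁻¹
        refine this.congr_of_eventuallyEq (Eventually.of_forall fun z => ?_)
        simp [div_eq_inv_mul]
      have hχd : HasFDerivAt (χ t) (deriv step (-φ y / t) • (t⁻¹ • -fderiv ℝ φ y)) y :=
        ((step_contDiff.differentiable one_ne_zero _).hasDerivAt).comp_hasFDerivAt y hd
      have hgd : HasFDerivAt (g t) (η y • (deriv step (-φ y / t) • (t⁻¹ • -fderiv ℝ φ y))
          + χ t y • fderiv ℝ η y) y :=
        ((hη.differentiable one_ne_zero y).hasFDerivAt).mul hχd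
      rw [indicator_of_mem hyb, hgd.fderiv]
      simp only [hX, hY, hg, add_apply, smul_apply, neg_apply, smul_eq_mul]
      ring
    · obtain ⟨h1, h2⟩ := hηoff y hyb
      have h3 : fderiv ℝ (g t) y = 0 := image_eq_zero_of_notMem_tsupport fun h' =>
        hyb (hηs (hgsub t (tsupport_fderiv_subset ℝ h')))
      have h4 : g t y = 0 := by simp [hg, h1]
      simp [hX, hY, h1, h2, h3, h4]
  have hχX : ∀ t, Integrable (fun y => (Metric.ball x r).indicator (χ t) y * X y)
      (areaMeasure C) := by
    intro t
    refine hXint.bdd_mul (c := 1) ?_ (Eventually.of_forall fun y => ?_)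
    · rw [aestronglyMeasurable_indicator_iff Metric.isOpen_ball.measurableSet]
      have hcont : ContinuousOn (χ t) (Metric.ball x r) :=
        step_contDiff.continuous.comp_continuousOn
          ((h.contDiffOn.continuousOn.neg).div_const t)
      exact (hcont.aestronglyMeasurable Metric.isOpen_ball.measurableSet).mono_measure
        (Measure.restrict_mono_measure Measure.restrict_le_self _)
    · by_cases hyb : y ∈ Metric.ball x r
      · rw [indicator_of_mem hyb, Real.norm_of_nonneg (step_nonneg _)]
        exact step_le_one _
      · simp [hyb]
  have hYint : ∀ t, 0 < t → Integrable (fun y => t⁻¹ * Y t y) (areaMeasure C) := by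
    intro t ht
    have hgi := (integrable_flux_left hC hF hB (u := u) (hgC t)).add
      (integrable_flux_right hC hF hB (u := u) (Du := Du) (hgC t))
    refine ((hχX t).sub hgi).congr ?_
    refine ae_restrict_of_forall_mem isOpen_interior.measurableSet fun y hy => ?_
    have := hident t ht y hy
    simp only [Pi.sub_apply, Pi.add_apply]
    linarith
  have hYeq : ∀ t, 0 < t → ∫ y in interior C, t⁻¹ * Y t y
      = ∫ y in interior C, (Metric.ball x r).indicator (χ t) y * X y := by
    intro t ht
    have h0 := weakFlux_eq_zero hC hF hB hu (hgC t) (hgc t) (hgs t ht)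
    rw [weakFlux, setIntegral_congr_fun isOpen_interior.measurableSet (hident t ht),
      integral_sub (hχX t) (hYint t ht)] at h0
    linarith
  have hlim : Tendsto (fun t => ∫ y in interior C, t⁻¹ * Y t y) (𝓝[>] 0)
      (𝓝 (weakFlux C F B u Du η)) := by
    have h1 : Tendsto (fun t => ∫ y in interior C, (Metric.ball x r).indicator (χ t) y * X y)
        (𝓝[>] 0) (𝓝 (∫ y in interior C, X y)) := by
      refine tendsto_integral_filter_of_dominated_convergence (fun y => ‖X y‖)
        (Eventually.of_forall fun t => (hχX t).aestronglyMeasurable)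
        (Eventually.of_forall fun t => Eventually.of_forall fun y => ?_) hXint.norm ?_
      · rw [norm_mul]
        refine mul_le_of_le_one_left (norm_nonneg _) ?_
        by_cases hyb : y ∈ Metric.ball x r
        · rw [indicator_of_mem hyb, Real.norm_of_nonneg (step_nonneg _)]
          exact step_le_one _
        · simp [hyb]
      · refine ae_restrict_of_forall_mem isOpen_interior.measurableSet fun y hy => ?_
        by_cases hyb : y ∈ Metric.ball x r
        · have hφy := h.neg_of_mem_interior hyb hy
          refine tendsto_const_nhds.congr' ?_
          have hpos : 0 < -φ y / 2 := by linarith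
          filter_upwards [Ioo_mem_nhdsGT hpos] with t ht
          have : χ t y = 1 := step_of_ge (by rw [le_div_iff₀ ht.1]; linarith [ht.2])
          rw [indicator_of_mem hyb, this, one_mul]
        · obtain ⟨h1, h2⟩ := hηoff y hyb
          simp [hX, h1, h2]
    refine h1.congr' ?_
    filter_upwards [self_mem_nhdsWithin] with t ht using (hYeq t ht).symm
  obtain ⟨Mρ, hMρ0, hMρ⟩ := exists_deriv_step_le
  obtain ⟨Mη, hMη⟩ := hηc.exists_bound_of_continuous hη.continuous
  obtain ⟨Mp, hMp⟩ := hC.exists_bound_of_continuousOn hp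
  obtain ⟨Ma, hMa⟩ := hηc.isCompact.exists_bound_of_continuousOn
    ((h.continuousOn_fderiv_apply hV).mono hηs)
  obtain ⟨R, hR⟩ := hB.bounded
  have hMη0 : 0 ≤ Mη := (norm_nonneg _).trans (hMη 0)
  have hMa0 : 0 ≤ Ma := (norm_nonneg _).trans (hMa y₀ hy₀)
  have hR0 : 0 ≤ R := (abs_nonneg _).trans (hR 0)
  have hc := h.pos
  set A := Mη * Mρ * |Mp| with hA
  have hA0 : 0 ≤ A := by positivity
  set K' := |K| with hK'
  have hBK' : ∀ ζ, B ζ ≤ K' * ‖ζ‖ ^ 2 := fun ζ =>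
    (hBK ζ).trans (mul_le_mul_of_nonneg_right (le_abs_self K) (sq_nonneg _))
  refine le_of_forall_pos_le_add fun ε hε => ?_
  set δ := ε / (2 * (A * R * (2 * r / c) + 1)) with hδ
  set ε' := ε / (2 * (A * Ma * K' + 1)) with hε'
  have hδ0 : 0 < δ := by positivity
  have hε'0 : 0 < ε' := by positivity
  set a : Plane → ℝ := fun y => fderiv ℝ φ y (V y) with ha
  have hacont : ContinuousOn a (tsupport η) := (h.continuousOn_fderiv_apply hV).mono hηs
  have hφcont : ContinuousOn φ (tsupport η) := h.contDiffOn.continuousOn.mono hηs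
  -- The part of the support where the inflow speed is at least `δ`. Its zeros of `φ` form a compact
  -- piece of the leading edge; elsewhere in the support the loss is at most of order `δ`.
  set Kδ : Set Plane := tsupport η ∩ a ⁻¹' Iic (-δ) with hKδ
  have hKδc : IsCompact Kδ :=
    hηc.isCompact.of_isClosed_subset
      (hacont.preimage_isClosed_of_isClosed (isClosed_tsupport _) isClosed_Iic) inter_subset_left
  have hKzc : IsCompact (Kδ ∩ φ ⁻¹' {0}) :=
    hKδc.of_isClosed_subset ((hφcont.mono inter_subset_left).preimage_isClosed_of_isClosed
      hKδc.isClosed isClosed_singleton) inter_subset_left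
  obtain ⟨N, hNo, hKN, hNlim⟩ := h.exists_open_tendsto hV htr hKzc
    (fun y hy => hηs hy.1.1) (fun y hy => hy.2) (fun y hy => by
      have : a y ≤ -δ := hy.1.2
      show a y < 0
      linarith)
  -- On the compact set `Kδ \ N` the function `|φ|` is bounded below by a positive number, so thin
  -- layers miss it.
  have hsep : ∀ᶠ t : ℝ in 𝓝[>] 0, ∀ y ∈ Kδ, y ∈ strip φ x r t → y ∈ N := by
    have hKc : IsCompact (Kδ \ N) := hKδc.diff hNo
    rcases (Kδ \ N).eq_empty_or_nonempty with hemp' | hne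
    · exact Eventually.of_forall fun t y hy _ => by
        by_contra hyN
        exact (hemp' ▸ (⟨hy, hyN⟩ : y ∈ Kδ \ N) : y ∈ (∅ : Set Plane))
    · obtain ⟨y₁, hy₁, hmin⟩ := hKc.exists_isMinOn hne
        (((hφcont.mono (sdiff_subset.trans inter_subset_left)).abs) :
          ContinuousOn (fun y => |φ y|) (Kδ \ N))
      have hm : 0 < |φ y₁| := abs_pos.2 fun h0 => hy₁.2 (hKN ⟨hy₁.1, h0⟩)
      filter_upwards [Ioo_mem_nhdsGT (half_pos hm)] with t ht y hy hst
      by_contra hyN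
      have h1 : |φ y₁| ≤ |φ y| := hmin ⟨hy, hyN⟩
      have h2 : |φ y| ≤ 2 * t := by
        rw [abs_le]
        exact ⟨hst.2.1, by linarith [hst.2.2, ht.1]⟩
      linarith [ht.2]
  have hev : ∀ᶠ t in 𝓝[>] (0 : ℝ), -ε ≤ ∫ y in interior C, t⁻¹ * Y t y := by
    filter_upwards [hsep, hNlim.eventually (ge_mem_nhds (ENNReal.ofReal_pos.2 hε'0)),
      self_mem_nhdsWithin] with t hsep_t hNt ht
    have ht : 0 < t := ht
    have hSm : MeasurableSet (strip φ x r t) := h.measurableSet_inter_preimage isClosed_Icc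
    have hSNm : MeasurableSet (strip φ x r t ∩ N) := hSm.inter hNo.measurableSet
    -- Slow inflow and outflow use the bound `B ≤ R`, with the constant `δ`; fast inflow lies in `N`
    -- and uses `B(u) ≤ K' ‖u‖²`. After averaging, the volume of the layer controls the first term
    -- and the zero trace the second, each by `ε / 2`.
    have hpt : ∀ y ∈ interior C,
        -((A * δ * R) * (strip φ x r t).indicator (fun _ => (1 : ℝ)) y
          + (A * Ma * K') * (strip φ x r t ∩ N).indicator (fun y => ‖u y‖ ^ 2) y) ≤ Y t y := by
      intro y hyC
      have hnn : 0 ≤ (A * δ * R) * (strip φ x r t).indicator (fun _ => (1 : ℝ)) y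
          + (A * Ma * K') * (strip φ x r t ∩ N).indicator (fun y => ‖u y‖ ^ 2) y :=
        add_nonneg (mul_nonneg (by positivity) (indicator_nonneg (fun _ _ => zero_le_one) y))
          (mul_nonneg (by positivity) (indicator_nonneg (fun _ _ => sq_nonneg _) y))
      by_cases hyη : y ∈ tsupport η
      swap
      · have : Y t y = 0 := by simp [hY, image_eq_zero_of_notMem_tsupport hyη]
        linarith
      by_cases hys : y ∈ strip φ x r t
      swap
      · have hnot : -φ y / t ∉ Icc 1 2 := by
          rintro ⟨h1, h2⟩
          rw [le_div_iff₀ ht] at h1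
          rw [div_le_iff₀ ht] at h2
          exact hys ⟨hηs hyη, by linarith, by linarith⟩
        have : Y t y = 0 := by simp [hY, deriv_step_eq_zero hnot]
        linarith
      have hpy : 0 ≤ p y := hp0 y (interior_subset hyC)
      have hpM : p y ≤ |Mp| :=
        (le_abs_self _).trans ((hMp y (interior_subset hyC)).trans (le_abs_self _))
      set q := η y * deriv step (-φ y / t) * p y with hq
      have hq0 : 0 ≤ q := mul_nonneg (mul_nonneg (hη0 y) (deriv_step_nonneg _)) hpy
      have hqA : q ≤ A :=
        mul_le_mul (mul_le_mul ((le_abs_self _).trans (hMη y)) (hMρ _) (deriv_step_nonneg _) hMη0)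
          hpM hpy (by positivity)
      have hYq : Y t y = q * (a y * B (u y)) := by
        simp only [hY, hq, hFdef, ha, map_smul, smul_eq_mul]; ring
      have hBy := hB0 (u y)
      rw [hYq, indicator_of_mem hys]
      by_cases hay : a y ≤ -δ
      · have hyN : y ∈ N := hsep_t y ⟨hyη, hay⟩ hys
        rw [indicator_of_mem (show y ∈ strip φ x r t ∩ N from ⟨hys, hyN⟩)]
        have hMay : -Ma ≤ a y := (abs_le.1 (hMa y hyη)).1
        have h1 : -(Ma * (K' * ‖u y‖ ^ 2)) ≤ a y * B (u y) := by
          have h2 : Ma * B (u y) ≤ Ma * (K' * ‖u y‖ ^ 2) :=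
            mul_le_mul_of_nonneg_left (hBK' _) hMa0
          nlinarith
        have h3 : q * (Ma * (K' * ‖u y‖ ^ 2)) ≤ A * (Ma * (K' * ‖u y‖ ^ 2)) :=
          mul_le_mul_of_nonneg_right hqA (by positivity)
        have h4 : q * -(Ma * (K' * ‖u y‖ ^ 2)) ≤ q * (a y * B (u y)) :=
          mul_le_mul_of_nonneg_left h1 hq0
        have h5 : 0 ≤ A * δ * R * 1 := by positivity
        linarith
      · have hay' : -δ ≤ a y := (not_le.1 hay).le
        have hBR : B (u y) ≤ R := (le_abs_self _).trans (hR _)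
        have h1 : -(δ * R) ≤ a y * B (u y) := by
          have h2 : δ * B (u y) ≤ δ * R := mul_le_mul_of_nonneg_left hBR hδ0.le
          nlinarith
        have h3 : q * (δ * R) ≤ A * (δ * R) := mul_le_mul_of_nonneg_right hqA (by positivity)
        have h4 : q * -(δ * R) ≤ q * (a y * B (u y)) := mul_le_mul_of_nonneg_left h1 hq0
        have h5 : 0 ≤ (A * Ma * K') * (strip φ x r t ∩ N).indicator (fun y => ‖u y‖ ^ 2) y :=
          mul_nonneg (by positivity) (indicator_nonneg (fun _ _ => sq_nonneg _) y)
        linarith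
    have hi1 : Integrable ((strip φ x r t).indicator fun _ => (1 : ℝ)) (areaMeasure C) :=
      (integrable_const 1).indicator hSm
    have hi2 : Integrable ((strip φ x r t ∩ N).indicator fun y => ‖u y‖ ^ 2) (areaMeasure C) :=
      ((Lp.memLp u).integrable_norm_pow two_ne_zero).indicator hSNm
    have hmono : ∫ y in interior C, t⁻¹ *
        -((A * δ * R) * (strip φ x r t).indicator (fun _ => (1 : ℝ)) y
          + (A * Ma * K') * (strip φ x r t ∩ N).indicator (fun y => ‖u y‖ ^ 2) y)
        ≤ ∫ y in interior C, t⁻¹ * Y t y := by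
      refine setIntegral_mono_on ?_ (hYint t ht) isOpen_interior.measurableSet fun y hy =>
        mul_le_mul_of_nonneg_left (hpt y hy) (by positivity)
      exact (((hi1.const_mul _).add (hi2.const_mul _)).neg).const_mul _
    rw [integral_const_mul, integral_neg, integral_add (hi1.const_mul _) (hi2.const_mul _),
      integral_const_mul, integral_const_mul] at hmono
    have hvol : t⁻¹ * ∫ y in interior C, (strip φ x r t).indicator (fun _ => (1 : ℝ)) y
        ≤ 2 * r / c := by
      rw [integral_indicator hSm, setIntegral_const, smul_eq_mul, mul_one, Measure.real,
        Measure.restrict_apply hSm]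
      have h1 : volume (strip φ x r t ∩ interior C)
          ≤ ENNReal.ofReal (t / c * (2 * r)) := by
        rw [ENNReal.ofReal_mul (by positivity)]
        exact (measure_mono inter_subset_left).trans (h.volume_strip_le t)
      have h2 := ENNReal.toReal_le_of_le_ofReal (by positivity) h1
      calc t⁻¹ * (volume (strip φ x r t ∩ interior C)).toReal
          ≤ t⁻¹ * (t / c * (2 * r)) := by gcongr
        _ = 2 * r / c := by field_simp
    have hsq := inv_mul_integral_indicator_sq_le hSNm ht hε'0.le hNt
    have hb1 : A * δ * R * (2 * r / c) ≤ ε / 2 := by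
      have := mul_div_two_mul_add_one_le (a := A * R * (2 * r / c)) (by positivity) hε.le
      calc A * δ * R * (2 * r / c) = A * R * (2 * r / c) * δ := by ring
        _ ≤ ε / 2 := this
    have hb2 : A * Ma * K' * ε' ≤ ε / 2 :=
      mul_div_two_mul_add_one_le (by positivity) hε.le
    have hb3 : A * δ * R * (t⁻¹ * ∫ y in interior C,
        (strip φ x r t).indicator (fun _ => (1 : ℝ)) y) ≤ A * δ * R * (2 * r / c) :=
      mul_le_mul_of_nonneg_left hvol (by positivity)
    have hb4 : A * Ma * K' * (t⁻¹ * ∫ y in interior C,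
        (strip φ x r t ∩ N).indicator (fun y => ‖u y‖ ^ 2) y) ≤ A * Ma * K' * ε' :=
      mul_le_mul_of_nonneg_left hsq (by positivity)
    refine le_trans ?_ hmono
    linarith
  have := ge_of_tendsto hlim hev
  linarith

end FrBD

end

/-! ### Removing the corners and globalising -/

noncomputable section

open scoped Manifold

namespace FrBD

/-- Smooth functions vanishing near a point, with gradients small in `L¹`. -/
theorem exists_cutoff_point (a : Plane) :
    ∃ η : ℕ → Plane → ℝ, (∀ k, ContDiff ℝ 1 (η k)) ∧ (∀ k x, 0 ≤ η k x) ∧ (∀ k x, η k x ≤ 1) ∧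
      (∀ k, a ∉ tsupport (η k)) ∧ (∀ x, x ≠ a → Tendsto (fun k => η k x) atTop (𝓝 1)) ∧
      (∀ k, Integrable fun x => ‖fderiv ℝ (η k) x‖) ∧
      Tendsto (fun k => ∫ x, ‖fderiv ℝ (η k) x‖) atTop (𝓝 0) := by
  set G : Plane → ℝ := fun y => step (‖y‖ ^ 2) with hG
  have hGC : ContDiff ℝ 1 G := step_contDiff.comp (contDiff_norm_sq ℝ)
  have hG1 : ∀ y, y ∉ Metric.closedBall (0 : Plane) 2 → fderiv ℝ G y = 0 := by
    intro y hy
    have h2 : 2 < ‖y‖ := by simpa using hy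
    have : G =ᶠ[𝓝 y] fun _ => 1 := by
      filter_upwards [continuous_norm.continuousAt.eventually (lt_mem_nhds h2)] with z hz
      exact step_of_ge (by nlinarith)
    rw [this.fderiv_eq, fderiv_fun_const]; rfl
  have hGc : HasCompactSupport (fderiv ℝ G) :=
    HasCompactSupport.intro (isCompact_closedBall _ _) hG1
  obtain ⟨M, hM⟩ := hGc.exists_bound_of_continuous (hGC.continuous_fderiv one_ne_zero)
  have hM0 : 0 ≤ M := (norm_nonneg _).trans (hM 0)
  set η : ℕ → Plane → ℝ := fun k x => G (((k : ℝ) + 1) • (x - a)) with hη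
  have hηC : ∀ k, ContDiff ℝ 1 (η k) := fun k =>
    hGC.comp ((contDiff_id.sub contDiff_const).const_smul ((k : ℝ) + 1))
  have hηd : ∀ (k : ℕ) x, fderiv ℝ (η k) x = ((k : ℝ) + 1) • fderiv ℝ G (((k : ℝ) + 1) • (x - a)) := by
    intro k x
    have h1 : HasFDerivAt (fun x => ((k : ℝ) + 1) • (x - a))
        (((k : ℝ) + 1) • ContinuousLinearMap.id ℝ Plane) x :=
      ((hasFDerivAt_id x).sub_const a).fun_const_smul _
    have h2 := ((hGC.differentiable one_ne_zero (((k : ℝ) + 1) • (x - a))).hasFDerivAt).comp x h1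
    rw [show η k = G ∘ fun x => ((k : ℝ) + 1) • (x - a) from rfl, h2.fderiv]
    ext v; simp
  have hηoff : ∀ (k : ℕ) x, x ∉ Metric.closedBall a (2 / ((k : ℝ) + 1)) → fderiv ℝ (η k) x = 0 := by
    intro k x hx
    rw [hηd, hG1 _ ?_, smul_zero]
    intro hx'
    apply hx
    have hk : (0 : ℝ) < (k : ℝ) + 1 := by positivity
    rw [mem_closedBall_zero_iff, norm_smul, Real.norm_of_nonneg hk.le] at hx'
    rw [Metric.mem_closedBall, dist_eq_norm, le_div_iff₀ hk]
    linarith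
  have hint : ∀ k, Integrable fun x => ‖fderiv ℝ (η k) x‖ := fun k =>
    (((hηC k).continuous_fderiv one_ne_zero).integrable_of_hasCompactSupport
      (HasCompactSupport.intro (isCompact_closedBall _ _) (hηoff k))).norm
  refine ⟨η, hηC, fun k x => step_nonneg _, fun k x => step_le_one _, ?_, ?_, hint, ?_⟩
  · intro k
    rw [notMem_tsupport_iff_eventuallyEq]
    have hc : ContinuousAt (fun x => ‖((k : ℝ) + 1) • (x - a)‖ ^ 2) a :=
      Continuous.continuousAt (by fun_prop)
    have h0 : ‖((k : ℝ) + 1) • (a - a)‖ ^ 2 < 1 := by simp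
    filter_upwards [hc.eventually_lt_const h0] with z hz
    exact step_of_le hz.le
  · intro x hx
    have hxa : 0 < ‖x - a‖ := norm_pos_iff.2 (sub_ne_zero.2 hx)
    refine tendsto_const_nhds.congr' ?_
    have ht : Tendsto (fun k : ℕ => ((k : ℝ) + 1) * ‖x - a‖) atTop atTop :=
      (tendsto_atTop_add_const_right _ _ tendsto_natCast_atTop_atTop).atTop_mul_const hxa
    filter_upwards [ht.eventually_ge_atTop 2] with k hk
    have : η k x = 1 := by
      refine step_of_ge ?_
      rw [norm_smul, Real.norm_of_nonneg (by positivity)]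
      nlinarith
    exact this.symm
  · set v := volume.real (Metric.ball (0 : Plane) 1) with hv
    -- The gradient is at most `(k+1) M` and lives on a disc of radius `2/(k+1)`, of area
    -- `4v/(k+1)²`; one factor `1/(k+1)` remains.
    have hle : ∀ k : ℕ, ∫ x, ‖fderiv ℝ (η k) x‖ ≤ (4 * M * v) * (1 / ((k : ℝ) + 1)) := by
      intro k
      have hk : (0 : ℝ) < (k : ℝ) + 1 := by positivity
      have hb : ∀ x, ‖fderiv ℝ (η k) x‖
          ≤ (Metric.closedBall a (2 / ((k : ℝ) + 1))).indicator (fun _ => ((k : ℝ) + 1) * M) x := by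
        intro x
        by_cases hx : x ∈ Metric.closedBall a (2 / ((k : ℝ) + 1))
        · rw [indicator_of_mem hx, hηd, norm_smul, Real.norm_of_nonneg hk.le]
          exact mul_le_mul_of_nonneg_left (hM _) hk.le
        · rw [hηoff k x hx, norm_zero, indicator_of_notMem hx]
      have hfin : volume (Metric.closedBall a (2 / ((k : ℝ) + 1))) ≠ ⊤ :=
        (isCompact_closedBall _ _).measure_lt_top.ne
      refine (integral_mono (hint k) ((integrable_indicator_iff
        Metric.isClosed_closedBall.measurableSet).2 (integrableOn_const hfin)) hb).trans ?_
      rw [integral_indicator Metric.isClosed_closedBall.measurableSet, setIntegral_const,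
        Measure.real, Measure.addHaar_closedBall _ _ (by positivity), ENNReal.toReal_mul,
        ENNReal.toReal_ofReal (by positivity), smul_eq_mul, ← Measure.real, ← hv]
      simp only [finrank_euclideanSpace, Fintype.card_fin]
      apply le_of_eq
      field_simp
      ring
    refine squeeze_zero (fun k => integral_nonneg fun x => norm_nonneg _) hle ?_
    simpa using tendsto_one_div_add_atTop_nhds_zero_nat.const_mul (4 * M * v)

/-- Points of the plane have zero capacity: smooth functions vanishing near a finite set, with
gradients small in `L¹`. -/
theorem exists_cutoff {E : Set Plane} (hE : E.Finite) :
    ∃ η : ℕ → Plane → ℝ, (∀ k, ContDiff ℝ 1 (η k)) ∧ (∀ k x, 0 ≤ η k x) ∧ (∀ k x, η k x ≤ 1) ∧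
      (∀ k, ∀ a ∈ E, a ∉ tsupport (η k)) ∧
      (∀ x, x ∉ E → Tendsto (fun k => η k x) atTop (𝓝 1)) ∧
      (∀ k, Integrable fun x => ‖fderiv ℝ (η k) x‖) ∧
      Tendsto (fun k => ∫ x, ‖fderiv ℝ (η k) x‖) atTop (𝓝 0) := by
  induction E, hE using Set.Finite.induction_on with
  | empty =>
    refine ⟨fun _ _ => 1, fun _ => contDiff_const, by simp, by simp, by simp, by simp, ?_, ?_⟩ <;>
      simp
  | @insert a E _ _ ih =>
    obtain ⟨η, h1, h2, h3, h4, h5, h6, h7⟩ := ih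
    obtain ⟨g, g1, g2, g3, g4, g5, g6, g7⟩ := exists_cutoff_point a
    have hb : ∀ k x, ‖fderiv ℝ (fun x => η k x * g k x) x‖
        ≤ ‖fderiv ℝ (η k) x‖ + ‖fderiv ℝ (g k) x‖ := by
      intro k x
      rw [fderiv_fun_mul ((h1 k).differentiable one_ne_zero x)
        ((g1 k).differentiable one_ne_zero x), add_comm]
      refine (norm_add_le _ _).trans (add_le_add ?_ ?_)
      · rw [norm_smul, Real.norm_of_nonneg (g2 k x)]
        exact mul_le_of_le_one_left (norm_nonneg _) (g3 k x)
      · rw [norm_smul, Real.norm_of_nonneg (h2 k x)]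
        exact mul_le_of_le_one_left (norm_nonneg _) (h3 k x)
    have hC : ∀ k, ContDiff ℝ 1 fun x => η k x * g k x := fun k => (h1 k).mul (g1 k)
    have hi : ∀ k, Integrable fun x => ‖fderiv ℝ (fun x => η k x * g k x) x‖ := fun k =>
      ((h6 k).add (g6 k)).mono' ((hC k).continuous_fderiv one_ne_zero).norm.aestronglyMeasurable
        (Eventually.of_forall fun x => by rw [norm_norm]; exact hb k x)
    refine ⟨fun k x => η k x * g k x, hC, fun k x => mul_nonneg (h2 k x) (g2 k x),
      fun k x => mul_le_one₀ (h3 k x) (g2 k x) (g3 k x), ?_, ?_, hi, ?_⟩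
    · rintro k b (rfl | hb) hmem
      · exact g4 k (tsupport_mul_subset_right hmem)
      · exact h4 k b hb (tsupport_mul_subset_left hmem)
    · intro x hx
      rw [mem_insert_iff, not_or] at hx
      simpa using (h5 x hx.2).mul (g5 x hx.1)
    · refine squeeze_zero (fun k => integral_nonneg fun x => norm_nonneg _) (fun k => ?_)
        (by simpa using h7.add g7)
      rw [← integral_add (h6 k) (g6 k)]
      exact integral_mono (hi k) ((h6 k).add (g6 k)) (hb k)

/-- A smooth partition of unity localises to balls around points of the support of `η`. At interior
points the flux is zero, at regular boundary points the chart estimate applies, and corners do not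
occur. -/
theorem weakFlux_nonneg_of_notMem_tsupport {C : Set Plane} (hC : IsCompact C) {V : Plane → Plane}
    (hV : Continuous V) {p : Plane → ℝ} (hp : ContinuousOn p C) (hp0 : ∀ x ∈ C, 0 ≤ p x)
    (hF : IsBoundedC1Field C fun y => p y • V y) {B : Plane → ℝ} (hB : IsBoundedC1 B)
    (hB0 : ∀ ζ, 0 ≤ B ζ) {K : ℝ} (hBK : ∀ ζ, B ζ ≤ K * ‖ζ‖ ^ 2) {u : L2 C} {Du : L2Grad C}
    (hu : HasWeakDeriv C u Du) (htr : HasTraceOn C (leadingEdge C V) u Du fun _ => 0)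
    {η : Plane → ℝ} (hη : ContDiff ℝ 1 η) (hη0 : ∀ y, 0 ≤ η y)
    (hηE : ∀ a ∈ {x ∈ frontier C | ¬ ∃ n, IsOutwardUnitNormal C x n}, a ∉ tsupport η) :
    0 ≤ weakFlux C (fun y => p y • V y) B u Du η := by
  have hloc : ∀ x ∈ C ∩ tsupport η, ∃ r > 0, ∀ θ : Plane → ℝ, ContDiff ℝ 1 θ → (∀ y, 0 ≤ θ y) →
      HasCompactSupport θ → tsupport θ ⊆ Metric.ball x r →
      0 ≤ weakFlux C (fun y => p y • V y) B u Du θ := by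
    rintro x ⟨hxC, hxη⟩
    by_cases hxi : x ∈ interior C
    · obtain ⟨r, hr, hball⟩ := Metric.isOpen_iff.1 isOpen_interior x hxi
      exact ⟨r, hr, fun θ h1 _ h3 h4 =>
        (weakFlux_eq_zero hC hF hB hu h1 h3 (h4.trans hball)).ge⟩
    · have hfr : x ∈ frontier C := ⟨subset_closure hxC, hxi⟩
      by_cases hn : ∃ n, IsOutwardUnitNormal C x n
      · obtain ⟨n, hn⟩ := hn
        obtain ⟨φ, r, c, e, hr, hch⟩ := hn.exists_chart
        exact ⟨r, hr, fun θ h1 h2 h3 h4 =>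
          hch.weakFlux_nonneg hC hV hp hp0 hF hB hB0 hBK hu htr h1 h2 h3 h4⟩
      · exact absurd hxη (hηE x ⟨hfr, hn⟩)
  choose! r hr hrθ using hloc
  have hKc : IsCompact (C ∩ tsupport η) := hC.inter_right (isClosed_tsupport η)
  obtain ⟨t, htK, htcov⟩ := hKc.elim_nhds_subcover (fun x => Metric.ball x (r x))
    fun x hx => Metric.ball_mem_nhds x (hr x hx)
  obtain ⟨f, hf⟩ := SmoothPartitionOfUnity.exists_isSubordinate 𝓘(ℝ, Plane) hKc.isClosed
    (fun i : t => Metric.ball (i : Plane) (r i)) (fun i => Metric.isOpen_ball) (by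
      intro y hy
      obtain ⟨x, hx, hyx⟩ := mem_iUnion₂.1 (htcov hy)
      exact mem_iUnion.2 ⟨⟨x, hx⟩, hyx⟩)
  have hfC : ∀ i, ContDiff ℝ 1 (f i) := fun i =>
    ((f i).contMDiff.contDiff).of_le (by exact_mod_cast le_top)
  have hθC : ∀ i, ContDiff ℝ 1 fun y => f i y * η y := fun i => (hfC i).mul hη
  have hsum : weakFlux C (fun y => p y • V y) B u Du η
      = ∑ i, weakFlux C (fun y => p y • V y) B u Du fun y => f i y * η y := by
    rw [← weakFlux_sum hC hF hB _ fun i _ => hθC i]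
    -- The partition sums to one only on `C ∩ tsupport η`; off the support of `η` both sides vanish.
    refine weakFlux_congr fun y hy => ?_
    rw [← Finset.sum_mul]
    by_cases hyη : y ∈ tsupport η
    · have h1 := f.sum_eq_one (show y ∈ C ∩ tsupport η from ⟨interior_subset hy, hyη⟩)
      rw [finsum_eq_sum_of_fintype] at h1
      rw [h1, one_mul]
    · rw [image_eq_zero_of_notMem_tsupport hyη, mul_zero]
  rw [hsum]
  refine Finset.sum_nonneg fun i _ => ?_
  have hsub : tsupport (fun y => f i y * η y) ⊆ Metric.ball (i : Plane) (r i) :=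
    tsupport_mul_subset_left.trans (hf i)
  refine hrθ i (htK i i.2) _ (hθC i) (fun y => mul_nonneg (f.nonneg i y) (hη0 y)) ?_ hsub
  exact (isCompact_closedBall (i : Plane) (r i)).of_isClosed_subset (isClosed_tsupport _)
    (hsub.trans Metric.ball_subset_closedBall)

/-- The flux is tested with functions vanishing near the corners and tending to one elsewhere. The
divergence term is nonpositive, and the term with the cutoff gradient tends to zero in `L¹` because
`F` and `B` are bounded. What remains in the limit is the transport integral. -/
theorem integral_fderiv_comp_nonneg {C : Set Plane} (hC : IsCompact C)
    (hCbd : HasPiecewiseC1Boundary C) {V : Plane → Plane}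
    (hV : Continuous V) {p : Plane → ℝ} (hp : ContinuousOn p C) (hp0 : ∀ x ∈ C, 0 ≤ p x)
    (hF : IsBoundedC1Field C fun y => p y • V y)
    (hdiv : ∀ x ∈ interior C, divergence (fun y => p y • V y) x ≤ 0)
    {B : Plane → ℝ} (hB : IsBoundedC1 B)
    (hB0 : ∀ ζ, 0 ≤ B ζ) {K : ℝ} (hBK : ∀ ζ, B ζ ≤ K * ‖ζ‖ ^ 2) {u : L2 C} {Du : L2Grad C}
    (hu : HasWeakDeriv C u Du) (htr : HasTraceOn C (leadingEdge C V) u Du fun _ => 0) :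
    0 ≤ ∫ x in interior C, fderiv ℝ B (u x) (Du x (p x • V x)) := by
  set F : Plane → Plane := fun y => p y • V y with hFdef
  obtain ⟨η, h1, h2, h3, h4, h5, h6, h7⟩ := exists_cutoff hCbd
  obtain ⟨KF, hKF⟩ := hF.bounded
  obtain ⟨R, hR⟩ := hB.bounded
  have hmeas : MeasurableSet (interior C) := isOpen_interior.measurableSet
  have hflux : ∀ k, 0 ≤ weakFlux C F B u Du (η k) := fun k =>
    weakFlux_nonneg_of_notMem_tsupport hC hV hp hp0 hF hB hB0 hBK hu htr (h1 k) (h2 k) (h4 k)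
  have hint : Integrable (fun x => fderiv ℝ B (u x) (Du x (F x))) (areaMeasure C) := by
    simpa using integrable_flux_right hC hF hB (u := u) (Du := Du) (g := fun _ => 1) contDiff_const
  have hlim : Tendsto (fun k => ∫ x in interior C, η k x * fderiv ℝ B (u x) (Du x (F x))) atTop
      (𝓝 (∫ x in interior C, fderiv ℝ B (u x) (Du x (F x)))) := by
    refine tendsto_integral_of_dominated_convergence
      (fun x => ‖fderiv ℝ B (u x) (Du x (F x))‖)
      (fun k => (integrable_flux_right hC hF hB (h1 k)).aestronglyMeasurable) hint.norm
      (fun k => Eventually.of_forall fun x => ?_) ?_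
    · rw [norm_mul, Real.norm_of_nonneg (h2 k x)]
      exact mul_le_of_le_one_left (norm_nonneg _) (h3 k x)
    · refine ae_restrict_of_forall_mem hmeas fun x hx => ?_
      have hxE : x ∉ {x ∈ frontier C | ¬ ∃ n, IsOutwardUnitNormal C x n} := fun h => h.1.2 hx
      simpa using (h5 x hxE).mul_const (fderiv ℝ B (u x) (Du x (F x)))
  have hbound : ∀ k, ∫ x in interior C, (η k x * divergence F x + fderiv ℝ (η k) x (F x)) * B (u x)
      ≤ ((∫ x, ‖fderiv ℝ (η k) x‖) * |KF|) * R := by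
    intro k
    have hR0 : 0 ≤ R := (abs_nonneg _).trans (hR 0)
    have hi : Integrable (fun x => ‖fderiv ℝ (η k) x‖ * |KF| * R) volume :=
      ((h6 k).mul_const _).mul_const _
    rw [← integral_mul_const, ← integral_mul_const]
    refine (setIntegral_mono_on (integrable_flux_left hC hF hB (h1 k)) hi.integrableOn hmeas
      fun x hx => ?_).trans (setIntegral_le_integral hi (Eventually.of_forall fun x =>
        show (0 : ℝ) ≤ ‖fderiv ℝ (η k) x‖ * |KF| * R by positivity))
    have e1 : η k x * divergence F x + fderiv ℝ (η k) x (F x) ≤ ‖fderiv ℝ (η k) x‖ * |KF| := by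
      have e2 : η k x * divergence F x ≤ 0 := mul_nonpos_of_nonneg_of_nonpos (h2 k x) (hdiv x hx)
      have e3 : fderiv ℝ (η k) x (F x) ≤ ‖fderiv ℝ (η k) x‖ * |KF| :=
        (le_abs_self _).trans (((fderiv ℝ (η k) x).le_opNorm (F x)).trans
          (mul_le_mul_of_nonneg_left ((hKF x hx).trans (le_abs_self _)) (norm_nonneg _)))
      linarith
    calc (η k x * divergence F x + fderiv ℝ (η k) x (F x)) * B (u x)
        ≤ (‖fderiv ℝ (η k) x‖ * |KF|) * B (u x) := mul_le_mul_of_nonneg_right e1 (hB0 _)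
      _ ≤ ‖fderiv ℝ (η k) x‖ * |KF| * R :=
        mul_le_mul_of_nonneg_left ((le_abs_self _).trans (hR _)) (by positivity)
  have hlim2 : Tendsto (fun k => ((∫ x, ‖fderiv ℝ (η k) x‖) * |KF|) * R
      + ∫ x in interior C, η k x * fderiv ℝ B (u x) (Du x (F x))) atTop
      (𝓝 (∫ x in interior C, fderiv ℝ B (u x) (Du x (F x)))) := by
    simpa using ((h7.mul_const |KF|).mul_const R).add hlim
  refine ge_of_tendsto' hlim2 fun k => ?_
  have := hflux k
  rw [weakFlux_eq_add hC hF hB (h1 k)] at this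
  linarith [hbound k]

end FrBD

end

/-! ### Truncated quadratic forms and the transport inequality -/

noncomputable section

namespace FrBD

/-- Near each point of `C`, differentiability within `C` provides a derivative within `C` that is
locally bounded. At interior points it is the ordinary derivative, and compactness of `C` makes the
bound uniform. No unique differentiability at boundary points of `C` is needed. -/
theorem exists_fderiv_bound {C : Set Plane} (hC : IsCompact C) {p : Plane → ℝ}
    (hp : ContDiffOn ℝ 1 p C) : ∃ M : ℝ, ∀ x ∈ interior C, ‖fderiv ℝ p x‖ ≤ M := by
  have key : ∃ M : ℝ, ∀ x ∈ C ∩ interior C, ‖fderiv ℝ p x‖ ≤ M := by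
    refine hC.induction_on (p := fun s => ∃ M : ℝ, ∀ x ∈ s ∩ interior C, ‖fderiv ℝ p x‖ ≤ M)
      ⟨0, by simp⟩ ?_ ?_ ?_
    · rintro s t hst ⟨M, hM⟩
      exact ⟨M, fun x hx => hM x ⟨hst hx.1, hx.2⟩⟩
    · rintro s t ⟨M, hM⟩ ⟨M', hM'⟩
      refine ⟨max M M', fun x hx => ?_⟩
      rcases hx.1 with h | h
      · exact (hM x ⟨h, hx.2⟩).trans (le_max_left _ _)
      · exact (hM' x ⟨h, hx.2⟩).trans (le_max_right _ _)
    · intro x hx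
      have h1 : ContDiffWithinAt ℝ (0 + 1) p C x := by simpa using hp x hx
      obtain ⟨o, ho, -, f', hf', hf'c⟩ :=
        (contDiffWithinAt_succ_iff_hasFDerivWithinAt (by simp)).1 h1
      rw [insert_eq_of_mem hx] at ho
      have hev : ∀ᶠ y in 𝓝[C] x, ‖f' y‖ < ‖f' x‖ + 1 :=
        nhdsWithin_le_of_mem ho
          ((hf'c.continuousWithinAt.norm).eventually_lt_const (by linarith))
      obtain ⟨W, hWo, hxW, hW⟩ := mem_nhdsWithin.1 (inter_mem ho hev)
      refine ⟨W ∩ C, inter_mem (mem_nhdsWithin_of_mem_nhds (hWo.mem_nhds hxW))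
        self_mem_nhdsWithin, ‖f' x‖ + 1, fun y hy => ?_⟩
      obtain ⟨hyo, hyb⟩ := hW hy.1
      have hoy : o ∈ 𝓝 y := mem_of_superset
        ((hWo.inter isOpen_interior).mem_nhds ⟨hy.1.1, hy.2⟩)
        fun w hw => (hW ⟨hw.1, interior_subset hw.2⟩).1
      rw [((hf' y hyo).hasFDerivAt hoy).fderiv]
      exact hyb.le
  obtain ⟨M, hM⟩ := key
  exact ⟨M, fun x hx => hM x ⟨interior_subset hx, hx⟩⟩

theorem isBoundedC1Field_smul {C : Set Plane} (hC : IsCompact C) {p : Plane → ℝ}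
    (hp : ContDiffOn ℝ 1 p C) {V : Plane → Plane} (hV : ContDiff ℝ 1 V) :
    IsBoundedC1Field C fun y => p y • V y := by
  obtain ⟨M, hM⟩ := exists_fderiv_bound hC hp
  obtain ⟨Mp, hMp⟩ := hC.exists_bound_of_continuousOn hp.continuousOn
  obtain ⟨MV, hMV⟩ := hC.exists_bound_of_continuousOn hV.continuous.continuousOn
  obtain ⟨Md, hMd⟩ := hC.exists_bound_of_continuousOn
    ((continuousOn_divergence isOpen_univ hV.contDiffOn).mono (subset_univ C))
  have hsub : interior C ⊆ C := interior_subset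
  refine ⟨(hp.mono hsub).smul hV.contDiffOn, ⟨|Mp| * |MV|, fun x hx => ?_⟩,
    ⟨|Mp| * |Md| + |M| * |MV|, fun x hx => ?_⟩⟩
  · rw [norm_smul]
    exact mul_le_mul ((hMp x (hsub hx)).trans (le_abs_self _))
      ((hMV x (hsub hx)).trans (le_abs_self _)) (norm_nonneg _) (abs_nonneg _)
  · have hpd : DifferentiableAt ℝ p x :=
      ((hp.mono hsub).contDiffAt (isOpen_interior.mem_nhds hx)).differentiableAt one_ne_zero
    rw [divergence_smul hpd (hV.differentiable one_ne_zero x)]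
    refine (abs_add_le _ _).trans (add_le_add ?_ ?_)
    · rw [abs_mul]
      exact mul_le_mul ((hMp x (hsub hx)).trans (le_abs_self _))
        ((hMd x (hsub hx)).trans (le_abs_self _)) (abs_nonneg _) (abs_nonneg _)
    · exact ((fderiv ℝ p x).le_opNorm _).trans (mul_le_mul ((hM x hx).trans (le_abs_self _))
        ((hMV x (hsub hx)).trans (le_abs_self _)) (norm_nonneg _) (abs_nonneg _))

/-- The quadratic form of `S`, truncated at height `a`. -/
def truncatedForm (S : Plane →L[ℝ] Plane) (a : ℝ) (ζ : Plane) : ℝ :=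
  ⟪ζ, S ζ⟫ / (1 + ⟪ζ, S ζ⟫ / a)

theorem hasFDerivAt_quadraticForm {S : Plane →L[ℝ] Plane} (hS : ∀ x y, ⟪S x, y⟫ = ⟪x, S y⟫)
    (ζ : Plane) : HasFDerivAt (fun ζ => ⟪ζ, S ζ⟫) ((2 : ℝ) • innerSL ℝ (S ζ)) ζ := by
  have h := (hasFDerivAt_id (𝕜 := ℝ) ζ).inner ℝ S.hasFDerivAt
  refine h.congr_fderiv ?_
  ext v
  change ⟪ζ, S v⟫ + ⟪v, S ζ⟫ = 2 * ⟪S ζ, v⟫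
  rw [← hS, real_inner_comm (S ζ) v, two_mul]

theorem hasFDerivAt_truncatedForm {S : Plane →L[ℝ] Plane} (hS : ∀ x y, ⟪S x, y⟫ = ⟪x, S y⟫)
    (hS0 : ∀ ζ, 0 ≤ ⟪ζ, S ζ⟫) {a : ℝ} (ha : 0 < a) (ζ : Plane) :
    HasFDerivAt (truncatedForm S a)
      ((2 / (1 + ⟪ζ, S ζ⟫ / a) ^ 2) • innerSL ℝ (S ζ)) ζ := by
  have hq := hasFDerivAt_quadraticForm hS ζ
  have hpos : 0 < 1 + ⟪ζ, S ζ⟫ / a := by have := hS0 ζ; positivity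
  have hθ : HasDerivAt (fun s : ℝ => s / (1 + s / a)) (1 / (1 + ⟪ζ, S ζ⟫ / a) ^ 2) ⟪ζ, S ζ⟫ := by
    have h1 : HasDerivAt (fun s : ℝ => 1 + s / a) (1 / a) ⟪ζ, S ζ⟫ :=
      ((hasDerivAt_id _).div_const a).const_add 1
    refine ((hasDerivAt_id' _).div h1 hpos.ne').congr_deriv ?_
    congr 1
    ring
  refine (hθ.comp_hasFDerivAt ζ hq).congr_fderiv ?_
  rw [smul_smul]
  congr 1
  ring

theorem fderiv_truncatedForm {S : Plane →L[ℝ] Plane} (hS : ∀ x y, ⟪S x, y⟫ = ⟪x, S y⟫)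
    (hS0 : ∀ ζ, 0 ≤ ⟪ζ, S ζ⟫) {a : ℝ} (ha : 0 < a) (ζ v : Plane) :
    fderiv ℝ (truncatedForm S a) ζ v = 2 / (1 + ⟪ζ, S ζ⟫ / a) ^ 2 * ⟪S ζ, v⟫ := by
  rw [(hasFDerivAt_truncatedForm hS hS0 ha ζ).fderiv]
  simp

theorem truncatedForm_nonneg {S : Plane →L[ℝ] Plane} (hS0 : ∀ ζ, 0 ≤ ⟪ζ, S ζ⟫) {a : ℝ}
    (ha : 0 < a) (ζ : Plane) : 0 ≤ truncatedForm S a ζ := by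
  have := hS0 ζ
  unfold truncatedForm
  positivity

theorem truncatedForm_le {S : Plane →L[ℝ] Plane} (hS0 : ∀ ζ, 0 ≤ ⟪ζ, S ζ⟫) {a : ℝ}
    (ha : 0 < a) (ζ : Plane) : truncatedForm S a ζ ≤ ‖S‖ * ‖ζ‖ ^ 2 := by
  have h0 := hS0 ζ
  refine (div_le_self h0 (le_add_of_nonneg_right (by positivity))).trans ?_
  refine (real_inner_le_norm _ _).trans ?_
  calc ‖ζ‖ * ‖S ζ‖ ≤ ‖ζ‖ * (‖S‖ * ‖ζ‖) := by gcongr; exact S.le_opNorm ζ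
    _ = ‖S‖ * ‖ζ‖ ^ 2 := by ring

/-- The function `s / (1 + s / a)` saturates at `a`, and its derivative decays like the inverse
square of `1 + s / a`. Coercivity bounds `‖ζ‖` by a multiple of `1 + q / a`, so this decay absorbs
the linear growth of `S ζ`. -/
theorem isBoundedC1_truncatedForm {S : Plane →L[ℝ] Plane} (hS : ∀ x y, ⟪S x, y⟫ = ⟪x, S y⟫)
    {c : ℝ} (hc : 0 < c) (hSc : ∀ ζ, c * ‖ζ‖ ^ 2 ≤ ⟪ζ, S ζ⟫) {a : ℝ} (ha : 0 < a) :
    IsBoundedC1 (truncatedForm S a) := by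
  have hS0 : ∀ ζ, 0 ≤ ⟪ζ, S ζ⟫ := fun ζ => le_trans (by positivity) (hSc ζ)
  have hq : ContDiff ℝ 1 fun ζ : Plane => ⟪ζ, S ζ⟫ := contDiff_id.inner ℝ S.contDiff
  have hden : ∀ ζ : Plane, 0 < 1 + ⟪ζ, S ζ⟫ / a := fun ζ => by have := hS0 ζ; positivity
  refine ⟨hq.div (contDiff_const.add (hq.div_const a)) fun ζ => (hden ζ).ne', ⟨a, fun ζ => ?_⟩,
    ⟨2 * (‖S‖ * (1 + a / c)), fun ζ => ?_⟩⟩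
  · rw [abs_of_nonneg (truncatedForm_nonneg hS0 ha ζ), truncatedForm, div_le_iff₀ (hden ζ)]
    have : a * (1 + ⟪ζ, S ζ⟫ / a) = a + ⟪ζ, S ζ⟫ := by field_simp
    linarith
  · rw [(hasFDerivAt_truncatedForm hS hS0 ha ζ).fderiv, norm_smul, innerSL_apply_norm,
      Real.norm_of_nonneg (by have := hden ζ; positivity)]
    set q := ⟪ζ, S ζ⟫ with hqdef
    have h1 : 1 ≤ 1 + q / a := le_add_of_nonneg_right (div_nonneg (hS0 ζ) ha.le)
    have h2 : ‖ζ‖ ≤ (1 + a / c) * (1 + q / a) := by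
      have h3 : c * ‖ζ‖ ^ 2 ≤ q := hSc ζ
      have h4 : a / c * (q / a) = q / c := by field_simp
      have h5 : ‖ζ‖ ^ 2 ≤ q / c := by rw [le_div_iff₀ hc]; linarith
      have h6 : 0 ≤ a / c := by positivity
      have h7 : 0 ≤ q / a := div_nonneg (hS0 ζ) ha.le
      nlinarith [sq_nonneg (‖ζ‖ - 1), norm_nonneg ζ]
    rw [div_mul_eq_mul_div, div_le_iff₀ (by positivity)]
    have h8 : ‖S ζ‖ ≤ ‖S‖ * ((1 + a / c) * (1 + q / a)) :=
      (S.le_opNorm ζ).trans (mul_le_mul_of_nonneg_left h2 (norm_nonneg _))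
    have h9 : (1 + q / a) ≤ (1 + q / a) ^ 2 := by nlinarith
    calc 2 * ‖S ζ‖ ≤ 2 * (‖S‖ * ((1 + a / c) * (1 + q / a))) := by linarith
      _ = 2 * (‖S‖ * (1 + a / c)) * (1 + q / a) := by ring
      _ ≤ 2 * (‖S‖ * (1 + a / c)) * (1 + q / a) ^ 2 :=
        mul_le_mul_of_nonneg_left h9 (by positivity)

theorem integrable_inner_grad_apply {C : Set Plane} {u : L2 C} {Du : L2Grad C}
    {F : Plane → Plane} (hF : IsBoundedC1Field C F) (S : Plane →L[ℝ] Plane) :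
    Integrable (fun x => ⟪S (u x), Du x (F x)⟫) (areaMeasure C) := by
  obtain ⟨K, hK⟩ := hF.bounded
  have h1 : Integrable (fun x => ‖u x‖ * ‖Du x‖) (areaMeasure C) :=
    (Lp.memLp u).norm.integrable_mul (Lp.memLp Du).norm
  refine ((h1.const_mul ‖S‖).mul_const |K|).mono' ?_ ?_
  · exact (S.continuous.comp_aestronglyMeasurable (Lp.aestronglyMeasurable u)).inner
      (isBoundedBilinearMap_apply.continuous.comp_aestronglyMeasurable₂
        (Lp.aestronglyMeasurable Du) hF.aestronglyMeasurable)
  · refine ae_restrict_of_forall_mem isOpen_interior.measurableSet fun x hx => ?_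
    refine (norm_inner_le_norm _ _).trans ?_
    calc ‖S (u x)‖ * ‖Du x (F x)‖ ≤ (‖S‖ * ‖u x‖) * (‖Du x‖ * |K|) := by
          refine mul_le_mul (S.le_opNorm _) (((Du x).le_opNorm _).trans ?_) (norm_nonneg _)
            (by positivity)
          exact mul_le_mul_of_nonneg_left ((hK x hx).trans (le_abs_self _)) (norm_nonneg _)
      _ = _ := by ring

/-- Transport does not lose energy: the boundary contributes with a sign because the deflection
vanishes on the leading edge, and the volume contributes with a sign because `div (p V) ≤ 0`. -/
theorem integral_inner_transport_nonneg {C : Set Plane} (hC : IsCompact C)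
    (hCbd : HasPiecewiseC1Boundary C) {V : Plane → Plane} (hV : ContDiff ℝ 1 V) {p : Plane → ℝ}
    (hp : ContDiffOn ℝ 1 p C) (hp0 : ∀ x ∈ C, 0 ≤ p x)
    (hdiv : ∀ x ∈ interior C, divergence (fun y => p y • V y) x ≤ 0)
    {S : Plane →L[ℝ] Plane} (hS : ∀ x y, ⟪S x, y⟫ = ⟪x, S y⟫)
    {c : ℝ} (hc : 0 < c) (hSc : ∀ ζ, c * ‖ζ‖ ^ 2 ≤ ⟪ζ, S ζ⟫) {u : L2 C} {Du : L2Grad C}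
    (hu : HasWeakDeriv C u Du) (htr : HasTraceOn C (leadingEdge C V) u Du fun _ => 0) :
    0 ≤ ∫ x in interior C, ⟪S (u x), Du x (p x • V x)⟫ := by
  have hS0 : ∀ ζ, 0 ≤ ⟪ζ, S ζ⟫ := fun ζ => le_trans (by positivity) (hSc ζ)
  have hF := isBoundedC1Field_smul hC hp hV
  have hint := integrable_inner_grad_apply (u := u) (Du := Du) hF S
  set I : Plane → ℝ := fun x => ⟪S (u x), Du x (p x • V x)⟫ with hI
  have hn : ∀ n : ℕ, 0 ≤ ∫ x in interior C,
      2 / (1 + ⟪u x, S (u x)⟫ / ((n : ℝ) + 1)) ^ 2 * I x := by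
    intro n
    have hn0 : (0 : ℝ) < (n : ℝ) + 1 := by positivity
    have := integral_fderiv_comp_nonneg hC hCbd hV.continuous hp.continuousOn hp0 hF hdiv
      (isBoundedC1_truncatedForm hS hc hSc hn0) (truncatedForm_nonneg hS0 hn0)
      (truncatedForm_le hS0 hn0) hu htr
    simpa only [fderiv_truncatedForm hS hS0 hn0] using this
  -- Raising the truncation height to infinity: the factor is at most 2 and tends to 2, and the
  -- integrand is integrable as a product of two `L²` functions.
  have hlim : Tendsto (fun n : ℕ => ∫ x in interior C,
      2 / (1 + ⟪u x, S (u x)⟫ / ((n : ℝ) + 1)) ^ 2 * I x) atTop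
      (𝓝 (∫ x in interior C, 2 * I x)) := by
    have hq : AEStronglyMeasurable (fun x => ⟪u x, S (u x)⟫) (areaMeasure C) :=
      (Lp.aestronglyMeasurable u).inner
        (S.continuous.comp_aestronglyMeasurable (Lp.aestronglyMeasurable u))
    refine tendsto_integral_of_dominated_convergence (fun x => 2 * ‖I x‖) (fun n => ?_)
      (hint.norm.const_mul 2) (fun n => Eventually.of_forall fun x => ?_)
      (Eventually.of_forall fun x => ?_)
    · refine AEStronglyMeasurable.mul ?_ hint.aestronglyMeasurable
      -- The absolute value keeps the denominator positive for every real `s`; it changes nothing on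
      -- the values of the nonnegative form.
      have hc : Continuous fun s : ℝ => 2 / (1 + |s| / ((n : ℝ) + 1)) ^ 2 := by
        refine continuous_const.div (by fun_prop) fun s => ?_
        positivity
      refine (hc.comp_aestronglyMeasurable hq).congr (Eventually.of_forall fun x => ?_)
      simp only [abs_of_nonneg (hS0 (u x))]
    · have h0 := hS0 (u x)
      rw [norm_mul, Real.norm_of_nonneg (by positivity)]
      refine mul_le_mul_of_nonneg_right ?_ (norm_nonneg _)
      refine div_le_self (by norm_num) (one_le_pow₀ (le_add_of_nonneg_right (by positivity)))
    · have h1 : Tendsto (fun n : ℕ => ⟪u x, S (u x)⟫ / ((n : ℝ) + 1)) atTop (𝓝 0) :=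
        tendsto_const_nhds.div_atTop
          (tendsto_atTop_add_const_right _ _ tendsto_natCast_atTop_atTop)
      have h2 : Tendsto (fun n : ℕ => 2 / (1 + ⟪u x, S (u x)⟫ / ((n : ℝ) + 1)) ^ 2) atTop
          (𝓝 (2 / (1 + 0) ^ 2)) :=
        tendsto_const_nhds.div ((tendsto_const_nhds.add h1).pow 2) (by norm_num)
      simpa using h2.mul_const (I x)
  have h2 := ge_of_tendsto' hlim hn
  rw [integral_const_mul] at h2
  linarith

end FrBD

end

/-! ### Matrix algebra and the local power balance -/

noncomputable section

namespace FrBD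

theorem inner_act_comm {A : Mat2} (hA : A.IsHermitian) (x y : Plane) :
    ⟪act A x, y⟫ = ⟪x, act A y⟫ := by
  have hT : A.transpose = A := by simpa [Matrix.IsHermitian] using hA
  rw [real_inner_comm, act, act, Matrix.inner_toEuclideanCLM, Matrix.inner_toEuclideanCLM,
    Matrix.dotProduct_mulVec, dotProduct_comm, ← Matrix.mulVec_transpose, hT]

theorem inner_act_pos {A : Mat2} (hA : A.PosDef) {x : Plane} (hx : x ≠ 0) :
    0 < ⟪x, act A x⟫ := by
  rw [act, Matrix.inner_toEuclideanCLM]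
  have h : x.ofLp ≠ 0 := fun h => hx (by ext i; simp [h])
  simpa using hA.dotProduct_mulVec_pos h

theorem inner_act_nonneg {A : Mat2} (hA : A.PosDef) (x : Plane) : 0 ≤ ⟪x, act A x⟫ := by
  rcases eq_or_ne x 0 with rfl | hx
  · simp
  · exact (inner_act_pos hA hx).le

/-- A positive definite matrix is coercive. -/
theorem exists_mul_norm_sq_le_inner_act {A : Mat2} (hA : A.PosDef) :
    ∃ c > 0, ∀ ζ : Plane, c * ‖ζ‖ ^ 2 ≤ ⟪ζ, act A ζ⟫ := by
  have hcont : Continuous fun ζ : Plane => ⟪ζ, act A ζ⟫ :=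
    continuous_id.inner (Matrix.toEuclideanCLM (𝕜 := ℝ) A).continuous
  obtain ⟨ζ₀, hζ₀, hmin⟩ := (isCompact_sphere (0 : Plane) 1).exists_isMinOn
    (NormedSpace.sphere_nonempty.2 zero_le_one) hcont.continuousOn
  have hζ₀' : ζ₀ ≠ 0 := by
    rintro rfl
    simp at hζ₀
  refine ⟨_, inner_act_pos hA hζ₀', fun ζ => ?_⟩
  rcases eq_or_ne ζ 0 with rfl | hζ
  · simp
  have hn : ‖ζ‖ ≠ 0 := norm_ne_zero_iff.2 hζ
  have h := hmin (a := ‖ζ‖⁻¹ • ζ) (by simp [norm_smul, hn])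
  have e : ⟪‖ζ‖⁻¹ • ζ, act A (‖ζ‖⁻¹ • ζ)⟫ = ⟪ζ, act A ζ⟫ / ‖ζ‖ ^ 2 := by
    simp only [act, map_smul, real_inner_smul_left, real_inner_smul_right]
    field_simp
  change ⟪ζ₀, act A ζ₀⟫ ≤ ⟪‖ζ‖⁻¹ • ζ, act A (‖ζ‖⁻¹ • ζ)⟫ at h
  rw [e, le_div_iff₀ (by positivity)] at h
  exact h

theorem posDef_sq {A : Mat2} (hA : A.PosDef) : (A ^ 2).PosDef := by
  have h := Matrix.PosDef.conjTranspose_mul_self A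
    (Matrix.mulVec_injective_of_isUnit hA.isUnit)
  rwa [hA.isHermitian.eq, ← sq] at h

theorem act_mul (A B : Mat2) (x : Plane) : act (A * B) x = act A (act B x) := by
  simp [act]

/-- The local power balance of the friction model: the power supplied by the slip velocity is at
least the power of the elastic force. -/
theorem inner_le_neg_inner_force_slip {D : FrictionData} (hS1 : D.S1.PosSemidef)
    (hMpos : ∀ y, (D.M y).PosDef) (hnrm : ∀ y, 0 ≤ D.nrm y) {V : ℝ} (hV : 0 < V)
    {z v w : Plane} (hw : w = act (D.SigmaMat V v) z + act (D.HMat V v) v) :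
    ⟪act D.S0 z, w⟫ + V * ⟪act D.S1 w, w⟫ ≤ -⟪act D.S0 z + V • act D.S1 w, v⟫ := by
  set y := V • v with hy
  set ν := D.nrm (act (D.M y) y) with hν
  have hν0 : 0 ≤ ν := hnrm _
  have hM2 : (D.M y ^ 2).PosDef := posDef_sq (hMpos y)
  have hG : (D.G y).PosDef := Matrix.PosDef.posSemidef_add (hS1.smul hν0) hM2
  have hGinv : D.G y * (D.G y)⁻¹ = 1 :=
    Matrix.mul_nonsing_inv _ ((Matrix.isUnit_iff_isUnit_det _).1 hG.isUnit)
  set f := act D.S0 z + V • act D.S1 w with hf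
  have h1 : act (D.G y) w = -((ν / V) • act D.S0 z) - act (D.M y ^ 2) v := by
    rw [hw, act, map_add, ← act, ← act, ← act_mul, ← act_mul, FrictionData.SigmaMat,
      FrictionData.HMat, ← hy, ← hν, mul_neg, mul_neg, Matrix.mul_smul, ← mul_assoc, ← mul_assoc,
      hGinv, one_mul, one_mul]
    simp only [act, map_neg, map_smul, neg_apply,
      smul_apply]
    rw [one_div_mul_eq_div, sub_eq_add_neg]
  have h2 : act (D.G y) w = ν • act D.S1 w + act (D.M y ^ 2) w := by
    simp only [FrictionData.G, act, map_add, map_smul, add_apply,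
      smul_apply, hν]
  -- Comparing the two expressions for `G w` moves the damping term to the other side, where it
  -- combines with the elastic term into the force.
  have h3 : act (D.M y ^ 2) (w + v) = -((ν / V) • f) := by
    have e : (ν / V) • V • act D.S1 w = ν • act D.S1 w := by
      rw [smul_smul, div_mul_cancel₀ _ hV.ne']
    have e2 : act (D.M y ^ 2) (w + v) = act (D.M y ^ 2) w + act (D.M y ^ 2) v := by
      simp [act]
    rw [e2, hf, smul_add, e]
    have h4 := h1.symm.trans h2
    have : act (D.M y ^ 2) w = -((ν / V) • act D.S0 z) - act (D.M y ^ 2) v - ν • act D.S1 w := by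
      rw [h4]; abel
    rw [this]; abel
  have h5 : ⟪f, w + v⟫ ≤ 0 := by
    have hq : ⟪w + v, act (D.M y ^ 2) (w + v)⟫ = -(ν / V * ⟪f, w + v⟫) := by
      rw [h3, inner_neg_right, real_inner_smul_right, real_inner_comm]
    -- If the norm vanishes, the identity gives no control of `f`, but definiteness of `M²` forces
    -- `w = -v`.
    rcases hν0.eq_or_lt with h0 | h0
    · have : w + v = 0 := by
        by_contra hne
        have := inner_act_pos hM2 hne
        rw [hq, ← h0] at this
        simp at this
      simp [this]
    · have hc : 0 < ν / V := div_pos h0 hV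
      have := inner_act_nonneg hM2 (w + v)
      rw [hq] at this
      nlinarith
  have h6 : ⟪f, w⟫ = ⟪act D.S0 z, w⟫ + V * ⟪act D.S1 w, w⟫ := by
    rw [hf, inner_add_left, real_inner_smul_left]
  rw [inner_add_right, h6] at h5
  linarith

/-- The viscous dissipation `V ⟪Σ₁ w, w⟫` is nonnegative and may be dropped; the left side is then
the density of `⟨Σ₀ z, dz/ds⟩`. -/
theorem inner_elastic_le_neg_inner_force_slip {D : FrictionData} (hS1 : D.S1.PosSemidef)
    (hMpos : ∀ y, (D.M y).PosDef) (hnrm : ∀ y, 0 ≤ D.nrm y) {V : ℝ} (hV : 0 < V)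
    {z v w : Plane} (hw : w = act (D.SigmaMat V v) z + act (D.HMat V v) v) :
    ⟪act D.S0 z, w⟫ ≤ -⟪act D.S0 z + V • act D.S1 w, v⟫ := by
  refine le_trans (le_add_of_nonneg_right (mul_nonneg hV.le ?_))
    (inner_le_neg_inner_force_slip hS1 hMpos hnrm hV hw)
  rw [real_inner_comm, act, Matrix.inner_toEuclideanCLM]
  simpa using hS1.dotProduct_mulVec_nonneg w.ofLp

end FrBD

end

/-! ### Multiplication operators and continuous curves in `L²` -/

noncomputable section

/-- Pointwise application of a bounded measurable field of linear maps, on `L²`. -/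
theorem MeasureTheory.Lp.exists_clm_apply_ae {α E F : Type*} [MeasurableSpace α] {μ : Measure α}
    [NormedAddCommGroup E] [NormedSpace ℝ E] [NormedAddCommGroup F] [NormedSpace ℝ F]
    {A : α → E →L[ℝ] F} (hA : AEStronglyMeasurable A μ) {K : ℝ} (hK : ∀ᵐ x ∂μ, ‖A x‖ ≤ K) :
    ∃ T : Lp E 2 μ →L[ℝ] Lp F 2 μ, ∀ u : Lp E 2 μ, T u =ᵐ[μ] fun x => A x (u x) := by
  have hA' := memLp_top_of_bound hA K hK
  refine ⟨(ContinuousLinearMap.id ℝ (E →L[ℝ] F)).holderL μ ⊤ 2 2 hA'.toLp, fun u => ?_⟩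
  filter_upwards [ContinuousLinearMap.coeFn_holder (r := 2)
    (ContinuousLinearMap.id ℝ (E →L[ℝ] F)) hA'.toLp u, hA'.coeFn_toLp] with x h1 h2
  rw [h2] at h1
  exact h1

namespace FrBD

/-- A jointly continuous field on a compact set defines a continuous curve in `L²`. -/
theorem exists_continuousOn_curve {C : Set Plane} (hC : IsCompact C) {v : Plane → ℝ → Plane}
    {S : ℝ} (hv : ContinuousOn (fun q : Plane × ℝ => v q.1 q.2) (C ×ˢ Icc 0 S)) :
    (∀ s ∈ Icc 0 S, MemLp (fun x => v x s) 2 (areaMeasure C)) ∧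
    ∃ y : ℝ → L2 C, ContinuousOn y (Icc 0 S) ∧
      ∀ s ∈ Icc 0 S, y s =ᵐ[areaMeasure C] fun x => v x s := by
  have := isFiniteMeasure_areaMeasure hC
  have hsub : interior C ⊆ C := interior_subset
  obtain ⟨K, hK⟩ := (hC.prod isCompact_Icc).exists_bound_of_continuousOn hv
  have hmem : ∀ s ∈ Icc 0 S, MemLp (fun x => v x s) 2 (areaMeasure C) := fun s hs => by
    refine MemLp.of_bound (ContinuousOn.aestronglyMeasurable ?_ isOpen_interior.measurableSet) K
      (ae_restrict_of_forall_mem isOpen_interior.measurableSet fun x hx => hK (x, s) ⟨hsub hx, hs⟩)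
    exact hv.comp (f := fun x => (x, s)) (by fun_prop) fun x hx => ⟨hsub hx, hs⟩
  refine ⟨hmem, ?_⟩
  classical
  refine ⟨fun s => if h : s ∈ Icc 0 S then (hmem s h).toLp else 0, ?_, fun s hs => ?_⟩
  swap
  · simp only [hs, dif_pos]
    exact (hmem s hs).coeFn_toLp
  have huc := (hC.prod isCompact_Icc).uniformContinuousOn_of_continuous hv
  rw [Metric.uniformContinuousOn_iff_le] at huc
  rw [Metric.continuousOn_iff]
  intro s hs ε hε
  -- The square root of the area: it converts the uniform bound from uniform continuity on `C × [0,
  -- S]` into an `L²` bound.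
  set B : ℝ := (measureUnivNNReal (areaMeasure C) : ℝ) ^ (2 : ENNReal).toReal⁻¹ with hB
  have hB0 : 0 ≤ B := by positivity
  obtain ⟨δ, hδ, h⟩ := huc (ε / (B + 1)) (by positivity)
  refine ⟨δ, hδ, fun t ht hts => ?_⟩
  simp only [hs, ht, dif_pos]
  rw [dist_eq_norm, ← MemLp.toLp_sub]
  have hle : ‖((hmem t ht).sub (hmem s hs)).toLp‖ ≤ B * (ε / (B + 1)) := by
    refine Lp.norm_le_of_ae_bound (by positivity) ?_
    filter_upwards [((hmem t ht).sub (hmem s hs)).coeFn_toLp,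
      ae_restrict_mem isOpen_interior.measurableSet] with x hx hxC
    rw [hx, Pi.sub_apply, ← dist_eq_norm]
    refine h (x, t) ⟨hsub hxC, ht⟩ (x, s) ⟨hsub hxC, hs⟩ ?_
    simpa [Prod.dist_eq] using hts.le
  refine hle.trans_lt ?_
  rw [← mul_div_assoc, div_lt_iff₀ (by positivity)]
  nlinarith

end FrBD

end

/-! ### The energy inequality -/

noncomputable section

namespace FrBD

theorem storedEnergy_nonneg {C : Set Plane} {D : FrictionData} (hS0 : D.S0.PosDef)
    {p : Plane → ℝ} (hp0 : ∀ x ∈ C, 0 ≤ p x) (ζ : L2 C) : 0 ≤ storedEnergy D C p ζ :=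
  mul_nonneg (by norm_num) (setIntegral_nonneg isOpen_interior.measurableSet fun x hx =>
    mul_nonneg (hp0 x (interior_subset hx)) (inner_act_nonneg hS0 _))

section Energy

variable {C : Set Plane} {p : Plane → ℝ} {S0 : Plane →L[ℝ] Plane} {T : L2 C →L[ℝ] L2 C}

theorem inner_weighted_eq (hT : ∀ u : L2 C, T u =ᵐ[areaMeasure C] fun x => p x • S0 (u x))
    (u w : L2 C) : ⟪T u, w⟫ = ∫ x in interior C, p x * ⟪S0 (u x), w x⟫ := by
  rw [L2.inner_def]
  refine integral_congr_ae ?_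
  filter_upwards [hT u] with x hx
  rw [hx, real_inner_smul_left]

/-- Symmetry of the weighted stiffness operator is what makes the derivative of the stored energy a
single pairing. -/
theorem inner_weighted_comm (hT : ∀ u : L2 C, T u =ᵐ[areaMeasure C] fun x => p x • S0 (u x))
    (hS : ∀ x y, ⟪S0 x, y⟫ = ⟪x, S0 y⟫) (u w : L2 C) : ⟪u, T w⟫ = ⟪T u, w⟫ := by
  rw [real_inner_comm, inner_weighted_eq hT, inner_weighted_eq hT]
  refine integral_congr_ae (Eventually.of_forall fun x => ?_)
  change p x * ⟪S0 (w x), u x⟫ = p x * ⟪S0 (u x), w x⟫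
  rw [hS, real_inner_comm]

end Energy

/-- A rolling contact model without spin in the deflection coefficient is passive as soon as the
transport velocity does not compress the vertical load. -/
theorem isPassiveWith_of_divergence_nonpos {C : Set Plane} (hC : IsCompact C)
    (hCbd : HasPiecewiseC1Boundary C) {D : FrictionData} (hS0 : D.S0.PosDef)
    (hS1 : D.S1.PosSemidef) (hMpos : ∀ y, (D.M y).PosDef) (hnrm : ∀ y, 0 ≤ D.nrm y)
    {Vmin Vmax : ℝ} (hVmin : 0 < Vmin) {p : Plane → ℝ} (hp : ContDiffOn ℝ 1 p C)
    (hp0 : ∀ x ∈ C, 0 ≤ p x) {mdl : RollingModel} (hV : ContDiff ℝ 1 mdl.transport)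
    (hcoeff : ∀ v Vr x s, mdl.coeff v Vr x s = D.SigmaMat (Vr s) (v x s))
    (hrel : ∀ v z x s, mdl.relVel v z x s = v x s)
    (hdiv : ∀ x ∈ interior C, divergence (fun y => p y • mdl.transport y) x ≤ 0) :
    IsPassiveWith D mdl C p Vmin Vmax (storedEnergy D C p) := by
  refine ⟨storedEnergy_nonneg hS0 hp0, fun v Vr hin S hSpos z₀ z Dz hz => ?_⟩
  set V := mdl.transport with hVdef
  have hsub : interior C ⊆ C := interior_subset
  have hmeas : MeasurableSet (interior C) := isOpen_interior.measurableSet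
  have hIcc : Icc 0 S ⊆ Ici 0 := fun s hs => hs.1
  obtain ⟨hvmem, vL, hvLc, hvL⟩ := exists_continuousOn_curve hC (S := S)
    (hin.slip_contDiffOn.continuousOn.mono (prod_mono le_rfl hIcc))
  obtain ⟨Kp, hKp⟩ := hC.exists_bound_of_continuousOn hp.continuousOn
  obtain ⟨KV, hKV⟩ := hC.exists_bound_of_continuousOn hV.continuous.continuousOn
  have hpm : AEStronglyMeasurable p (areaMeasure C) :=
    (hp.continuousOn.mono hsub).aestronglyMeasurable hmeas
  set A0 := Matrix.toEuclideanCLM (𝕜 := ℝ) D.S0 with hA0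
  set A1 := Matrix.toEuclideanCLM (𝕜 := ℝ) D.S1 with hA1
  -- the operators on `L²`
  obtain ⟨T0, hT0⟩ := Lp.exists_clm_apply_ae (μ := areaMeasure C) (A := fun _ => A0)
    aestronglyMeasurable_const (K := ‖A0‖) (Eventually.of_forall fun _ => le_rfl)
  obtain ⟨T1, hT1⟩ := Lp.exists_clm_apply_ae (μ := areaMeasure C) (A := fun _ => A1)
    aestronglyMeasurable_const (K := ‖A1‖) (Eventually.of_forall fun _ => le_rfl)
  obtain ⟨P, hP⟩ := Lp.exists_clm_apply_ae (μ := areaMeasure C)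
    (A := fun x => p x • ContinuousLinearMap.id ℝ Plane)
    (hpm.smul aestronglyMeasurable_const) (K := |Kp|)
    (ae_restrict_of_forall_mem hmeas fun x hx => by
      rw [norm_smul]
      refine (mul_le_of_le_one_right (norm_nonneg _) ContinuousLinearMap.norm_id_le).trans ?_
      exact (hKp x (hsub hx)).trans (le_abs_self _))
  obtain ⟨E, hE⟩ := Lp.exists_clm_apply_ae (μ := areaMeasure C)
    (A := fun x => ContinuousLinearMap.apply ℝ Plane (V x))
    ((ContinuousLinearMap.apply ℝ Plane).continuous.comp_aestronglyMeasurable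
      hV.continuous.aestronglyMeasurable) (K := |KV|)
    (ae_restrict_of_forall_mem hmeas fun x hx => by
      refine ContinuousLinearMap.opNorm_le_bound _ (abs_nonneg _) fun L => ?_
      rw [ContinuousLinearMap.apply_apply, mul_comm]
      exact (L.le_opNorm _).trans (mul_le_mul_of_nonneg_left
        ((hKV x (hsub hx)).trans (le_abs_self _)) (norm_nonneg _)))
  -- the curves in `L²`
  set z' : ℝ → L2 C := fun s => sDeriv S z s with hz'
  have hz'c : ContinuousOn z' (Icc 0 S) :=
    hz.contDiffOn.continuousOn_derivWithin (uniqueDiffOn_Icc hSpos) le_rfl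
  have hzc : ContinuousOn z (Icc 0 S) := hz.contDiffOn.continuousOn
  set wL : ℝ → L2 C := fun s => z' s + E (Dz s) with hwL
  set fL : ℝ → L2 C := fun s => T0 (z s) + Vr s • T1 (wL s) with hfL
  have hwLc : ContinuousOn wL (Icc 0 S) :=
    hz'c.add (E.continuous.comp_continuousOn hz.continuousOn_deriv)
  have hfLc : ContinuousOn fL (Icc 0 S) :=
    (T0.continuous.comp_continuousOn hzc).add
      ((hin.speed_contDiffOn.continuousOn.mono hIcc).smul (T1.continuous.comp_continuousOn hwLc))
  have hwae : ∀ s, wL s =ᵐ[areaMeasure C] totalDeriv V S z Dz s := fun s => by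
    filter_upwards [Lp.coeFn_add (z' s) (E (Dz s)), hE (Dz s)] with x h1 h2
    rw [h1, Pi.add_apply, h2]
    rfl
  have hfae : ∀ s, fL s =ᵐ[areaMeasure C] bristleForce D V Vr S z Dz s := fun s => by
    filter_upwards [Lp.coeFn_add (T0 (z s)) (Vr s • T1 (wL s)), hT0 (z s),
      Lp.coeFn_smul (Vr s) (T1 (wL s)), hT1 (wL s), hwae s] with x h1 h2 h3 h4 h5
    rw [h1, Pi.add_apply, h2, h3, Pi.smul_apply, h4, h5]
    rfl
  set g : ℝ → ℝ := fun s => powerSupply C p (bristleForce D V Vr S z Dz s) fun x => -v x s with hg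
  -- Written as a pairing of continuous `L²` curves, the supply is continuous in `s`, hence
  -- integrable.
  have hgeq : ∀ s ∈ Icc 0 S, g s = -⟪P (fL s), vL s⟫ := fun s hs => by
    rw [L2.inner_def, ← integral_neg]
    refine integral_congr_ae ?_
    filter_upwards [hP (fL s), hfae s, hvL s hs] with x h1 h2 h3
    rw [h1, h2, h3, inner_neg_right]
    rfl
  have hgc : ContinuousOn g (Icc 0 S) :=
    ((P.continuous.comp_continuousOn hfLc).inner hvLc).neg.congr hgeq
  have hgi : ∀ s ∈ Icc 0 S, IntervalIntegrable g volume 0 s := fun s hs =>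
    (hgc.mono (Icc_subset_Icc_right hs.2)).intervalIntegrable_of_Icc hs.1
  refine ⟨fun s hs => ⟨(memLp_congr_ae (hfae s)).1 (Lp.memLp _), hvmem s hs, ?_⟩,
    hgi S ⟨hSpos.le, le_rfl⟩, fun s hs => ⟨?_, ?_⟩⟩
  · simpa only [hrel] using hvmem s hs
  · simp only [hrel, hg]
  -- the energy inequality
  set T := P ∘L T0 with hTdef
  have hT : ∀ u : L2 C, T u =ᵐ[areaMeasure C] fun x => p x • A0 (u x) := fun u => by
    filter_upwards [hP (T0 u), hT0 u] with x h1 h2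
    rw [hTdef, ContinuousLinearMap.comp_apply, h1, h2]
    rfl
  have hsymm : ∀ x y, ⟪A0 x, y⟫ = ⟪x, A0 y⟫ := inner_act_comm hS0.isHermitian
  obtain ⟨c, hc, hcoer⟩ := exists_mul_norm_sq_le_inner_act hS0
  have hW : ∀ ζ : L2 C, storedEnergy D C p ζ = 1 / 2 * ⟪T ζ, ζ⟫ := fun ζ => by
    rw [storedEnergy, inner_weighted_eq hT]
    congr 1
    refine integral_congr_ae (Eventually.of_forall fun x => ?_)
    change p x * ⟪ζ x, A0 (ζ x)⟫ = p x * ⟪A0 (ζ x), ζ x⟫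
    rw [hsymm]
  -- The local power balance, weighted by `p` and integrated, bounds the pairing with the total
  -- derivative; the transport part of that pairing is nonnegative and can be discarded.
  have hrate : ∀ t ∈ Ioo 0 S, ⟪T (z t), z' t⟫ ≤ g t := fun t ht => by
    have ht' : t ∈ Icc 0 S := Ioo_subset_Icc_self ht
    have h1 := integral_inner_transport_nonneg hC hCbd hV hp hp0 hdiv hsymm hc hcoer
      (hz.weakDeriv t ht') (hz.boundary t ht)
    have h2 : ∫ x in interior C, ⟪A0 (z t x), Dz t x (p x • V x)⟫ = ⟪T (z t), E (Dz t)⟫ := by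
      rw [L2.inner_def]
      refine integral_congr_ae ?_
      filter_upwards [hT (z t), hE (Dz t)] with x h1 h2
      rw [h1, h2, map_smul, real_inner_smul_left, real_inner_smul_right]
      rfl
    have h3 : ⟪T (z t), wL t⟫ ≤ -⟪P (fL t), vL t⟫ := by
      rw [L2.inner_def, L2.inner_def, ← integral_neg]
      refine integral_mono_ae (L2.integrable_inner _ _) (L2.integrable_inner _ _).neg ?_
      filter_upwards [hT (z t), hP (fL t), hfae t, hvL t ht', hwae t, hz.pde t ht,
        ae_restrict_mem hmeas] with x h1 h2 h3 h4 h5 h6 hx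
      rw [hcoeff] at h6
      have h7 := inner_elastic_le_neg_inner_force_slip hS1 hMpos hnrm
        (hVmin.trans_le (hin.speed_mem t ht.1.le).1) h6
      change ⟪T (z t) x, wL t x⟫ ≤ -⟪P (fL t) x, vL t x⟫
      rw [h1, h2, h3, h4, h5, smul_apply, ContinuousLinearMap.id_apply, real_inner_smul_left,
        real_inner_smul_left, ← mul_neg]
      exact mul_le_mul_of_nonneg_left h7 (hp0 x (hsub hx))
    rw [hgeq t ht']
    rw [hwL, inner_add_right] at h3
    rw [h2] at h1
    linarith
  have hTc : ContinuousOn (fun t => T (z t)) (Icc 0 S) := T.continuous.comp_continuousOn hzc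
  have hderiv : ∀ t ∈ Ioo 0 S, HasDerivAt (fun t => storedEnergy D C p (z t)) ⟪T (z t), z' t⟫ t :=
    fun t ht => by
    have hzd : HasDerivAt z (z' t) t :=
      (((hz.contDiffOn.differentiableOn one_ne_zero) t
        (Ioo_subset_Icc_self ht)).hasDerivWithinAt).hasDerivAt (Icc_mem_nhds ht.1 ht.2)
    have hTd : HasDerivAt (fun t => T (z t)) (T (z' t)) t := T.hasFDerivAt.comp_hasDerivAt t hzd
    have h := (hTd.inner ℝ hzd).const_mul (1 / 2)
    simp_rw [hW]
    refine h.congr_deriv ?_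
    rw [← inner_weighted_comm hT hsymm (z' t) (z t), real_inner_comm (T (z t))]
    ring
  have hs' : Icc 0 s ⊆ Icc 0 S := Icc_subset_Icc_right hs.2
  have hWc : ContinuousOn (fun t => storedEnergy D C p (z t)) (Icc 0 s) := by
    simp_rw [hW]
    exact (continuousOn_const.mul (hTc.inner hzc)).mono hs'
  have hri : IntervalIntegrable (fun t => ⟪T (z t), z' t⟫) volume 0 s :=
    ((hTc.inner hz'c).mono hs').intervalIntegrable_of_Icc hs.1
  -- The equation and the boundary condition hold only at interior times, so the fundamental theorem
  -- is used with continuity up to the end points and differentiability inside.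
  have hFTC := intervalIntegral.integral_eq_sub_of_hasDerivAt_of_le hs.1 hWc
    (fun t ht => hderiv t ⟨ht.1, ht.2.trans_le hs.2⟩) hri
  rw [← hz.initial, ← hFTC]
  exact intervalIntegral.integral_mono_on_of_le_Ioo hs.1 hri (hgi s hs)
    fun t ht => hrate t ⟨ht.1, ht.2.trans_le hs.2⟩

theorem contDiff_transport_standardModel (D : FrictionData) :
    ContDiff ℝ 1 (standardModel D).transport := contDiff_const

theorem contDiff_transport_largeSpinModel (D : FrictionData) (ε : Plane) (φ₁ : ℝ) (φ₂ : ℝ → ℝ) :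
    ContDiff ℝ 1 (largeSpinModel D ε φ₁ φ₂).transport :=
  contDiff_const.add (Matrix.toEuclideanCLM (𝕜 := ℝ) !![0, φ₁; -φ₁, 0]).contDiff

theorem spinMat_zero : spinMat 0 = 0 := by
  ext i j
  fin_cases i <;> fin_cases j <;> simp [spinMat]

end FrBD

end

/-! ### The two rolling contact models -/

theorem lemma2
    (C : Set FrBD.Plane) (hC : IsCompact C) (hCbd : FrBD.HasPiecewiseC1Boundary C)
    (D : FrBD.FrictionData)
    (hS0 : D.S0.PosDef) (hS1 : D.S1.PosSemidef)
    (hMpos : ∀ y, (D.M y).PosDef) (hMcont : Continuous D.M)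
    (hnrm_nonneg : ∀ y, 0 ≤ D.nrm y) (hnrm_cont : Continuous D.nrm)
    (Vmin Vmax : ℝ) (hVmin : 0 < Vmin) (hVmax : Vmin ≤ Vmax)
    (p : FrBD.Plane → ℝ) (hp : ContDiffOn ℝ 1 p C) (hp_nonneg : ∀ x ∈ C, 0 ≤ p x)
    (hQ : ∀ y u : FrBD.Plane,
      0 ≤ inner ℝ u (FrBD.act (D.M y ^ 2 * (D.G y)⁻¹ * D.S1) u)) :
    ((∀ x ∈ interior C,
        FrBD.divergence (fun y => p y • (FrBD.standardModel D).transport y) x ≤ 0) →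
      FrBD.IsPassiveWith D (FrBD.standardModel D) C p Vmin Vmax (FrBD.storedEnergy D C p)) ∧
    (∀ (ε : FrBD.Plane) (φ₁ : ℝ), ‖ε‖ = 1 →
      (∀ x ∈ interior C, FrBD.divergence
        (fun y => p y • (FrBD.largeSpinModel D ε φ₁ (fun _ => 0)).transport y) x ≤ 0) →
      FrBD.IsPassiveWith D (FrBD.largeSpinModel D ε φ₁ (fun _ => 0)) C p Vmin Vmax
        (FrBD.storedEnergy D C p)) := by
  refine ⟨fun hdiv => ?_, fun ε φ₁ _ hdiv => ?_⟩
  · exact FrBD.isPassiveWith_of_divergence_nonpos hC hCbd hS0 hS1 hMpos hnrm_nonneg hVmin hp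
      hp_nonneg (FrBD.contDiff_transport_standardModel D) (fun _ _ _ _ => rfl)
      (fun _ _ _ _ => rfl) hdiv
  · exact FrBD.isPassiveWith_of_divergence_nonpos hC hCbd hS0 hS1 hMpos hnrm_nonneg hVmin hp
      hp_nonneg (FrBD.contDiff_transport_largeSpinModel D ε φ₁ _)
      -- With `φ₂ = 0` the spin matrix vanishes, so the coefficient and the relative velocity reduce
      -- to those of the standard model; only the transport velocity differs.
      (fun _ _ _ _ => by simp [FrBD.largeSpinModel, FrBD.spinMat_zero])
      (fun _ _ _ _ => by simp [FrBD.largeSpinModel, FrBD.spinMat_zero, FrBD.act]) hdiv
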